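/- Let $T,N\ge 1$ be integers, $\beta\in(0,1)$, $\Delta_l=2^{-l}$, and let $\Theta\subseteq\mathbb{R}^d$ carry a $\sigma$-finite measure $d\theta$ and a prior probability density $\pi$. Let $W$ be a Brownian motion relative to a filtration and, for each $\theta\in\Theta$, let $V=V^{\theta}$ solve the Volterra equation $$V_t=v_0+\int_0^tK(t-s)b_\theta(V_s)\,ds+\int_0^tK(t-s)\sigma_\theta(V_s)\,dW_s,\qquad t\in[0,T],$$ where $(\theta,v)\mapsto b_\theta(v),\sigma_\theta(v)$ are measurable, $|b_\theta(v)|+|\sigma_\theta(v)|\le c(1+|v|)$ with $c$ independent of $\theta$, and for some $c$ one has $|K(t)|\le c\,t^{\beta-1/2}$ and $|K(t)-K(s)|\le c\,(t-s)s^{\beta-3/2}$ for $0<s\le t\le T$ (for instance $K(t)=Ct^{H}$ with $H\in[0,1/2)$, $\beta=H+1/2$). For increments $\overline w_{j}$ on the grid of step $\Delta_l$, the Euler scheme is $V^l_0=v_0$, $$V^l_{(k+1)\Delta_l}=v_0+\sum_{j=0}^kK((k+1-j)\Delta_l)\{b_\theta(V^l_{j\Delta_l})\Delta_l+\sigma_\theta(V^l_{j\Delta_l})\overline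 w_{(j+1)\Delta_l}\}.$$ Given observations $y_0,\dots,y_T\in\mathsf Y$, put, for $t=1,\dots,T$, $$\kappa_{t,l}=\overline g\Big(y_t;y_{t-1},\Delta_l\sum_{k=0}^{2^l-1}\overline f(V^l_{t-1+k\Delta_l}),\sum_{k=0}^{2^l-1}\overline h(V^l_{t-1+k\Delta_l})\,\overline w_{t-1+(k+1)\Delta_l}\Big).$$ Let $\pi^l$ be the probability law of $(\theta,\overline w)$ proportional to $\prod_{t=1}^T\kappa_{t,l}\;\pi(\theta)d\theta$ times the law of independent $\mathcal N(0,\Delta_l)$ increments $\overline w_{\Delta_l},\dots,\overline w_T$. For $l\ge1$, the delta particle filter with $N$ particles simulates increments at level $l$; the increments at level $l-1$ are sums of two consecutive ones. Particles are resampled at times $1,\dots,T-1$, and one trajectory is selected at time $T$, with probabilities proportional to the weights $\max\{\kappa_{t,l},\kappa_{t,l-1}\}$; the filter returns the selected trajectory and $\hat p=\prod_{t=1}^T\frac1N\sum_{i=1}^N\max\{\kappa^i_{t,l},\kappa^i_{t,l-1}\}$. Coupled MCMC at level $l$ is the Markov chain whose state is a parameter together with all random variables of one run of the filter, and whose kernel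 $K_l$ is: propose $\theta'$ from a density $q_l(\theta'|\theta)$, run the filter with $\theta'$, and accept with probability $\min\{1,\frac{\hat p'\,\pi(\theta')\,q_l(\theta|\theta')}{\hat p\,\pi(\theta)\,q_l(\theta'|\theta)}\}$. With $H_{1,l}=\prod_{t=1}^T\frac{\kappa_{t,l}}{\max\{\kappa_{t,l},\kappa_{t,l-1}\}}$ and $H_{2,l}=\prod_{t=1}^T\frac{\kappa_{t,l-1}}{\max\{\kappa_{t,l},\kappa_{t,l-1}\}}$, the level-difference estimator from the states $0,\dots,M$ of the chain is $$\widehat D_l^{M}(\varphi)=\frac{\sum_{k=0}^M\varphi(\theta_k,V^l_{k,1:T})H_{1,l}^{(k)}}{\sum_{k=0}^MH_{1,l}^{(k)}}-\frac{\sum_{k=0}^M\varphi(\theta_k,V^{l-1}_{k,1:T})H_{2,l}^{(k)}}{\sum_{k=0}^MH_{2,l}^{(k)}}.$$ Assume: (A1) $\overline f,\overline h:\mathbb R\to\mathbb R$ are bounded and Lipschitz, and for all $y,y'\in\mathsf Y$ the function $(x_1,x_2)\mapsto\overline g(y;y',x_1,x_2)$ is Lipschitz and takes values in some $[\underline C,\overline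 C]$ with $0<\underline C\le\overline C<\infty$. (A2) For every $r\in[1,2]$ there is $C<\infty$ such that $\sup_{\theta\in\Theta}\mathbb E[|V^l_t-V_t|^r]^{1/r}\le C\Delta_l^\beta$ for all $l\ge0$ and $t\in\{\Delta_l,2\Delta_l,\dots,T\}$, where $V^l$ is driven by the increments of $W$. (A3) There is $\xi\in(0,1)$ such that for every $l\ge1$ there is a probability measure $\nu_l$ with $K_l(w,\cdot)\ge\xi\nu_l$ for all states $w$, and $K_l$ is reversible with respect to a probability measure $\eta_l$. Assume that for each $l\geq 1$ the chain is started in stationarity, i.e. from $\eta_l$. Then for every $\varphi:\Theta\times\mathbb R^T\to\mathbb R$ that is bounded and Lipschitz (for the $L_1$ distance) there is $C<\infty$ such that for all integers $l,M_l\ge1$ the estimator is integrable and $$\Big|\mathbb E\Big[\widehat D_l^{M_l}(\varphi)-\big\{\mathbb E_{\pi^l}[\varphi(\theta,V^l_{1:T})]-\mathbb E_{\pi^{l-1}}[\varphi(\theta,V^{l-1}_{1:T})]\big\}\Big]\Big|\le\frac{C\Delta_l^{\beta}}{M_l}.$$ -/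

import Mathlib

open MeasureTheory ProbabilityTheory Filter Topology
open scoped NNReal ENNReal

namespace VolterraMCMC

noncomputable section

/-! ### Itô integrals and Volterra equations -/

/-- A simple predictable integrand `∑ i < n, ξ i · 1_(τ i, τ (i+1)]`, with bounded `ξ i` that are
measurable with respect to the filtration at time `τ i`. -/
structure SimpleIntegrand {Ω : Type*} {mΩ : MeasurableSpace Ω} (ℱ : Filtration ℝ≥0 mΩ) where
  n : ℕ
  τ : ℕ → ℝ≥0
  mono : Monotone τ
  ξ : ℕ → Ω → ℝ
  meas : ∀ i, Measurable[ℱ (τ i)] (ξ i)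
  bdd : ∀ i, ∃ c : ℝ, ∀ ω, |ξ i ω| ≤ c

/-- The value of a simple integrand at time `s`. -/
def SimpleIntegrand.eval {Ω : Type*} {mΩ : MeasurableSpace Ω} {ℱ : Filtration ℝ≥0 mΩ}
    (S : SimpleIntegrand ℱ) (s : ℝ≥0) (ω : Ω) : ℝ :=
  ∑ i ∈ Finset.range S.n, (Set.Ioc (S.τ i) (S.τ (i + 1))).indicator (fun _ => S.ξ i ω) s

/-- The elementary stochastic integral of a simple integrand over `[0, t]`. -/
def SimpleIntegrand.integral {Ω : Type*} {mΩ : MeasurableSpace Ω} {ℱ : Filtration ℝ≥0 mΩ}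
    (S : SimpleIntegrand ℱ) (W : ℝ≥0 → Ω → ℝ) (t : ℝ≥0) (ω : Ω) : ℝ :=
  ∑ i ∈ Finset.range S.n, S.ξ i ω * (W (min (S.τ (i + 1)) t) ω - W (min (S.τ i) t) ω)

/-- `I` is the Itô integral `∫_0^t X_s dW_s`: there are simple integrands that converge to `X` in
`L²([0, t])`, in probability, and whose elementary integrals converge to `I` in probability. -/
def HasItoIntegral {Ω : Type*} {mΩ : MeasurableSpace Ω} (P : Measure Ω) (ℱ : Filtration ℝ≥0 mΩ)
    (W X : ℝ≥0 → Ω → ℝ) (t : ℝ≥0) (I : Ω → ℝ) : Prop :=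
  ∃ S : ℕ → SimpleIntegrand ℱ,
    (∀ ε : ℝ≥0∞, 0 < ε → Tendsto (fun n => P {ω | ε ≤ ∫⁻ s in Set.Ioc (0 : ℝ) t,
      ENNReal.ofReal (((S n).eval s.toNNReal ω - X s.toNNReal ω) ^ 2)}) atTop (𝓝 0)) ∧
    TendstoInMeasure P (fun n => (S n).integral W t) atTop I

/-- `W` is a standard Brownian motion relative to the filtration `ℱ`. -/
structure IsBrownianWrt {Ω : Type*} {mΩ : MeasurableSpace Ω} (P : Measure Ω)
    (ℱ : Filtration ℝ≥0 mΩ) (W : ℝ≥0 → Ω → ℝ) : Prop where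
  brownian : IsBrownianReal W P
  adapted : Adapted ℱ W
  indep : ∀ s t : ℝ≥0, s ≤ t →
    Indep (MeasurableSpace.comap (fun ω => W t ω - W s ω) inferInstance) (ℱ s) P

/-- `V` solves `V_t = v₀ + ∫_0^t K(t-s) b(V_s) ds + ∫_0^t K(t-s) σ(V_s) dW_s` on `[0, T]`. -/
structure IsVolterraSolution {Ω : Type*} {mΩ : MeasurableSpace Ω} (P : Measure Ω)
    (ℱ : Filtration ℝ≥0 mΩ) (W : ℝ≥0 → Ω → ℝ) (T : ℕ) (K b σ : ℝ → ℝ) (v₀ : ℝ)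
    (V : ℝ≥0 → Ω → ℝ) : Prop where
  adapted : Adapted ℱ V
  measurable : Measurable (Function.uncurry V)
  integrable : ∀ t : ℝ≥0, t ≤ T → ∀ᵐ ω ∂P,
    IntegrableOn (fun s : ℝ => K (t - s) * b (V s.toNNReal ω)) (Set.Ioc 0 (t : ℝ))
  eq : ∀ t : ℝ≥0, t ≤ T → ∃ I : Ω → ℝ,
    HasItoIntegral P ℱ W (fun s ω => K ((t : ℝ) - s) * σ (V s ω)) t I ∧
    ∀ᵐ ω ∂P, V t ω = v₀ + (∫ s in Set.Ioc 0 (t : ℝ), K (t - s) * b (V s.toNNReal ω)) + I ω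

/-! ### The model and its Euler discretization -/

/-- The step size `Δ_l = 2^{-l}`. -/
def step (l : ℕ) : ℝ≥0 := 2⁻¹ ^ l

/-- The Euler scheme with step `Δ`; `w j` is the Brownian increment over `[jΔ, (j+1)Δ]` and the
`k`-th value approximates the process at time `kΔ`. -/
def euler (K b σ : ℝ → ℝ) (v₀ Δ : ℝ) (w : ℕ → ℝ) : ℕ → ℝ
  | 0 => v₀
  | k + 1 => v₀ + ∑ j : Fin (k + 1), K (((k : ℝ) + 1 - (j.1 : ℝ)) * Δ) *
      (b (euler K b σ v₀ Δ w j.1) * Δ + σ (euler K b σ v₀ Δ w j.1) * w j.1)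
  termination_by k => k
  decreasing_by all_goals exact j.2

/-- Increments on the grid of step `Δ_{l-1}` from those on the grid of step `Δ_l`. -/
def coarsen (w : ℕ → ℝ) (j : ℕ) : ℝ := w (2 * j) + w (2 * j + 1)

/-- The data of the model: Volterra kernel `K`, drift `b`, diffusion coefficient `σ`, initial value
`v₀`, the functions `f`, `h`, `g` in the observation density
`g (y_t; y_{t-1}, ∫ f(V_s) ds, ∫ h(V_s) dW_s)`, the observations `y 0, y 1, …`, the dominating
measure `dθ` on the parameter space and the prior density. -/
structure Model {d : ℕ} (Θ : Set (Fin d → ℝ)) (Y : Type*) where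
  K : ℝ → ℝ
  b : Θ → ℝ → ℝ
  σ : Θ → ℝ → ℝ
  v₀ : ℝ
  f : ℝ → ℝ
  h : ℝ → ℝ
  g : Y → Y → ℝ → ℝ → ℝ
  y : ℕ → Y
  dθ : Measure Θ
  prior : Θ → ℝ≥0

namespace Model

variable {d : ℕ} {Θ : Set (Fin d → ℝ)} {Y : Type*} (𝓜 : Model Θ Y)

/-- Standing conditions: a proper prior density with respect to a σ-finite measure, measurable
coefficients of linear growth uniformly in the parameter, and a kernel on `(0, T]` that is at least
as regular as `t ^ (β - 1/2)`. -/
structure IsRegular (T : ℕ) (β : ℝ) : Prop where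
  sigmaFinite : SigmaFinite 𝓜.dθ
  prior_meas : Measurable 𝓜.prior
  prior_proper : ∫⁻ θ, (𝓜.prior θ : ℝ≥0∞) ∂𝓜.dθ = 1
  b_meas : Measurable (Function.uncurry 𝓜.b)
  σ_meas : Measurable (Function.uncurry 𝓜.σ)
  growth : ∃ c : ℝ, ∀ θ v, |𝓜.b θ v| + |𝓜.σ θ v| ≤ c * (1 + |v|)
  kernel : ∃ c : ℝ, (∀ t : ℝ, 0 < t → t ≤ T → |𝓜.K t| ≤ c * t ^ (β - 1 / 2)) ∧
    ∀ s t : ℝ, 0 < s → s ≤ t → t ≤ T → |𝓜.K t - 𝓜.K s| ≤ c * (t - s) * s ^ (β - 3 / 2)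

/-- The Euler approximation of the Volterra process at level `l`. -/
def vol (l : ℕ) (θ : Θ) (w : ℕ → ℝ) : ℕ → ℝ :=
  euler 𝓜.K (𝓜.b θ) (𝓜.σ θ) 𝓜.v₀ (step l) w

/-- The Euler approximations `(V^l_1, …, V^l_T)` at the observation times. -/
def skeleton (T l : ℕ) (θ : Θ) (w : ℕ → ℝ) (t : Fin T) : ℝ :=
  𝓜.vol l θ w ((t.1 + 1) * 2 ^ l)

/-- The discretized likelihood factor of the observation at time `t + 1`. -/
def lik (l t : ℕ) (θ : Θ) (w : ℕ → ℝ) : ℝ :=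
  𝓜.g (𝓜.y (t + 1)) (𝓜.y t)
    ((step l : ℝ) * ∑ k ∈ Finset.range (2 ^ l), 𝓜.f (𝓜.vol l θ w (t * 2 ^ l + k)))
    (∑ k ∈ Finset.range (2 ^ l), 𝓜.h (𝓜.vol l θ w (t * 2 ^ l + k)) * w (t * 2 ^ l + k))

/-- The maximum of the likelihood factors at levels `l` and `l - 1`; `w` are the fine increments. -/
def maxLik (l t : ℕ) (θ : Θ) (w : ℕ → ℝ) : ℝ :=
  max (𝓜.lik l t θ w) (𝓜.lik (l - 1) t θ (coarsen w))

/-- The correction factor `H_{1,l}`. -/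
def H₁ (T l : ℕ) (θ : Θ) (w : ℕ → ℝ) : ℝ :=
  ∏ t ∈ Finset.range T, 𝓜.lik l t θ w / 𝓜.maxLik l t θ w

/-- The correction factor `H_{2,l}`. -/
def H₂ (T l : ℕ) (θ : Θ) (w : ℕ → ℝ) : ℝ :=
  ∏ t ∈ Finset.range T, 𝓜.lik (l - 1) t θ (coarsen w) / 𝓜.maxLik l t θ w

/-! ### The posterior at level `l` -/

/-- A finite vector of increments, continued by zero. -/
def extend {n : ℕ} (w : Fin n → ℝ) (j : ℕ) : ℝ := if hj : j < n then w ⟨j, hj⟩ else 0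

/-- The unnormalized posterior of the parameter and of the Brownian increments on `[0, T]`. -/
def unnormPosterior (T l : ℕ) : Measure (Θ × (Fin (T * 2 ^ l) → ℝ)) :=
  ((𝓜.dθ.withDensity (fun θ => (𝓜.prior θ : ℝ≥0∞))).prod
    (Measure.pi (fun _ => gaussianReal 0 (step l)))).withDensity
    (fun p => ENNReal.ofReal (∏ t ∈ Finset.range T, 𝓜.lik l t p.1 (extend p.2)))

/-- The posterior `π^l`. -/
def posterior (T l : ℕ) : Measure (Θ × (Fin (T * 2 ^ l) → ℝ)) :=
  (𝓜.unnormPosterior T l Set.univ)⁻¹ • 𝓜.unnormPosterior T l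

/-- The posterior expectation `E_{π^l}[φ(θ, V_{1:T})]`. -/
def posteriorExp (T l : ℕ) (φ : Θ → (Fin T → ℝ) → ℝ) : ℝ :=
  ∫ p, φ p.1 (𝓜.skeleton T l p.1 (extend p.2)) ∂(𝓜.posterior T l)

/-! ### The delta particle filter -/

/-- The random variables of one run of the delta particle filter with `N` particles at level `l`:
the fine increments of every particle on every unit interval, the ancestor indices drawn at the
times `1, …, T - 1`, and the index of the trajectory selected at time `T`. The coarse increments
are sums of consecutive fine ones. -/
abbrev Particles (T N l : ℕ) : Type :=
  (Fin T → Fin N → Fin (2 ^ l) → ℝ) × (Fin (T - 1) → Fin N → Fin N) × Fin N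

/-- The `k`-th increment generated for particle `i` on the `t`-th unit interval (zero outside the
index range). -/
def inc {T N l : ℕ} (u : Particles T N l) (t : ℕ) (i : Fin N) (k : ℕ) : ℝ :=
  if ht : t < T then if hk : k < 2 ^ l then u.1 ⟨t, ht⟩ i ⟨k, hk⟩ else 0 else 0

/-- The ancestor, in generation `t`, of particle `i` of generation `t + 1`. -/
def anc {T N l : ℕ} (u : Particles T N l) (t : ℕ) (i : Fin N) : Fin N :=
  if ht : t < T - 1 then u.2.1 ⟨t, ht⟩ i else i

/-- The fine trajectory on `[0, t + 1]` of particle `i` of generation `t`: the resampled trajectory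
of its ancestor, followed by new increments. -/
def path {T N l : ℕ} (u : Particles T N l) : ℕ → Fin N → ℕ → ℝ
  | 0, i, j => inc u 0 i j
  | t + 1, i, j => if j < (t + 1) * 2 ^ l then path u t (anc u t i) j
      else inc u (t + 1) i (j - (t + 1) * 2 ^ l)

/-- The trajectory that the filter returns. -/
def output {T N l : ℕ} (u : Particles T N l) : ℕ → ℝ := path u (T - 1) u.2.2

/-- The unnormalized weight of particle `i` in generation `t`. -/
def weight {T N l : ℕ} (θ : Θ) (u : Particles T N l) (t : ℕ) (i : Fin N) : ℝ :=
  𝓜.maxLik l t θ (path u t i)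

/-- The normalized weight of particle `i` in generation `t`. -/
def normWeight {T N l : ℕ} (θ : Θ) (u : Particles T N l) (t : ℕ) (i : Fin N) : ℝ :=
  𝓜.weight θ u t i / ∑ j, 𝓜.weight θ u t j

/-- The normalizing constant estimate that the filter returns. -/
def normConst {T N l : ℕ} (θ : Θ) (u : Particles T N l) : ℝ :=
  ∏ t ∈ Finset.range T, (1 / (N : ℝ)) * ∑ i, 𝓜.weight θ u t i

/-- The reference measure: independent centred Gaussian increments of variance `Δ_l`, and counting
measure on the indices. -/
def particleRef (T N l : ℕ) : Measure (Particles T N l) :=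
  (Measure.pi (fun _ => Measure.pi (fun _ => Measure.pi (fun _ => gaussianReal 0 (step l))))).prod
    (Measure.count.prod Measure.count)

/-- The density of the law of the random variables of the filter: the resampling and the final
selection pick index `j` with probability the normalized weight of `j`. -/
def filterDensity {T N l : ℕ} (θ : Θ) (u : Particles T N l) : ℝ :=
  (∏ t : Fin (T - 1), ∏ i, 𝓜.normWeight θ u t.1 (u.2.1 t i)) * 𝓜.normWeight θ u (T - 1) u.2.2

/-! ### Coupled MCMC -/

end Model

/-- The state space of the coupled MCMC chain: a parameter and the random variables of a run of the
delta particle filter. -/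
abbrev State {d : ℕ} (Θ : Set (Fin d → ℝ)) (T N l : ℕ) : Type := Θ × Model.Particles T N l

/-- `q θ θ'` is a (jointly measurable) probability density in `θ'`. -/
structure IsProposal {α : Type*} [MeasurableSpace α] (μ : Measure α) (q : α → α → ℝ≥0) :
    Prop where
  meas : Measurable (Function.uncurry q)
  mass : ∀ θ, ∫⁻ θ', (q θ θ' : ℝ≥0∞) ∂μ = 1

namespace Model

variable {d : ℕ} {Θ : Set (Fin d → ℝ)} {Y : Type*} (𝓜 : Model Θ Y)

/-- The proposal from state `x`: draw `θ'` from the density `q (x.1)` and run the filter with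
parameter `θ'`. -/
def proposal {T N l : ℕ} (q : Θ → Θ → ℝ≥0) (x : State Θ T N l) : Measure (State Θ T N l) :=
  (𝓜.dθ.prod (particleRef T N l)).withDensity
    (fun x' => (q x.1 x'.1 : ℝ≥0∞) * ENNReal.ofReal (𝓜.filterDensity x'.1 x'.2))

/-- The probability of accepting `x'` from `x`; as usual it is `1` if the denominator vanishes. -/
def accept {T N l : ℕ} (q : Θ → Θ → ℝ≥0) (x x' : State Θ T N l) : ℝ :=
  if 𝓜.normConst x.1 x.2 * 𝓜.prior x.1 * q x.1 x'.1 = 0 then 1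
  else min 1 ((𝓜.normConst x'.1 x'.2 * 𝓜.prior x'.1 * q x'.1 x.1) /
    (𝓜.normConst x.1 x.2 * 𝓜.prior x.1 * q x.1 x'.1))

/-- The Markov transition `K_l(x, ·)` of one iteration of coupled MCMC: an accepted proposal
replaces the state, otherwise the state is kept. -/
def transition {T N l : ℕ} (q : Θ → Θ → ℝ≥0) (x : State Θ T N l) : Measure (State Θ T N l) :=
  (𝓜.proposal q x).withDensity (fun x' => ENNReal.ofReal (𝓜.accept q x x')) +
    (1 - ∫⁻ x', ENNReal.ofReal (𝓜.accept q x x') ∂(𝓜.proposal q x)) • Measure.dirac x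

/-- The estimator of `E_{π^l}[φ] - E_{π^{l-1}}[φ]` from the states `x 0, …, x m`. -/
def estimator {T N l : ℕ} (φ : Θ → (Fin T → ℝ) → ℝ) (m : ℕ) (x : ℕ → State Θ T N l) : ℝ :=
  (1 / ((m : ℝ) + 1) * ∑ k ∈ Finset.range (m + 1),
      φ (x k).1 (𝓜.skeleton T l (x k).1 (output (x k).2)) *
        𝓜.H₁ T l (x k).1 (output (x k).2)) /
    (1 / ((m : ℝ) + 1) * ∑ k ∈ Finset.range (m + 1), 𝓜.H₁ T l (x k).1 (output (x k).2)) -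
  (1 / ((m : ℝ) + 1) * ∑ k ∈ Finset.range (m + 1),
      φ (x k).1 (𝓜.skeleton T (l - 1) (x k).1 (coarsen (output (x k).2))) *
        𝓜.H₂ T l (x k).1 (output (x k).2)) /
    (1 / ((m : ℝ) + 1) * ∑ k ∈ Finset.range (m + 1), 𝓜.H₂ T l (x k).1 (output (x k).2))

/-! ### Assumptions -/

/-- (A1): regularity of the observation density. -/
structure A1 : Prop where
  f_lip : ∃ L : ℝ≥0, LipschitzWith L 𝓜.f
  f_bdd : ∃ c : ℝ, ∀ x, |𝓜.f x| ≤ c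
  h_lip : ∃ L : ℝ≥0, LipschitzWith L 𝓜.h
  h_bdd : ∃ c : ℝ, ∀ x, |𝓜.h x| ≤ c
  g_lip : ∀ y y', ∃ c : ℝ, ∀ x₁ x₂ x₁' x₂',
    |𝓜.g y y' x₁ x₂ - 𝓜.g y y' x₁' x₂'| ≤ c * (|x₁ - x₁'| + |x₂ - x₂'|)
  g_bdd : ∀ y y', ∃ c c' : ℝ, 0 < c ∧ ∀ x₁ x₂, c ≤ 𝓜.g y y' x₁ x₂ ∧ 𝓜.g y y' x₁ x₂ ≤ c'

/-- (A2): the Euler scheme driven by `W` converges to `V` with strong rate `β`, uniformly in the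
parameter. -/
def A2 {Ω : Type*} {mΩ : MeasurableSpace Ω} (P : Measure Ω) (W : ℝ≥0 → Ω → ℝ)
    (V : Θ → ℝ≥0 → Ω → ℝ) (T : ℕ) (β : ℝ) : Prop :=
  ∀ r : ℝ, 1 ≤ r → r ≤ 2 → ∃ C : ℝ, ∀ l k : ℕ, 1 ≤ k → k ≤ T * 2 ^ l → ∀ θ : Θ,
    eLpNorm (fun ω => 𝓜.vol l θ (fun j => W ((j + 1 : ℕ) * step l) ω - W (j * step l) ω) k
      - V θ (k * step l) ω) (ENNReal.ofReal r) P ≤ ENNReal.ofReal (C * (step l : ℝ) ^ β)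

/-- (A3): the transitions satisfy a minorization condition uniformly in the level, and are
reversible with respect to the probability measures `η l`. -/
structure A3 {T N : ℕ} (q : ℕ → Θ → Θ → ℝ≥0) (η : ∀ l : ℕ, Measure (State Θ T N l)) : Prop where
  minorization : ∃ ξ : ℝ, 0 < ξ ∧ ξ < 1 ∧ ∀ l : ℕ, 1 ≤ l →
    ∃ ν : Measure (State Θ T N l), IsProbabilityMeasure ν ∧
      ∀ x : State Θ T N l, ENNReal.ofReal ξ • ν ≤ 𝓜.transition (q l) x
  prob : ∀ l : ℕ, 1 ≤ l → IsProbabilityMeasure (η l)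
  reversible : ∀ l : ℕ, 1 ≤ l → ∀ A B : Set (State Θ T N l), MeasurableSet A → MeasurableSet B →
    ∫⁻ x in A, 𝓜.transition (q l) x B ∂(η l) = ∫⁻ x in B, 𝓜.transition (q l) x A ∂(η l)

end Model

/-- `X` is a Markov chain under `P` with initial law `μ` and transition `κ`. -/
structure IsMarkovChain {Ω α : Type*} {mΩ : MeasurableSpace Ω} [MeasurableSpace α] (P : Measure Ω)
    (μ : Measure α) (κ : α → Measure α) (X : ℕ → Ω → α) : Prop where
  meas : ∀ k, Measurable (X k)
  init : P.map (X 0) = μ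
  markov : ∀ k : ℕ, ∀ A : Set α, MeasurableSet A →
    P⟦X (k + 1) ⁻¹' A | ⨆ j ≤ k, MeasurableSpace.comap (X j) inferInstance⟧
      =ᵐ[P] fun ω => (κ (X k ω)).real A

/-- `φ` is bounded and Lipschitz for the `L₁` distance on `Θ × ℝ^T`. -/
structure IsBoundedLipschitz {d T : ℕ} {Θ : Set (Fin d → ℝ)} (φ : Θ → (Fin T → ℝ) → ℝ) :
    Prop where
  bdd : ∃ c : ℝ, ∀ θ v, |φ θ v| ≤ c
  lip : ∃ L : ℝ, ∀ (θ θ' : Θ) (v v' : Fin T → ℝ),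
    |φ θ v - φ θ' v'| ≤ L * (∑ i, |θ.1 i - θ'.1 i| + ∑ t, |v t - v' t|)

end

end VolterraMCMC

namespace VolterraMCMC

/-! ### Second moments of additive functionals of a Markov chain -/

/-! The estimator is a difference of two ratios `A₁/B₁ - A₂/B₂` of ergodic averages, and its target
is `a₁/b₁ - a₂/b₂`, where lower case letters are stationary means. With `r = a/b` and `U = A - r B`,
each ratio satisfies `A/B - r = U/b - U (B - b)/(b B)`. The function averaged in `U` is centred, so
in stationarity the linear term has mean zero, and the bias is the expected difference of two
quadratic remainders (`sub_ratio_eq`). Both `U` and `B - b` have `L²` norm of order `m^{-1/2}`,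
which produces `1/m`. Every term of the telescoped difference of the remainders also contains a
discrepancy between the two levels, and this produces the factor `Δ_l^β` (`abs_ratio_remainder_le`,
`IsMarkovChain.abs_integral_ratio_sub_le`).

Three further ingredients are needed.

Variance of ergodic averages, uniformly in the level. By minorization the transition contracts
centred functions in `L²(η)` by `√(1 - ξ)` (`integral_sq_kernel_le`). Correlations then decay
geometrically, and a sum of `n` terms has second moment at most a constant times `n` times that of
one term (`IsMarkovChain.integral_sq_sum_le`).

Identification of the stationary law. Minorization allows only one invariant probability measure
(`eq_of_invariant_of_minorization`). The Metropolis–Hastings chain is reversible for the extended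
target with density `p̂ · π ·` (density of the filter). Since the filter is unbiased
(`sum_genealogy`, `lintegral_normConst_mul_filterDensity`), the image of this target on parameter
and returned trajectory is the prior law reweighted by the product of the maxima of the likelihoods.
The factors `H₁`, `H₂` turn this common law into the posteriors of the two levels
(`posteriorExp_fine_eq`, `posteriorExp_coarse_eq`).

Closeness of the levels. The reweighting density is bounded above and below, so it suffices to bound
mean squares under the prior, for each parameter separately, with increments read off the Brownian
motion. At coarse grid points (A2) and the triangle inequality give the rate. At the other fine
points one Euler step is added, whose mean square is `O(Δ^{2β})` by the regularity of the kernel and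
a singular Gronwall inequality (`exists_integral_sq_vol_sub_le`). A discrete Itô isometry carries
the rate over to the likelihoods, and from there it passes to `H₁ - H₂` and to the weighted test
functions. -/

theorem sq_integral_mul_le {α : Type*} [MeasurableSpace α] {μ : Measure α} {f g : α → ℝ}
    (hf : MemLp f 2 μ) (hg : MemLp g 2 μ) :
    (∫ x, f x * g x ∂μ) ^ 2 ≤ (∫ x, f x ^ 2 ∂μ) * ∫ x, g x ^ 2 ∂μ := by
  have hff := hf.integrable_sq
  have hgg := hg.integrable_sq
  have hfg : Integrable (fun x => f x * g x) μ := hf.integrable_mul hg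
  -- The quadratic `t ↦ ∫ (t f + g)²` is nonnegative, so its discriminant is nonpositive; this is
  -- Cauchy–Schwarz.
  have key : ∀ t : ℝ, 0 ≤ (∫ x, f x ^ 2 ∂μ) * (t * t) + (2 * ∫ x, f x * g x ∂μ) * t +
      ∫ x, g x ^ 2 ∂μ := by
    intro t
    have h : ∫ x, (t * f x + g x) ^ 2 ∂μ =
        (∫ x, f x ^ 2 ∂μ) * (t * t) + (2 * ∫ x, f x * g x ∂μ) * t + ∫ x, g x ^ 2 ∂μ := by
      have h1 : ∀ x, (t * f x + g x) ^ 2 = (t * t) * f x ^ 2 + (2 * t) * (f x * g x) + g x ^ 2 :=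
        fun x => by ring
      simp_rw [h1]
      have i1 : Integrable (fun x => (t * t) * f x ^ 2) μ := hff.const_mul _
      have i2 : Integrable (fun x => (2 * t) * (f x * g x)) μ := hfg.const_mul _
      have i3 : Integrable (fun x => (t * t) * f x ^ 2 + (2 * t) * (f x * g x)) μ := i1.add i2
      rw [integral_add i3 hgg, integral_add i1 i2, integral_const_mul, integral_const_mul]
      ring
    rw [← h]
    exact integral_nonneg fun x => sq_nonneg _
  have := discrim_le_zero key
  unfold discrim at this
  nlinarith

theorem integral_abs_mul_le {α : Type*} [MeasurableSpace α] {μ : Measure α} {f g : α → ℝ}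
    (hf : MemLp f 2 μ) (hg : MemLp g 2 μ) {p q : ℝ} (hp : 0 ≤ p) (hq : 0 ≤ q)
    (hfp : ∫ x, f x ^ 2 ∂μ ≤ p ^ 2) (hgq : ∫ x, g x ^ 2 ∂μ ≤ q ^ 2) :
    ∫ x, |f x| * |g x| ∂μ ≤ p * q := by
  have h := sq_integral_mul_le hf.abs hg.abs
  simp only [sq_abs, Pi.abs_apply] at h
  refine abs_le_of_sq_le_sq' (h.trans ?_) (by positivity) |>.2
  rw [mul_pow]
  exact mul_le_mul hfp hgq (integral_nonneg fun x => sq_nonneg _) (sq_nonneg _)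

theorem memLp_of_abs_le {α : Type*} [MeasurableSpace α] {μ : Measure α} [IsFiniteMeasure μ]
    {f : α → ℝ} (hf : Measurable f) {c : ℝ} (hc : ∀ x, |f x| ≤ c) {p : ℝ≥0∞} : MemLp f p μ :=
  MemLp.of_bound hf.aestronglyMeasurable c (ae_of_all _ fun x => by simpa using hc x)

theorem integrable_of_abs_le {α : Type*} [MeasurableSpace α] {μ : Measure α} [IsFiniteMeasure μ]
    {f : α → ℝ} (hf : Measurable f) {c : ℝ} (hc : ∀ x, |f x| ≤ c) : Integrable f μ :=
  memLp_one_iff_integrable.1 (memLp_of_abs_le hf hc)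

theorem abs_integral_le_of_abs_le {α : Type*} [MeasurableSpace α] {μ : Measure α}
    [IsProbabilityMeasure μ] {f : α → ℝ} {c : ℝ} (hc : ∀ x, |f x| ≤ c) : |∫ x, f x ∂μ| ≤ c := by
  simpa using norm_integral_le_of_norm_le_const (μ := μ) (f := f) (ae_of_all _ hc)

/-! ### Contraction and uniqueness under a minorization condition. -/

section Minorization

variable {α : Type*} [MeasurableSpace α] {κ : Kernel α α}

/-- The residual is `μ - ξ ν`. For `μ = κ x` the removed part does not depend on `x`, so all
dependence on the starting state sits in a measure of mass `1 - ξ`. -/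
theorem exists_residual {ξ : ℝ} (hξ₀ : 0 < ξ) {ν : Measure α}
    [IsProbabilityMeasure ν] {μ : Measure α} [IsProbabilityMeasure μ]
    (h : ENNReal.ofReal ξ • ν ≤ μ) :
    ∃ ρ : Measure α, IsFiniteMeasure ρ ∧ ρ.real Set.univ = 1 - ξ ∧ ρ ≤ μ ∧
      ∀ f : α → ℝ, Measurable f → ∀ c : ℝ, (∀ x, |f x| ≤ c) →
        ∫ x, f x ∂μ = (∫ x, f x ∂ρ) + ξ * ∫ x, f x ∂ν := by
  have hfin : IsFiniteMeasure (ENNReal.ofReal ξ • ν) := ν.smul_finite ENNReal.ofReal_ne_top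
  have hadd := Measure.sub_add_cancel_of_le h
  have hle : μ - ENNReal.ofReal ξ • ν ≤ μ := Measure.sub_le
  have hR : IsFiniteMeasure (μ - ENNReal.ofReal ξ • ν) := isFiniteMeasure_of_le μ hle
  refine ⟨μ - ENNReal.ofReal ξ • ν, hR, ?_, hle, ?_⟩
  · have h1 := congrArg (fun m : Measure α => m.real Set.univ) hadd
    simp only [probReal_univ] at h1
    rw [measureReal_def, Measure.add_apply, ENNReal.toReal_add (measure_ne_top _ _)
      (measure_ne_top _ _)] at h1
    simp only [Measure.smul_apply, measure_univ, smul_eq_mul, mul_one,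
      ENNReal.toReal_ofReal hξ₀.le] at h1
    rw [measureReal_def]
    linarith
  · intro f hf c hc
    conv_lhs => rw [← hadd]
    rw [integral_add_measure (integrable_of_abs_le hf hc) (integrable_of_abs_le hf hc),
      integral_smul_measure, ENNReal.toReal_ofReal hξ₀.le, smul_eq_mul]

theorem measurable_integral_kernel {f : α → ℝ} (hf : Measurable f) :
    Measurable fun x => ∫ y, f y ∂(κ x) :=
  (hf.stronglyMeasurable.integral_kernel (κ := κ)).measurable

variable [IsMarkovKernel κ]

theorem integral_kernel_of_invariant {η : Measure α} [IsProbabilityMeasure η]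
    (hη : Kernel.Invariant κ η) {f : α → ℝ} (hf : Measurable f) {c : ℝ} (hc : ∀ x, |f x| ≤ c) :
    ∫ x, ∫ y, f y ∂(κ x) ∂η = ∫ x, f x ∂η := by
  conv_rhs => rw [← hη.def]
  rw [← Measure.snd_compProd, Measure.snd, integral_map measurable_snd.aemeasurable
    hf.aestronglyMeasurable, Measure.integral_compProd]
  exact integrable_of_abs_le (hf.comp measurable_snd) fun p => hc p.2

/-- With `a = ξ ∫ f dν` the difference `κ f - a` is an integral against the residual of mass `1 -
ξ`, so Cauchy–Schwarz gives `(κ f - a)² ≤ (1 - ξ) κ(f²)` pointwise. Integrating against the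
invariant law kills the cross term, because `κ f` is centred, and leaves `+ a²` on the favourable
side. Only invariance is involved, not reversibility. -/
theorem integral_sq_kernel_le {η : Measure α} [IsProbabilityMeasure η]
    (hη : Kernel.Invariant κ η) {ξ : ℝ} (hξ₀ : 0 < ξ) (hξ₁ : ξ < 1) {ν : Measure α}
    [IsProbabilityMeasure ν] (hmin : ∀ x, ENNReal.ofReal ξ • ν ≤ κ x) {f : α → ℝ}
    (hf : Measurable f) {c : ℝ} (hc : ∀ x, |f x| ≤ c) (h0 : ∫ x, f x ∂η = 0) :
    ∫ x, (∫ y, f y ∂(κ x)) ^ 2 ∂η ≤ (1 - ξ) * ∫ x, f x ^ 2 ∂η := by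
  have hKc : ∀ x, |∫ y, f y ∂(κ x)| ≤ c := fun x => abs_integral_le_of_abs_le hc
  have hKm := measurable_integral_kernel (κ := κ) hf
  have hf2 : Measurable fun x => f x ^ 2 := hf.pow_const 2
  have hc2 : ∀ x, |f x ^ 2| ≤ c ^ 2 := fun x => by
    rw [abs_pow]; exact pow_le_pow_left₀ (abs_nonneg _) (hc x) 2
  set a : ℝ := ξ * ∫ y, f y ∂ν with ha
  have hpt : ∀ x, (∫ y, f y ∂(κ x)) ^ 2 - 2 * a * (∫ y, f y ∂(κ x)) + a ^ 2 ≤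
      (1 - ξ) * ∫ y, f y ^ 2 ∂(κ x) := by
    intro x
    obtain ⟨ρ, hR, hR1, hRle, hRint⟩ := exists_residual hξ₀ (hmin x)
    have h1 : (∫ y, f y ∂(κ x)) - a = ∫ y, f y ∂ρ := by rw [hRint f hf c hc]; ring
    have h2 := sq_integral_mul_le (μ := ρ) (memLp_of_abs_le hf hc) (memLp_const (1 : ℝ))
    simp only [mul_one, one_pow, integral_const, hR1, smul_eq_mul] at h2
    have h3 : ∫ y, f y ^ 2 ∂ρ ≤ ∫ y, f y ^ 2 ∂(κ x) :=
      integral_mono_measure hRle (ae_of_all _ fun y => sq_nonneg _) (integrable_of_abs_le hf2 hc2)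
    calc _ = (∫ y, f y ∂ρ) ^ 2 := by rw [← h1]; ring
      _ ≤ (∫ y, f y ^ 2 ∂ρ) * (1 - ξ) := h2
      _ ≤ (1 - ξ) * ∫ y, f y ^ 2 ∂(κ x) := by nlinarith
  have hi1 : Integrable (fun x => (∫ y, f y ∂(κ x)) ^ 2) η :=
    (memLp_of_abs_le hKm hKc).integrable_sq
  have hi2 : Integrable (fun x => 2 * a * ∫ y, f y ∂(κ x)) η :=
    (integrable_of_abs_le hKm hKc).const_mul _
  have hi3 : Integrable (fun x => (1 - ξ) * ∫ y, f y ^ 2 ∂(κ x)) η :=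
    (integrable_of_abs_le (measurable_integral_kernel hf2)
      (fun x => abs_integral_le_of_abs_le hc2)).const_mul _
  have h : ∫ x, ((∫ y, f y ∂(κ x)) ^ 2 - 2 * a * (∫ y, f y ∂(κ x)) + a ^ 2) ∂η ≤
      ∫ x, (1 - ξ) * ∫ y, f y ^ 2 ∂(κ x) ∂η :=
    integral_mono (μ := η) ((hi1.sub hi2).add (integrable_const (a ^ 2))) hi3 hpt
  rw [integral_const_mul, integral_kernel_of_invariant hη hf2 hc2] at h
  have e : ∫ x, ((∫ y, f y ∂(κ x)) ^ 2 - 2 * a * (∫ y, f y ∂(κ x)) + a ^ 2) ∂η = (∫ x, (∫ y, f y ∂(κ x)) ^ 2 ∂η) + a ^ 2 := by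
    have hi12 : Integrable (fun x => (∫ y, f y ∂(κ x)) ^ 2 - 2 * a * ∫ y, f y ∂(κ x)) η :=
      hi1.sub hi2
    rw [integral_add hi12 (integrable_const _), integral_sub hi1 hi2, integral_const_mul,
      integral_kernel_of_invariant hη hf hc, h0]
    simp
  rw [e] at h
  nlinarith [sq_nonneg a]

/-- One application of `κ` maps functions with values in `[a, b]` to functions with values in an
interval of length `(1 - ξ)(b - a)`, and it does not change integrals against invariant laws. After
`n` applications the two integrals differ by at most `(1 - ξ)^n (b - a)`; indicators then separate
no sets. -/
theorem eq_of_invariant_of_minorization {η η' : Measure α} [IsProbabilityMeasure η]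
    [IsProbabilityMeasure η'] (hη : Kernel.Invariant κ η) (hη' : Kernel.Invariant κ η')
    {ξ : ℝ} (hξ₀ : 0 < ξ) (hξ₁ : ξ < 1) {ν : Measure α}
    [IsProbabilityMeasure ν] (hmin : ∀ x, ENNReal.ofReal ξ • ν ≤ κ x) : η = η' := by
  have key : ∀ n : ℕ, ∀ f : α → ℝ, Measurable f → ∀ c a b : ℝ, (∀ x, |f x| ≤ c) →
      (∀ x, a ≤ f x ∧ f x ≤ b) → |∫ x, f x ∂η - ∫ x, f x ∂η'| ≤ (1 - ξ) ^ n * (b - a) := by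
    intro n
    induction n with
    | zero =>
      intro f hf c a b hc hab
      have hI : ∀ m : Measure α, IsProbabilityMeasure m → a ≤ ∫ x, f x ∂m ∧ ∫ x, f x ∂m ≤ b := by
        intro m hm
        have hfi : Integrable f m := integrable_of_abs_le hf hc
        constructor
        · simpa using integral_mono (integrable_const a) hfi (fun x => (hab x).1)
        · simpa using integral_mono hfi (integrable_const b) (fun x => (hab x).2)
      have h1 := hI η inferInstance
      have h2 := hI η' inferInstance
      rw [abs_le]; constructor <;> simp <;> linarith
    | succ n ih =>
      intro f hf c a b hc hab
      rw [← integral_kernel_of_invariant hη hf hc, ← integral_kernel_of_invariant hη' hf hc]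
      refine (ih (fun x => ∫ y, f y ∂(κ x)) (measurable_integral_kernel hf) c
        ((1 - ξ) * a + ξ * ∫ y, f y ∂ν) ((1 - ξ) * b + ξ * ∫ y, f y ∂ν)
        (fun x => abs_integral_le_of_abs_le hc) ?_).trans (le_of_eq (by ring))
      intro x
      obtain ⟨ρ, hR, hR1, hRle, hRint⟩ := exists_residual hξ₀ (hmin x)
      have hfi : Integrable f ρ := integrable_of_abs_le hf hc
      have h1 := integral_mono (integrable_const a) hfi (fun x => (hab x).1)
      have h2 := integral_mono hfi (integrable_const b) (fun x => (hab x).2)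
      simp only [integral_const, hR1, smul_eq_mul] at h1 h2
      rw [hRint f hf c hc]
      constructor <;> linarith
  ext s hs
  have h := fun n => key n (s.indicator 1) (measurable_one.indicator hs) 1 0 1
    (fun x => by by_cases hx : x ∈ s <;> simp [hx]) (fun x => by by_cases hx : x ∈ s <;> simp [hx])
  simp only [integral_indicator_one hs, sub_zero, mul_one] at h
  have h0 : |η.real s - η'.real s| ≤ 0 :=
    ge_of_tendsto' (tendsto_pow_atTop_nhds_zero_of_lt_one (by linarith) (by linarith)) h
  have h1 : η.real s = η'.real s := by linarith [abs_nonpos_iff.1 h0]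
  exact (measureReal_eq_measureReal_iff).1 h1

end Minorization

/-! ### Covariances and second moments along the stationary chain. -/

section Chain

variable {α Ω : Type*} [MeasurableSpace α] {mΩ : MeasurableSpace Ω} {P : Measure Ω}
  [IsProbabilityMeasure P] {κ : Kernel α α} [IsMarkovKernel κ] {η : Measure α}
  {X : ℕ → Ω → α}

/-- `IsMarkovChain` prescribes conditional probabilities given the whole past. Keeping one earlier
coordinate `X j` next to the present `X k` is what is needed to peel off the last step inside a
covariance with time `j`. -/
theorem IsMarkovChain.map_triple (hX : IsMarkovChain P η κ X) {j k : ℕ} (hjk : j ≤ k) :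
    P.map (fun ω => ((X j ω, X k ω), X (k + 1) ω)) =
      (P.map (fun ω => (X j ω, X k ω))) ⊗ₘ (Kernel.prodMkLeft α κ) := by
  have hm := hX.meas
  have hm2 : Measurable fun ω => (X j ω, X k ω) := (hm j).prodMk (hm k)
  have : IsProbabilityMeasure (P.map (fun ω => (X j ω, X k ω))) :=
    Measure.isProbabilityMeasure_map hm2.aemeasurable
  have : IsProbabilityMeasure (P.map (fun ω => ((X j ω, X k ω), X (k + 1) ω))) :=
    Measure.isProbabilityMeasure_map (hm2.prodMk (hm (k + 1))).aemeasurable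
  refine Measure.ext_prod fun {s t} hs ht => ?_
  rw [Measure.map_apply (hm2.prodMk (hm (k + 1))) (hs.prod ht), Measure.compProd_apply_prod hs ht,
    setLIntegral_map hs ((Kernel.measurable_coe _ ht)) hm2]
  simp only [Kernel.prodMkLeft_apply]
  have hle : (⨆ j ≤ k, MeasurableSpace.comap (X j) inferInstance) ≤ mΩ :=
    iSup₂_le fun i _ => (hm i).comap_le
  have hXi : ∀ i ≤ k, Measurable[⨆ j ≤ k, MeasurableSpace.comap (X j) inferInstance] (X i) :=
    fun i hi => (comap_measurable (X i)).mono
      (le_iSup₂_of_le (f := fun j (_ : j ≤ k) => MeasurableSpace.comap (X j) inferInstance)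
        i hi le_rfl) le_rfl
  have hB : MeasurableSet[⨆ j ≤ k, MeasurableSpace.comap (X j) inferInstance]
      ((fun ω => (X j ω, X k ω)) ⁻¹' s) :=
    ((hXi j hjk).prodMk (hXi k le_rfl)) hs
  have hint : Integrable ((X (k + 1) ⁻¹' t).indicator (fun _ => (1 : ℝ))) P :=
    (integrable_const 1).indicator (hm (k + 1) ht)
  have h1 := setIntegral_condExp hle hint hB
  rw [setIntegral_congr_ae (hle _ hB) ((hX.markov k t ht).mono fun ω h _ => h)] at h1
  rw [setIntegral_indicator (hm (k + 1) ht), setIntegral_const, smul_eq_mul, mul_one] at h1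
  have h2 : ∫⁻ ω in (fun ω => (X j ω, X k ω)) ⁻¹' s, κ (X k ω) t ∂P =
      ENNReal.ofReal (∫ ω in (fun ω => (X j ω, X k ω)) ⁻¹' s, (κ (X k ω)).real t ∂P) := by
    rw [ofReal_integral_eq_lintegral_ofReal]
    · simp
    · refine Integrable.integrableOn (integrable_of_abs_le (c := 1) ?_ ?_)
      · exact ((Kernel.measurable_coe κ ht).comp (hm k)).ennreal_toReal
      · intro ω; rw [abs_of_nonneg measureReal_nonneg]; exact measureReal_le_one
    · exact ae_of_all _ fun ω => measureReal_nonneg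
  rw [h2, h1, ofReal_measureReal]
  congr 1

theorem IsMarkovChain.integral_mul_succ (hX : IsMarkovChain P η κ X) {j k : ℕ} (hjk : j ≤ k)
    {f g : α → ℝ} (hf : Measurable f) (hg : Measurable g) {c d : ℝ} (hc : ∀ x, |f x| ≤ c)
    (hd : ∀ x, |g x| ≤ d) :
    ∫ ω, f (X j ω) * g (X (k + 1) ω) ∂P = ∫ ω, f (X j ω) * ∫ y, g y ∂(κ (X k ω)) ∂P := by
  have hm := hX.meas
  have hm2 : Measurable fun ω => (X j ω, X k ω) := (hm j).prodMk (hm k)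
  have : IsProbabilityMeasure (P.map (fun ω => (X j ω, X k ω))) :=
    Measure.isProbabilityMeasure_map hm2.aemeasurable
  have hF : Measurable fun p : (α × α) × α => f p.1.1 * g p.2 := by fun_prop
  have h1 : ∫ ω, f (X j ω) * g (X (k + 1) ω) ∂P =
      ∫ p, f p.1.1 * g p.2 ∂(P.map (fun ω => ((X j ω, X k ω), X (k + 1) ω))) :=
    (integral_map (hm2.prodMk (hm (k + 1))).aemeasurable hF.aestronglyMeasurable).symm
  have hbd : ∀ p : (α × α) × α, |f p.1.1 * g p.2| ≤ c * d := fun p => by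
    rw [abs_mul]
    exact mul_le_mul (hc _) (hd _) (abs_nonneg _) ((abs_nonneg _).trans (hc p.1.1))
  rw [h1, hX.map_triple hjk, Measure.integral_compProd (integrable_of_abs_le hF hbd)]
  simp only [Kernel.prodMkLeft_apply, integral_const_mul]
  rw [integral_map hm2.aemeasurable]
  exact ((hf.comp measurable_fst).mul
    ((measurable_integral_kernel hg).comp measurable_snd)).aestronglyMeasurable

theorem IsMarkovChain.map_eq (hX : IsMarkovChain P η κ X) (hη : Kernel.Invariant κ η) (k : ℕ) :
    P.map (X k) = η := by
  induction k with
  | zero => exact hX.init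
  | succ k ih =>
    have h := congrArg (fun m : Measure ((α × α) × α) => m.map Prod.snd) (hX.map_triple (le_refl k))
    have hm := hX.meas
    rw [Measure.map_map measurable_snd (by fun_prop)] at h
    have h2 : Measure.map Prod.snd ((P.map (fun ω => (X k ω, X k ω))) ⊗ₘ (Kernel.prodMkLeft α κ))
        = (Measure.map (X k) P).bind κ := by
      have : IsProbabilityMeasure (P.map (fun ω => (X k ω, X k ω))) :=
        Measure.isProbabilityMeasure_map (by fun_prop)
      ext s hs
      rw [Measure.map_apply measurable_snd hs, Measure.bind_apply hs κ.aemeasurable,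
        Measure.compProd_apply (measurable_snd hs), lintegral_map _ (by fun_prop),
        lintegral_map (κ.measurable_coe hs) (by fun_prop)]
      · rfl
      · exact (Kernel.prodMkLeft α κ).measurable_kernel_prodMk_left (measurable_snd hs)
    rw [h2, ih, hη.def] at h
    exact h

theorem IsMarkovChain.integral_comp (hX : IsMarkovChain P η κ X) (hη : Kernel.Invariant κ η)
    (k : ℕ) {f : α → ℝ} (hf : Measurable f) : ∫ ω, f (X k ω) ∂P = ∫ x, f x ∂η := by
  rw [← hX.map_eq hη k, integral_map (hX.meas k).aemeasurable hf.aestronglyMeasurable]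

variable [IsProbabilityMeasure η]

/-- Induction on the lag: conditioning on all but the last step replaces `g` by `κ g`, which is
again centred and whose `L²` bound has shrunk by `√(1 - ξ)`. At lag zero it is Cauchy–Schwarz under
`η`. This is why `g` and `q` are quantified after the lag. -/
theorem IsMarkovChain.abs_integral_mul_le (hX : IsMarkovChain P η κ X)
    (hη : Kernel.Invariant κ η) {ξ : ℝ} (hξ₀ : 0 < ξ) (hξ₁ : ξ < 1) {ν : Measure α}
    [IsProbabilityMeasure ν] (hmin : ∀ x, ENNReal.ofReal ξ • ν ≤ κ x) {f : α → ℝ}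
    (hf : Measurable f) {c : ℝ} (hc : ∀ x, |f x| ≤ c) {p : ℝ} (hp : 0 ≤ p)
    (hfp : ∫ x, f x ^ 2 ∂η ≤ p ^ 2) (j i : ℕ) :
    ∀ g : α → ℝ, Measurable g → ∀ d : ℝ, (∀ x, |g x| ≤ d) → ∫ x, g x ∂η = 0 → ∀ q : ℝ, 0 ≤ q →
      ∫ x, g x ^ 2 ∂η ≤ q ^ 2 →
      |∫ ω, f (X j ω) * g (X (j + i) ω) ∂P| ≤ √(1 - ξ) ^ i * (p * q) := by
  induction i with
  | zero =>
    intro g hg d hd h0 q hq hgq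
    have h := hX.integral_comp hη j (hf.mul hg)
    simp only [Pi.mul_apply] at h
    rw [Nat.add_zero, h, pow_zero, one_mul]
    refine (MeasureTheory.abs_integral_le_integral_abs).trans ?_
    simp only [abs_mul]
    exact integral_abs_mul_le (memLp_of_abs_le hf hc) (memLp_of_abs_le hg hd) hp hq hfp hgq
  | succ i ih =>
    intro g hg d hd h0 q hq hgq
    rw [← Nat.add_assoc, hX.integral_mul_succ (Nat.le_add_right j i) hf hg hc hd]
    refine (ih (fun x => ∫ y, g y ∂(κ x)) (measurable_integral_kernel hg) d
      (fun x => abs_integral_le_of_abs_le hd) ?_ (√(1 - ξ) * q) (by positivity) ?_).trans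
      (le_of_eq (by ring))
    · rw [integral_kernel_of_invariant hη hg hd, h0]
    · rw [mul_pow, Real.sq_sqrt (by linarith)]
      exact (integral_sq_kernel_le hη hξ₀ hξ₁ hmin hg hd h0).trans
        (mul_le_mul_of_nonneg_left hgq (by linarith))

/-- With `ρ = √(1 - ξ)`, the `n`-th summand adds its own square, at most `p²`, and twice its
covariances with the past, at most `2 p² ρ/(1 - ρ)` by the geometric series. The sum is below `2
p²/(1 - ρ)`, which equals `2 p² ρ/(1 - ρ) + 2 p²`. -/
theorem IsMarkovChain.integral_sq_sum_le (hX : IsMarkovChain P η κ X)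
    (hη : Kernel.Invariant κ η) {ξ : ℝ} (hξ₀ : 0 < ξ) (hξ₁ : ξ < 1) {ν : Measure α}
    [IsProbabilityMeasure ν] (hmin : ∀ x, ENNReal.ofReal ξ • ν ≤ κ x) {f : α → ℝ}
    (hf : Measurable f) {c : ℝ} (hc : ∀ x, |f x| ≤ c) (h0 : ∫ x, f x ∂η = 0) {p : ℝ} (hp : 0 ≤ p)
    (hfp : ∫ x, f x ^ 2 ∂η ≤ p ^ 2) (n : ℕ) :
    ∫ ω, (∑ k ∈ Finset.range n, f (X k ω)) ^ 2 ∂P ≤ n * (2 / (1 - √(1 - ξ)) * p ^ 2) := by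
  have hρ : √(1 - ξ) < 1 := (Real.sqrt_lt' one_pos).2 (by linarith)
  have hm := hX.meas
  have hfm : ∀ k, Measurable fun ω => f (X k ω) := fun k => hf.comp (hm k)
  induction n with
  | zero => simp
  | succ n ih =>
    have hL : MemLp (fun ω => ∑ k ∈ Finset.range n, f (X k ω)) 2 P :=
      memLp_finsetSum _ fun k _ => memLp_of_abs_le (hfm k) (fun ω => hc _)
    have hLn : MemLp (fun ω => f (X n ω)) 2 P := memLp_of_abs_le (hfm n) (fun ω => hc _)
    have e : ∀ ω, (∑ k ∈ Finset.range (n + 1), f (X k ω)) ^ 2 =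
        (∑ k ∈ Finset.range n, f (X k ω)) ^ 2 +
        2 * (∑ k ∈ Finset.range n, f (X k ω) * f (X n ω)) + f (X n ω) ^ 2 := fun ω => by
      rw [Finset.sum_range_succ, ← Finset.sum_mul]; ring
    have hI : ∀ k, Integrable (fun ω => f (X k ω) * f (X n ω)) P := fun k =>
      MemLp.integrable_mul (p := 2) (q := 2) (memLp_of_abs_le (hfm k) (fun ω => hc _)) hLn
    simp_rw [e]
    have hI2 : Integrable (fun ω => 2 * ∑ k ∈ Finset.range n, f (X k ω) * f (X n ω)) P :=
      (integrable_finsetSum _ fun k _ => hI k).const_mul _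
    have hI3 : Integrable (fun ω => (∑ k ∈ Finset.range n, f (X k ω)) ^ 2 +
        2 * (∑ k ∈ Finset.range n, f (X k ω) * f (X n ω))) P := hL.integrable_sq.add hI2
    rw [integral_add hI3 hLn.integrable_sq,
      integral_add hL.integrable_sq hI2, integral_const_mul, integral_finsetSum _ fun k _ => hI k]
    have h1 : ∫ ω, f (X n ω) ^ 2 ∂P ≤ p ^ 2 := by
      have := hX.integral_comp hη n (hf.pow_const 2)
      rw [this]; exact hfp
    have h2 : ∑ k ∈ Finset.range n, ∫ ω, f (X k ω) * f (X n ω) ∂P ≤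
        ∑ k ∈ Finset.range n, √(1 - ξ) ^ (n - k) * (p * p) := by
      refine Finset.sum_le_sum fun k hk => ?_
      have hkn : k + (n - k) = n := Nat.add_sub_cancel' (Finset.mem_range.1 hk).le
      have := hX.abs_integral_mul_le hη hξ₀ hξ₁ hmin hf hc hp hfp k (n - k) f hf c hc h0 p hp hfp
      rw [hkn] at this
      exact (le_abs_self _).trans this
    have h3 : ∑ k ∈ Finset.range n, √(1 - ξ) ^ (n - k) ≤ √(1 - ξ) / (1 - √(1 - ξ)) := by
      have : ∑ k ∈ Finset.range n, √(1 - ξ) ^ (n - k) =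
          √(1 - ξ) * ∑ k ∈ Finset.range n, √(1 - ξ) ^ k := by
        rw [← Finset.sum_range_reflect, Finset.mul_sum]
        refine Finset.sum_congr rfl fun k hk => ?_
        have := Finset.mem_range.1 hk
        rw [← pow_succ']
        congr 1; omega
      rw [this, div_eq_mul_inv, ← tsum_geometric_of_lt_one (Real.sqrt_nonneg _) hρ]
      exact mul_le_mul_of_nonneg_left ((summable_geometric_of_lt_one (Real.sqrt_nonneg _)
        hρ).sum_le_tsum _ fun _ _ => by positivity) (Real.sqrt_nonneg _)
    rw [← Finset.sum_mul] at h2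
    have h4 := mul_le_mul_of_nonneg_right h3 (mul_nonneg hp hp)
    have h5 : 2 / (1 - √(1 - ξ)) = 2 * (√(1 - ξ) / (1 - √(1 - ξ))) + 2 := by
      field_simp [(sub_pos.2 hρ).ne']
      ring
    push_cast
    rw [add_mul]
    have h6 : 1 * (2 / (1 - √(1 - ξ)) * p ^ 2) =
      2 * (√(1 - ξ) / (1 - √(1 - ξ)) * (p * p)) + 2 * p ^ 2 := by rw [h5]; ring
    rw [h6]
    nlinarith [sq_nonneg p]

end Chain

end VolterraMCMC

namespace VolterraMCMC

/-! ### The bias of a difference of ratio estimators -/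

/-- The average of `f` over the states `X 0, …, X m`. -/
noncomputable def chainAvg {α Ω : Type*} (X : ℕ → Ω → α) (m : ℕ) (f : α → ℝ) (ω : Ω) : ℝ :=
  1 / ((m : ℝ) + 1) * ∑ k ∈ Finset.range (m + 1), f (X k ω)

section ChainAvg

variable {α Ω : Type*} {X : ℕ → Ω → α}

theorem chainAvg_sub (m : ℕ) (f g : α → ℝ) (ω : Ω) :
    chainAvg X m (fun x => f x - g x) ω = chainAvg X m f ω - chainAvg X m g ω := by
  simp only [chainAvg, Finset.sum_sub_distrib]; ring

theorem chainAvg_const_mul (m : ℕ) (r : ℝ) (f : α → ℝ) (ω : Ω) :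
    chainAvg X m (fun x => r * f x) ω = r * chainAvg X m f ω := by
  simp only [chainAvg, ← Finset.mul_sum]; ring

theorem chainAvg_const (m : ℕ) (r : ℝ) (ω : Ω) : chainAvg X m (fun _ => r) ω = r := by
  simp only [chainAvg, Finset.sum_const, Finset.card_range, nsmul_eq_mul]
  push_cast
  field_simp

theorem chainAvg_mono (m : ℕ) {f g : α → ℝ} (h : ∀ x, f x ≤ g x) (ω : Ω) :
    chainAvg X m f ω ≤ chainAvg X m g ω :=
  mul_le_mul_of_nonneg_left (Finset.sum_le_sum fun _ _ => h _) (by positivity)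

theorem abs_chainAvg_le (m : ℕ) {f : α → ℝ} {c : ℝ} (h : ∀ x, |f x| ≤ c) (ω : Ω) :
    |chainAvg X m f ω| ≤ c := by
  rw [abs_le]
  constructor
  · rw [← chainAvg_const (X := X) m (-c) ω]
    exact chainAvg_mono m (fun x => (abs_le.1 (h x)).1) ω
  · rw [← chainAvg_const (X := X) m c ω]
    exact chainAvg_mono m (fun x => (abs_le.1 (h x)).2) ω

theorem measurable_chainAvg [MeasurableSpace α] [MeasurableSpace Ω] (hX : ∀ k, Measurable (X k))
    (m : ℕ) {f : α → ℝ} (hf : Measurable f) : Measurable (chainAvg X m f) :=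
  (Finset.measurable_sum _ fun k _ => hf.comp (hX k)).const_mul _

end ChainAvg

/-- For each index, `A/B - a/b = U/B` with `U = A - (a/b) B`, and `1/B = 1/b - (B - b)/(b B)`. The
part linear in `U` has mean zero in stationarity; the rest is a product of two fluctuations. -/
theorem sub_ratio_eq {A₁ B₁ A₂ B₂ a₁ b₁ a₂ b₂ : ℝ} (hB₁ : B₁ ≠ 0) (hB₂ : B₂ ≠ 0) (hb₁ : b₁ ≠ 0)
    (hb₂ : b₂ ≠ 0) :
    A₁ / B₁ - A₂ / B₂ - (a₁ / b₁ - a₂ / b₂) =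
      (A₁ - a₁ / b₁ * B₁) / b₁ - (A₂ - a₂ / b₂ * B₂) / b₂ -
      ((A₁ - a₁ / b₁ * B₁) * (B₁ - b₁) / (b₁ * B₁) -
        (A₂ - a₂ / b₂ * B₂) * (B₂ - b₂) / (b₂ * B₂)) := by
  field_simp
  ring

/-- The difference of the two remainders is telescoped by exchanging first `U`, then `B - b`, then
the denominator. Each term keeps two fluctuations and one level discrepancy: `U₁ - U₂`, the
difference of the centred `B`s, or `D`. -/
theorem abs_ratio_remainder_le {U₁ U₂ B₁ B₂ b₁ b₂ δ D : ℝ} (hδ : 0 < δ) (hB₁ : δ ≤ B₁)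
    (hB₂ : δ ≤ B₂) (hB₂' : B₂ ≤ 1) (hb₁ : δ ≤ b₁) (hb₁' : b₁ ≤ 1) (hb₂ : δ ≤ b₂)
    (hb₂' : b₂ ≤ 1) (hD : |b₁ - b₂| ≤ D) :
    |U₁ * (B₁ - b₁) / (b₁ * B₁) - U₂ * (B₂ - b₂) / (b₂ * B₂)| ≤
      1 / δ ^ 2 * (|U₁ - U₂| * |B₁ - b₁|) + 1 / δ ^ 2 * (|U₂| * |(B₁ - b₁) - (B₂ - b₂)|) +
      1 / δ ^ 4 * (2 * D * (|U₂| * |B₂ - b₂|) + |U₂| * |(B₁ - b₁) - (B₂ - b₂)|) := by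
  have p1 : 0 < b₁ := hδ.trans_le hb₁
  have p2 : 0 < b₂ := hδ.trans_le hb₂
  have q1 : 0 < B₁ := hδ.trans_le hB₁
  have q2 : 0 < B₂ := hδ.trans_le hB₂
  have h1 : δ ^ 2 ≤ b₁ * B₁ := by rw [sq]; exact mul_le_mul hb₁ hB₁ hδ.le p1.le
  have h2 : δ ^ 2 ≤ b₂ * B₂ := by rw [sq]; exact mul_le_mul hb₂ hB₂ hδ.le p2.le
  have e : U₁ * (B₁ - b₁) / (b₁ * B₁) - U₂ * (B₂ - b₂) / (b₂ * B₂) =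
      1 / (b₁ * B₁) * ((U₁ - U₂) * (B₁ - b₁)) +
      1 / (b₁ * B₁) * (U₂ * ((B₁ - b₁) - (B₂ - b₂))) +
      1 / ((b₁ * B₁) * (b₂ * B₂)) * (U₂ * (B₂ - b₂) * (b₂ * B₂ - b₁ * B₁)) := by
    field_simp
    ring
  have i1 : |1 / (b₁ * B₁)| ≤ 1 / δ ^ 2 := by
    rw [abs_of_pos (by positivity)]
    exact one_div_le_one_div_of_le (by positivity) h1
  have i2 : |1 / ((b₁ * B₁) * (b₂ * B₂))| ≤ 1 / δ ^ 4 := by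
    rw [abs_of_pos (by positivity)]
    refine one_div_le_one_div_of_le (by positivity) ?_
    calc δ ^ 4 = δ ^ 2 * δ ^ 2 := by ring
      _ ≤ _ := mul_le_mul h1 h2 (by positivity) (by positivity)
  have i3 : |b₂ * B₂ - b₁ * B₁| ≤ 2 * D + |(B₁ - b₁) - (B₂ - b₂)| := by
    have : b₂ * B₂ - b₁ * B₁ = (b₂ - b₁) * B₂ + b₁ * ((b₂ - b₁) - ((B₁ - b₁) - (B₂ - b₂))) := by
      ring
    rw [this]
    have h3 : |(b₂ - b₁) * B₂| ≤ D := by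
      rw [abs_mul, abs_of_pos q2, abs_sub_comm]
      calc _ ≤ D * 1 := mul_le_mul hD hB₂' q2.le ((abs_nonneg _).trans hD)
        _ = D := mul_one D
    have h4 : |b₁ * ((b₂ - b₁) - ((B₁ - b₁) - (B₂ - b₂)))| ≤ D + |(B₁ - b₁) - (B₂ - b₂)| := by
      rw [abs_mul, abs_of_pos p1]
      calc _ ≤ 1 * |(b₂ - b₁) - ((B₁ - b₁) - (B₂ - b₂))| :=
            mul_le_mul_of_nonneg_right hb₁' (abs_nonneg _)
        _ ≤ |b₂ - b₁| + |(B₁ - b₁) - (B₂ - b₂)| := by rw [one_mul]; exact abs_sub _ _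
        _ ≤ _ := by rw [abs_sub_comm b₂]; gcongr
    linarith [abs_add_le ((b₂ - b₁) * B₂) (b₁ * ((b₂ - b₁) - ((B₁ - b₁) - (B₂ - b₂))))]
  -- Exchanging the denominators produces a cubic term; bounding this one fluctuation by `1` makes
  -- it quadratic, so that second moments suffice.
  have i4 : |B₂ - b₂| ≤ 1 := by rw [abs_le]; constructor <;> linarith
  have i5 : |U₂ * (B₂ - b₂) * (b₂ * B₂ - b₁ * B₁)| ≤
      2 * D * (|U₂| * |B₂ - b₂|) + |U₂| * |(B₁ - b₁) - (B₂ - b₂)| := by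
    rw [abs_mul, abs_mul]
    calc _ ≤ |U₂| * |B₂ - b₂| * (2 * D + |(B₁ - b₁) - (B₂ - b₂)|) :=
          mul_le_mul_of_nonneg_left i3 (by positivity)
      _ = 2 * D * (|U₂| * |B₂ - b₂|) + |U₂| * |(B₁ - b₁) - (B₂ - b₂)| * |B₂ - b₂| := by ring
      _ ≤ _ := by
        exact add_le_add_right (mul_le_of_le_one_right (by positivity) i4) _
  rw [e]
  refine (abs_add_le _ _).trans (add_le_add ((abs_add_le _ _).trans (add_le_add ?_ ?_)) ?_)
  · rw [abs_mul, abs_mul (U₁ - U₂)]; gcongr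
  · rw [abs_mul, abs_mul U₂]; gcongr
  · rw [abs_mul]; gcongr

/-- The constant in the bound for the bias of a difference of ratio estimators. -/
noncomputable def ratioBiasConst (c δ ξ : ℝ) : ℝ :=
  2 / (1 - √(1 - ξ)) * (1 / δ ^ 2 * (2 * (1 + (1 / δ + c / δ ^ 2) + c / δ)) +
    1 / δ ^ 2 * (c + c / δ) + 1 / δ ^ 4 * (2 * (c + c / δ) + (c + c / δ)))

section RatioBias

variable {α Ω : Type*} [MeasurableSpace α] {mΩ : MeasurableSpace Ω} {P : Measure Ω}
  [IsProbabilityMeasure P] {κ : Kernel α α} [IsMarkovKernel κ] {η : Measure α}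
  {X : ℕ → Ω → α}

theorem IsMarkovChain.integral_chainAvg (hX : IsMarkovChain P η κ X) (hη : Kernel.Invariant κ η)
    (m : ℕ) {f : α → ℝ} (hf : Measurable f) {c : ℝ} (hc : ∀ x, |f x| ≤ c) :
    ∫ ω, chainAvg X m f ω ∂P = ∫ x, f x ∂η := by
  unfold chainAvg
  rw [integral_const_mul, integral_finsetSum _ fun k _ =>
    (show Integrable (fun ω => f (X k ω)) P from
      integrable_of_abs_le (hf.comp (hX.meas k)) (fun ω => hc _))]
  simp only [hX.integral_comp hη _ hf, Finset.sum_const, Finset.card_range,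
    nsmul_eq_mul]
  push_cast
  field_simp

variable [IsProbabilityMeasure η]

theorem IsMarkovChain.integral_sq_chainAvg_le (hX : IsMarkovChain P η κ X)
    (hη : Kernel.Invariant κ η) {ξ : ℝ} (hξ₀ : 0 < ξ) (hξ₁ : ξ < 1) {ν : Measure α}
    [IsProbabilityMeasure ν] (hmin : ∀ x, ENNReal.ofReal ξ • ν ≤ κ x) {f : α → ℝ}
    (hf : Measurable f) {c : ℝ} (hc : ∀ x, |f x| ≤ c) (h0 : ∫ x, f x ∂η = 0) {p : ℝ} (hp : 0 ≤ p)
    (hfp : ∫ x, f x ^ 2 ∂η ≤ p ^ 2) (m : ℕ) :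
    ∫ ω, chainAvg X m f ω ^ 2 ∂P ≤ (√(2 / (1 - √(1 - ξ)) / ((m : ℝ) + 1)) * p) ^ 2 := by
  have hρ : √(1 - ξ) < 1 := (Real.sqrt_lt' one_pos).2 (by linarith)
  have hρ' : 0 < 1 - √(1 - ξ) := by linarith
  have h := hX.integral_sq_sum_le hη hξ₀ hξ₁ hmin hf hc h0 hp hfp (m + 1)
  unfold chainAvg
  simp_rw [mul_pow]
  rw [integral_const_mul, Real.sq_sqrt (by positivity)]
  calc _ ≤ (1 / ((m : ℝ) + 1)) ^ 2 * (((m + 1 : ℕ) : ℝ) * (2 / (1 - √(1 - ξ)) * p ^ 2)) :=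
        mul_le_mul_of_nonneg_left h (by positivity)
    _ = _ := by push_cast; field_simp

theorem IsMarkovChain.integral_sq_chainAvg_sub_le (hX : IsMarkovChain P η κ X)
    (hη : Kernel.Invariant κ η) {ξ : ℝ} (hξ₀ : 0 < ξ) (hξ₁ : ξ < 1) {ν : Measure α}
    [IsProbabilityMeasure ν] (hmin : ∀ x, ENNReal.ofReal ξ • ν ≤ κ x) {f : α → ℝ}
    (hf : Measurable f) {c : ℝ} (hc : ∀ x, |f x| ≤ c) {p : ℝ} (hp : 0 ≤ p)
    (hfp : ∫ x, f x ^ 2 ∂η ≤ p ^ 2) (m : ℕ) :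
    ∫ ω, (chainAvg X m f ω - ∫ x, f x ∂η) ^ 2 ∂P ≤
      (√(2 / (1 - √(1 - ξ)) / ((m : ℝ) + 1)) * p) ^ 2 := by
  have hi : Integrable f η := integrable_of_abs_le hf hc
  have hi2 : Integrable (fun x => f x ^ 2) η := (memLp_of_abs_le hf hc).integrable_sq
  set a := ∫ x, f x ∂η with ha
  have e : ∀ ω, chainAvg X m f ω - a = chainAvg X m (fun x => f x - a) ω := fun ω => by
    rw [chainAvg_sub, chainAvg_const]
  simp_rw [e]
  refine hX.integral_sq_chainAvg_le hη hξ₀ hξ₁ hmin (f := fun x => f x - a)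
    (hf.sub measurable_const) (c := c + |a|)
    (fun x => (abs_sub _ _).trans (add_le_add_left (hc x) _)) ?_ hp ?_ m
  · rw [integral_sub hi (integrable_const _)]; simp [ha]
  · have e2 : ∀ x, (f x - a) ^ 2 = f x ^ 2 - 2 * a * f x + a ^ 2 := fun x => by ring
    simp_rw [e2]
    have j1 : Integrable (fun x => 2 * a * f x) η := hi.const_mul _
    have j2 : Integrable (fun x => f x ^ 2 - 2 * a * f x) η := hi2.sub j1
    rw [integral_add j2 (integrable_const _), integral_sub hi2 j1, integral_const_mul, ← ha]
    simp only [integral_const, probReal_univ, one_smul]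
    nlinarith [sq_nonneg a]

theorem integral_sq_le_of_abs_le {f : α → ℝ} {c : ℝ} (hf : Measurable f) (hc : ∀ x, |f x| ≤ c) :
    ∫ x, f x ^ 2 ∂η ≤ c ^ 2 := by
  have := integral_mono (memLp_of_abs_le (μ := η) hf hc).integrable_sq (integrable_const (c ^ 2))
    (fun x => sq_le_sq' (by linarith [(abs_le.1 (hc x)).1]) (abs_le.1 (hc x)).2)
  simpa using this

/-- Here `f - r g` stands for the centred numerators of the two levels. Their difference splits into
`f₁ - f₂`, `(r₁ - r₂) g₁` and `r₂ (g₁ - g₂)`, each of `L²` size `O(D)`; thus `u` is a Lipschitz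
constant for the ratio `r` and `v` a bound for it. -/
theorem integral_sq_centred_sub_le {f₁ f₂ g₁ g₂ : α → ℝ} (hf₁ : Measurable f₁)
    (hf₂ : Measurable f₂) (hg₁ : Measurable g₁) (hg₂ : Measurable g₂) {c : ℝ}
    (hc₁ : ∀ x, |f₁ x| ≤ c) (hc₂ : ∀ x, |f₂ x| ≤ c) (hgc₁ : ∀ x, |g₁ x| ≤ 1)
    (hgc₂ : ∀ x, |g₂ x| ≤ 1) {D u v r₁ r₂ : ℝ} (hD : 0 ≤ D) (hu : 0 ≤ u) (hv : 0 ≤ v)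
    (hrr : |r₁ - r₂| ≤ u * D) (hr₂ : |r₂| ≤ v)
    (hfD : ∫ x, (f₁ x - f₂ x) ^ 2 ∂η ≤ D ^ 2) (hgD : ∫ x, (g₁ x - g₂ x) ^ 2 ∂η ≤ D ^ 2) :
    ∫ x, ((f₁ x - r₁ * g₁ x) - (f₂ x - r₂ * g₂ x)) ^ 2 ∂η ≤ (2 * (1 + u + v) * D) ^ 2 := by
  have Lf : MemLp (fun x => f₁ x - f₂ x) 2 η :=
    (memLp_of_abs_le hf₁ hc₁).sub (memLp_of_abs_le hf₂ hc₂)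
  have Lg₁ : MemLp g₁ 2 η := memLp_of_abs_le hg₁ hgc₁
  have Lg : MemLp (fun x => g₁ x - g₂ x) 2 η := Lg₁.sub (memLp_of_abs_le hg₂ hgc₂)
  have e : ∀ x, (f₁ x - r₁ * g₁ x) - (f₂ x - r₂ * g₂ x) =
      (f₁ x - f₂ x) + (-(r₁ - r₂) * g₁ x) + (-r₂ * (g₁ x - g₂ x)) := fun x => by ring
  have hpt : ∀ x, ((f₁ x - r₁ * g₁ x) - (f₂ x - r₂ * g₂ x)) ^ 2 ≤ 3 * (f₁ x - f₂ x) ^ 2 +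
      3 * (u * D) ^ 2 + 3 * v ^ 2 * (g₁ x - g₂ x) ^ 2 := by
    intro x
    have e2 : ∀ x y z : ℝ, (x + y + z) ^ 2 ≤ 3 * x ^ 2 + 3 * y ^ 2 + 3 * z ^ 2 := fun x y z => by
      nlinarith [sq_nonneg (x - y), sq_nonneg (y - z), sq_nonneg (x - z)]
    rw [e]
    refine (e2 _ _ _).trans ?_
    have h1 : (-(r₁ - r₂) * g₁ x) ^ 2 ≤ (u * D) ^ 2 := by
      rw [sq_le_sq, abs_mul, abs_neg, abs_of_nonneg (mul_nonneg hu hD)]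
      exact (mul_le_mul hrr (hgc₁ x) (abs_nonneg _) (by positivity)).trans_eq (mul_one _)
    have h2 : (-r₂ * (g₁ x - g₂ x)) ^ 2 ≤ v ^ 2 * (g₁ x - g₂ x) ^ 2 := by
      rw [mul_pow, neg_sq]
      exact mul_le_mul_of_nonneg_right (sq_le_sq' (by linarith [(abs_le.1 hr₂).1])
        (abs_le.1 hr₂).2) (sq_nonneg _)
    linarith
  have hLψ : Integrable (fun x => ((f₁ x - r₁ * g₁ x) - (f₂ x - r₂ * g₂ x)) ^ 2) η := by
    simp_rw [e]
    exact ((Lf.add (Lg₁.const_mul _)).add (Lg.const_mul _)).integrable_sq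
  have j1 : Integrable (fun x => 3 * (f₁ x - f₂ x) ^ 2) η := Lf.integrable_sq.const_mul _
  have j2 : Integrable (fun x => 3 * (f₁ x - f₂ x) ^ 2 + 3 * (u * D) ^ 2) η :=
    j1.add (integrable_const _)
  have j3 : Integrable (fun x => 3 * v ^ 2 * (g₁ x - g₂ x) ^ 2) η := Lg.integrable_sq.const_mul _
  have h := integral_mono hLψ (j2.add j3) hpt
  simp only [Pi.add_apply] at h
  rw [integral_add j2 j3, integral_add j1 (integrable_const _), integral_const_mul,
    integral_const_mul (3 * v ^ 2), integral_const, probReal_univ, one_smul] at h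
  have h3 : 3 * v ^ 2 * ∫ x, (g₁ x - g₂ x) ^ 2 ∂η ≤ 3 * v ^ 2 * D ^ 2 :=
    mul_le_mul_of_nonneg_left hgD (by positivity)
  have h5 : 3 + 3 * u ^ 2 + 3 * v ^ 2 ≤ 4 * (1 + u + v) ^ 2 := by nlinarith [mul_nonneg hu hv]
  have h6 := mul_le_mul_of_nonneg_right h5 (sq_nonneg D)
  have h7 : (2 * (1 + u + v) * D) ^ 2 = 4 * (1 + u + v) ^ 2 * D ^ 2 := by ring
  rw [h7]
  nlinarith

theorem abs_integral_sub_le_of_sq {u v : α → ℝ} (hu : Measurable u) (hv : Measurable v) {C : ℝ}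
    (hCu : ∀ x, |u x| ≤ C) (hCv : ∀ x, |v x| ≤ C) {D : ℝ} (hD : 0 ≤ D)
    (huv : ∫ x, (u x - v x) ^ 2 ∂η ≤ D ^ 2) : |∫ x, u x ∂η - ∫ x, v x ∂η| ≤ D := by
  rw [← integral_sub (integrable_of_abs_le hu hCu) (integrable_of_abs_le hv hCv)]
  have hL : MemLp (fun x => u x - v x) 2 η :=
    (memLp_of_abs_le hu hCu).sub (memLp_of_abs_le hv hCv)
  have := sq_integral_mul_le hL (memLp_const (1 : ℝ))
  simp only [mul_one, one_pow, integral_const, probReal_univ, smul_eq_mul] at this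
  exact abs_le_of_sq_le_sq (this.trans huv) hD

set_option maxHeartbeats 1000000 in
-- The linear parts of the two ratios integrate to zero, so only the quadratic remainders
-- contribute. Cauchy–Schwarz bounds each expected product by the square `s²` of the scale `s` of
-- ergodic averages, of order `(m + 1)^{-1/2}`, times one factor `D`.
theorem IsMarkovChain.abs_integral_ratio_sub_le (hX : IsMarkovChain P η κ X)
    (hη : Kernel.Invariant κ η) {ξ : ℝ} (hξ₀ : 0 < ξ) (hξ₁ : ξ < 1) {ν : Measure α}
    [IsProbabilityMeasure ν] (hmin : ∀ x, ENNReal.ofReal ξ • ν ≤ κ x) {f₁ f₂ g₁ g₂ : α → ℝ}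
    (hf₁ : Measurable f₁) (hf₂ : Measurable f₂) (hg₁ : Measurable g₁) (hg₂ : Measurable g₂)
    {c : ℝ} (hc₁ : ∀ x, |f₁ x| ≤ c) (hc₂ : ∀ x, |f₂ x| ≤ c) {δ : ℝ} (hδ : 0 < δ)
    (hδ₁ : ∀ x, δ ≤ g₁ x ∧ g₁ x ≤ 1) (hδ₂ : ∀ x, δ ≤ g₂ x ∧ g₂ x ≤ 1) {D : ℝ} (hD : 0 ≤ D)
    (hfD : ∫ x, (f₁ x - f₂ x) ^ 2 ∂η ≤ D ^ 2) (hgD : ∫ x, (g₁ x - g₂ x) ^ 2 ∂η ≤ D ^ 2) (m : ℕ) :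
    Integrable (fun ω => chainAvg X m f₁ ω / chainAvg X m g₁ ω -
        chainAvg X m f₂ ω / chainAvg X m g₂ ω) P ∧
      |∫ ω, (chainAvg X m f₁ ω / chainAvg X m g₁ ω - chainAvg X m f₂ ω / chainAvg X m g₂ ω -
        ((∫ x, f₁ x ∂η) / (∫ x, g₁ x ∂η) - (∫ x, f₂ x ∂η) / (∫ x, g₂ x ∂η))) ∂P| ≤
        ratioBiasConst c δ ξ * D / ((m : ℝ) + 1) := by
  obtain ⟨x₀⟩ : Nonempty α := η.nonempty_of_neZero
  have hc0 : 0 ≤ c := (abs_nonneg _).trans (hc₁ x₀)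
  have hgc : ∀ {g : α → ℝ}, (∀ x, δ ≤ g x ∧ g x ≤ 1) → ∀ x, |g x| ≤ 1 := fun h x => by
    rw [abs_le]; constructor <;> linarith [(h x).1, (h x).2]
  have hgc₁ := hgc hδ₁
  have hgc₂ := hgc hδ₂
  have hif₁ : Integrable f₁ η := integrable_of_abs_le hf₁ hc₁
  have hif₂ : Integrable f₂ η := integrable_of_abs_le hf₂ hc₂
  have hig₁ : Integrable g₁ η := integrable_of_abs_le hg₁ hgc₁
  have hig₂ : Integrable g₂ η := integrable_of_abs_le hg₂ hgc₂
  set a₁ := ∫ x, f₁ x ∂η with ha₁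
  set a₂ := ∫ x, f₂ x ∂η with ha₂
  set b₁ := ∫ x, g₁ x ∂η with hb₁
  set b₂ := ∫ x, g₂ x ∂η with hb₂
  have hbb : ∀ {g : α → ℝ}, Integrable g η → (∀ x, δ ≤ g x ∧ g x ≤ 1) →
      δ ≤ ∫ x, g x ∂η ∧ ∫ x, g x ∂η ≤ 1 := fun {g} hi h => by
    constructor
    · simpa using integral_mono (integrable_const δ) hi (fun x => (h x).1)
    · simpa using integral_mono hi (integrable_const 1) (fun x => (h x).2)
  obtain ⟨hb₁l, hb₁u⟩ := hbb hig₁ hδ₁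
  obtain ⟨hb₂l, hb₂u⟩ := hbb hig₂ hδ₂
  rw [← hb₁] at hb₁l hb₁u
  rw [← hb₂] at hb₂l hb₂u
  have hB : ∀ {g : α → ℝ}, (∀ x, δ ≤ g x ∧ g x ≤ 1) → ∀ ω, δ ≤ chainAvg X m g ω ∧
      chainAvg X m g ω ≤ 1 := fun {g} h ω => by
    constructor
    · rw [← chainAvg_const (X := X) m δ ω]; exact chainAvg_mono m (fun x => (h x).1) ω
    · rw [← chainAvg_const (X := X) m 1 ω]; exact chainAvg_mono m (fun x => (h x).2) ω
  have hB₁ := hB hδ₁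
  have hB₂ := hB hδ₂
  have hmA : ∀ {f : α → ℝ}, Measurable f → Measurable (chainAvg X m f) :=
    fun h => measurable_chainAvg hX.meas m h
  have hda : |a₁ - a₂| ≤ D := abs_integral_sub_le_of_sq hf₁ hf₂ hc₁ hc₂ hD hfD
  have hdb : |b₁ - b₂| ≤ D := abs_integral_sub_le_of_sq hg₁ hg₂ hgc₁ hgc₂ hD hgD
  have hb₁0 : 0 < b₁ := hδ.trans_le hb₁l
  have hb₂0 : 0 < b₂ := hδ.trans_le hb₂l
  have ha₁c : |a₁| ≤ c := abs_integral_le_of_abs_le hc₁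
  have ha₂c : |a₂| ≤ c := abs_integral_le_of_abs_le hc₂
  set r₁ := a₁ / b₁ with hr₁
  set r₂ := a₂ / b₂ with hr₂
  have hr₁c : |r₁| ≤ c / δ := by
    rw [hr₁, abs_div, abs_of_pos hb₁0]; exact div_le_div₀ hc0 ha₁c hδ hb₁l
  have hr₂c : |r₂| ≤ c / δ := by
    rw [hr₂, abs_div, abs_of_pos hb₂0]; exact div_le_div₀ hc0 ha₂c hδ hb₂l
  -- The ratio `a/b` is Lipschitz where `b ≥ δ`: changing the numerator costs `D/δ`, changing the
  -- denominator `|r₂| D/δ ≤ c D/δ²`.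
  have hrr : |r₁ - r₂| ≤ (1 / δ + c / δ ^ 2) * D := by
    have e : r₁ - r₂ = (a₁ - a₂) / b₁ + r₂ * (b₂ - b₁) / b₁ := by
      rw [hr₁, hr₂]; field_simp; ring
    rw [e]
    refine (abs_add_le _ _).trans ?_
    rw [abs_div, abs_div, abs_mul, abs_of_pos hb₁0, abs_sub_comm b₂]
    have h1 : |a₁ - a₂| / b₁ ≤ D / δ := div_le_div₀ hD hda hδ hb₁l
    have h2 : |r₂| * |b₁ - b₂| / b₁ ≤ (c / δ * D) / δ :=
      div_le_div₀ (by positivity) (mul_le_mul hr₂c hdb (abs_nonneg _) (by positivity)) hδ hb₁l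
    calc _ ≤ D / δ + (c / δ * D) / δ := add_le_add h1 h2
      _ = _ := by field_simp
  -- the centred functions
  set ψ₁ : α → ℝ := fun x => f₁ x - r₁ * g₁ x with hψ₁
  set ψ₂ : α → ℝ := fun x => f₂ x - r₂ * g₂ x with hψ₂
  have hmψ₁ : Measurable ψ₁ := hf₁.sub (hg₁.const_mul _)
  have hmψ₂ : Measurable ψ₂ := hf₂.sub (hg₂.const_mul _)
  have hψc : ∀ {f g : α → ℝ} {r : ℝ}, (∀ x, |f x| ≤ c) → (∀ x, |g x| ≤ 1) → |r| ≤ c / δ →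
      ∀ x, |f x - r * g x| ≤ c + c / δ := fun {f g r} hf hg hr x => by
    refine (abs_sub _ _).trans (add_le_add (hf x) ?_)
    rw [abs_mul]
    calc _ ≤ c / δ * 1 := mul_le_mul hr (hg x) (abs_nonneg _) (by positivity)
      _ = _ := mul_one _
  have hcψ₁ : ∀ x, |ψ₁ x| ≤ c + c / δ := hψc hc₁ hgc₁ hr₁c
  have hcψ₂ : ∀ x, |ψ₂ x| ≤ c + c / δ := hψc hc₂ hgc₂ hr₂c
  have h0ψ₁ : ∫ x, ψ₁ x ∂η = 0 := by
    rw [hψ₁, integral_sub hif₁ (hig₁.const_mul _), integral_const_mul, ← ha₁, ← hb₁, hr₁]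
    field_simp; ring
  have h0ψ₂ : ∫ x, ψ₂ x ∂η = 0 := by
    rw [hψ₂, integral_sub hif₂ (hig₂.const_mul _), integral_const_mul, ← ha₂, ← hb₂, hr₂]
    field_simp; ring
  have hU₁ : ∀ ω, chainAvg X m ψ₁ ω = chainAvg X m f₁ ω - r₁ * chainAvg X m g₁ ω := fun ω => by
    rw [hψ₁, chainAvg_sub, chainAvg_const_mul]
  have hU₂ : ∀ ω, chainAvg X m ψ₂ ω = chainAvg X m f₂ ω - r₂ * chainAvg X m g₂ ω := fun ω => by
    rw [hψ₂, chainAvg_sub, chainAvg_const_mul]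
  have hEU₁ : ∫ ω, chainAvg X m ψ₁ ω ∂P = 0 := by
    rw [hX.integral_chainAvg hη m hmψ₁ hcψ₁, h0ψ₁]
  have hEU₂ : ∫ ω, chainAvg X m ψ₂ ω ∂P = 0 := by
    rw [hX.integral_chainAvg hη m hmψ₂ hcψ₂, h0ψ₂]
  -- An average of `m + 1` states has second moment at most `γ/(m + 1) = s²` times that of a single
  -- state.
  set γ := 2 / (1 - √(1 - ξ)) with hγ
  have hρ : √(1 - ξ) < 1 := (Real.sqrt_lt' one_pos).2 (by linarith)
  have hγ0 : 0 ≤ γ := div_nonneg zero_le_two (by linarith)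
  set s := √(γ / ((m : ℝ) + 1)) with hs
  have hss : s * s = γ / ((m : ℝ) + 1) := Real.mul_self_sqrt (by positivity)
  have hs0 : 0 ≤ s := Real.sqrt_nonneg _
  -- second moments
  set E₁ : ℝ := 2 * (1 + (1 / δ + c / δ ^ 2) + c / δ) with hE₁
  have hE₁0 : 0 ≤ E₁ := by positivity
  have hψD : ∫ x, (ψ₁ x - ψ₂ x) ^ 2 ∂η ≤ (E₁ * D) ^ 2 := by
    have := integral_sq_centred_sub_le hf₁ hf₂ hg₁ hg₂ hc₁ hc₂ hgc₁ hgc₂ hD (by positivity)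
      (by positivity) hrr hr₂c hfD hgD
    exact this
  have hmU₁ := hmA hmψ₁
  have hmU₂ := hmA hmψ₂
  have cU₁ : ∀ ω, |chainAvg X m ψ₁ ω| ≤ c + c / δ := abs_chainAvg_le m hcψ₁
  have cU₂ : ∀ ω, |chainAvg X m ψ₂ ω| ≤ c + c / δ := abs_chainAvg_le m hcψ₂
  have LU₁ : MemLp (chainAvg X m ψ₁) 2 P := memLp_of_abs_le hmU₁ cU₁
  have LU₂ : MemLp (chainAvg X m ψ₂) 2 P := memLp_of_abs_le hmU₂ cU₂
  have cB₁ : ∀ ω, |chainAvg X m g₁ ω| ≤ 1 := abs_chainAvg_le m hgc₁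
  have cB₂ : ∀ ω, |chainAvg X m g₂ ω| ≤ 1 := abs_chainAvg_le m hgc₂
  have LB₁ : MemLp (chainAvg X m g₁) 2 P := memLp_of_abs_le (hmA hg₁) cB₁
  have LB₂ : MemLp (chainAvg X m g₂) 2 P := memLp_of_abs_le (hmA hg₂) cB₂
  have LY₁ : MemLp (fun ω => chainAvg X m g₁ ω - b₁) 2 P := LB₁.sub (memLp_const _)
  have LY₂ : MemLp (fun ω => chainAvg X m g₂ ω - b₂) 2 P := LB₂.sub (memLp_const _)
  have LYY : MemLp (fun ω => (chainAvg X m g₁ ω - b₁) - (chainAvg X m g₂ ω - b₂)) 2 P :=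
    LY₁.sub LY₂
  have LUU : MemLp (fun ω => chainAvg X m ψ₁ ω - chainAvg X m ψ₂ ω) 2 P := LU₁.sub LU₂
  have mU₂ : ∫ ω, chainAvg X m ψ₂ ω ^ 2 ∂P ≤ (s * (c + c / δ)) ^ 2 :=
    hX.integral_sq_chainAvg_le hη hξ₀ hξ₁ hmin hmψ₂ hcψ₂ h0ψ₂ (by positivity)
      (integral_sq_le_of_abs_le hmψ₂ hcψ₂) m
  have mUU : ∫ ω, (chainAvg X m ψ₁ ω - chainAvg X m ψ₂ ω) ^ 2 ∂P ≤ (s * (E₁ * D)) ^ 2 := by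
    simp_rw [← chainAvg_sub]
    refine hX.integral_sq_chainAvg_le hη hξ₀ hξ₁ hmin (f := fun x => ψ₁ x - ψ₂ x)
      (hmψ₁.sub hmψ₂)
      (c := (c + c / δ) + (c + c / δ))
      (fun x => (abs_sub _ _).trans (add_le_add (hcψ₁ x) (hcψ₂ x))) ?_ (by positivity) hψD m
    rw [integral_sub (integrable_of_abs_le hmψ₁ hcψ₁) (integrable_of_abs_le hmψ₂ hcψ₂), h0ψ₁,
      h0ψ₂, sub_zero]
  have mY₁ : ∫ ω, (chainAvg X m g₁ ω - b₁) ^ 2 ∂P ≤ (s * 1) ^ 2 :=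
    hX.integral_sq_chainAvg_sub_le hη hξ₀ hξ₁ hmin hg₁ hgc₁ zero_le_one
      (integral_sq_le_of_abs_le hg₁ hgc₁) m
  have mY₂ : ∫ ω, (chainAvg X m g₂ ω - b₂) ^ 2 ∂P ≤ (s * 1) ^ 2 :=
    hX.integral_sq_chainAvg_sub_le hη hξ₀ hξ₁ hmin hg₂ hgc₂ zero_le_one
      (integral_sq_le_of_abs_le hg₂ hgc₂) m
  have mYY : ∫ ω, ((chainAvg X m g₁ ω - b₁) - (chainAvg X m g₂ ω - b₂)) ^ 2 ∂P ≤
      (s * D) ^ 2 := by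
    have h := hX.integral_sq_chainAvg_sub_le hη hξ₀ hξ₁ hmin (hg₁.sub hg₂)
      (c := 1 + 1) (fun x => (abs_sub _ _).trans (add_le_add (hgc₁ x) (hgc₂ x))) hD hgD m
    simp only [Pi.sub_apply] at h
    rw [integral_sub hig₁ hig₂, ← hb₁, ← hb₂] at h
    refine le_trans (le_of_eq (integral_congr_ae (ae_of_all _ fun ω => ?_))) h
    change _ = (chainAvg X m (fun x => g₁ x - g₂ x) ω - (b₁ - b₂)) ^ 2
    rw [chainAvg_sub]; ring
  -- The first two products contain a level difference and are `O(s² D)`. The third is only `O(s²)`;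
  -- in the remainder bound it is multiplied by `2 D`.
  have t1 := integral_abs_mul_le LUU LY₁ (by positivity) (by positivity) mUU mY₁
  have t2 := integral_abs_mul_le LU₂ LYY (by positivity) (by positivity) mU₂ mYY
  have t3 := integral_abs_mul_le LU₂ LY₂ (by positivity) (by positivity) mU₂ mY₂
  -- integrability
  have hA₁i : Measurable (fun ω => chainAvg X m f₁ ω / chainAvg X m g₁ ω) :=
    (hmA hf₁).div (hmA hg₁)
  have hA₂i : Measurable (fun ω => chainAvg X m f₂ ω / chainAvg X m g₂ ω) :=
    (hmA hf₂).div (hmA hg₂)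
  have hest : Integrable (fun ω => chainAvg X m f₁ ω / chainAvg X m g₁ ω -
      chainAvg X m f₂ ω / chainAvg X m g₂ ω) P := by
    have hq : ∀ {f g : α → ℝ}, (∀ x, |f x| ≤ c) → (∀ x, δ ≤ g x ∧ g x ≤ 1) → ∀ ω,
        |chainAvg X m f ω / chainAvg X m g ω| ≤ c / δ := fun {f g} hf hg ω => by
      rw [abs_div, abs_of_pos (hδ.trans_le (hB hg ω).1)]
      exact div_le_div₀ hc0 (abs_chainAvg_le m hf ω) hδ (hB hg ω).1
    exact (integrable_of_abs_le hA₁i (hq hc₁ hδ₁)).sub (integrable_of_abs_le hA₂i (hq hc₂ hδ₂))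
  refine ⟨hest, ?_⟩
  set Rm : Ω → ℝ := fun ω => chainAvg X m ψ₁ ω * (chainAvg X m g₁ ω - b₁) /
    (b₁ * chainAvg X m g₁ ω) - chainAvg X m ψ₂ ω * (chainAvg X m g₂ ω - b₂) /
    (b₂ * chainAvg X m g₂ ω) with hRm
  have hkey : ∀ ω, chainAvg X m f₁ ω / chainAvg X m g₁ ω -
      chainAvg X m f₂ ω / chainAvg X m g₂ ω - (r₁ - r₂) =
      chainAvg X m ψ₁ ω / b₁ - chainAvg X m ψ₂ ω / b₂ - Rm ω := fun ω => by
    simp only [hRm, hU₁, hU₂]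
    exact sub_ratio_eq (hδ.trans_le (hB₁ ω).1).ne' (hδ.trans_le (hB₂ ω).1).ne' hb₁0.ne' hb₂0.ne'
  have k1 : Integrable (fun ω => |chainAvg X m ψ₁ ω - chainAvg X m ψ₂ ω| *
      |chainAvg X m g₁ ω - b₁|) P := LUU.abs.integrable_mul LY₁.abs
  have k2 : Integrable (fun ω => |chainAvg X m ψ₂ ω| *
      |(chainAvg X m g₁ ω - b₁) - (chainAvg X m g₂ ω - b₂)|) P := LU₂.abs.integrable_mul LYY.abs
  have k3 : Integrable (fun ω => |chainAvg X m ψ₂ ω| * |chainAvg X m g₂ ω - b₂|) P :=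
    LU₂.abs.integrable_mul LY₂.abs
  have l1 : Integrable (fun ω => 1 / δ ^ 2 * (|chainAvg X m ψ₁ ω - chainAvg X m ψ₂ ω| *
      |chainAvg X m g₁ ω - b₁|)) P := k1.const_mul _
  have l2 : Integrable (fun ω => 1 / δ ^ 2 * (|chainAvg X m ψ₂ ω| *
      |(chainAvg X m g₁ ω - b₁) - (chainAvg X m g₂ ω - b₂)|)) P := k2.const_mul _
  have l3 : Integrable (fun ω => 2 * D * (|chainAvg X m ψ₂ ω| * |chainAvg X m g₂ ω - b₂|)) P :=
    k3.const_mul _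
  have l4 : Integrable (fun ω => 2 * D * (|chainAvg X m ψ₂ ω| * |chainAvg X m g₂ ω - b₂|) +
      |chainAvg X m ψ₂ ω| * |(chainAvg X m g₁ ω - b₁) - (chainAvg X m g₂ ω - b₂)|) P := l3.add k2
  have l5 : Integrable (fun ω => 1 / δ ^ 4 * (2 * D * (|chainAvg X m ψ₂ ω| *
      |chainAvg X m g₂ ω - b₂|) +
      |chainAvg X m ψ₂ ω| * |(chainAvg X m g₁ ω - b₁) - (chainAvg X m g₂ ω - b₂)|)) P :=
    l4.const_mul _
  have l6 : Integrable (fun ω => 1 / δ ^ 2 * (|chainAvg X m ψ₁ ω - chainAvg X m ψ₂ ω| *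
      |chainAvg X m g₁ ω - b₁|) + 1 / δ ^ 2 * (|chainAvg X m ψ₂ ω| *
      |(chainAvg X m g₁ ω - b₁) - (chainAvg X m g₂ ω - b₂)|)) P := l1.add l2
  have hRb : ∀ ω, |Rm ω| ≤ _ := fun ω => abs_ratio_remainder_le (U₁ := chainAvg X m ψ₁ ω)
    (U₂ := chainAvg X m ψ₂ ω) hδ (hB₁ ω).1 (hB₂ ω).1 (hB₂ ω).2 hb₁l hb₁u hb₂l hb₂u hdb
  have hRmeas : Measurable Rm :=
    ((hmU₁.mul ((hmA hg₁).sub_const _)).div ((hmA hg₁).const_mul _)).sub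
      ((hmU₂.mul ((hmA hg₂).sub_const _)).div ((hmA hg₂).const_mul _))
  have hRi : Integrable Rm P := (l6.add l5).mono' hRmeas.aestronglyMeasurable (ae_of_all _ hRb)
  have n1 : Integrable (fun ω => chainAvg X m ψ₁ ω / b₁) P :=
    (LU₁.integrable one_le_two).div_const _
  have n2 : Integrable (fun ω => chainAvg X m ψ₂ ω / b₂) P :=
    (LU₂.integrable one_le_two).div_const _
  have n3 : Integrable (fun ω => chainAvg X m ψ₁ ω / b₁ - chainAvg X m ψ₂ ω / b₂) P := n1.sub n2
  simp_rw [hkey]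
  -- Stationarity removes the linear terms here, leaving minus the integral of the remainder.
  rw [integral_sub n3 hRi, integral_sub n1 n2, integral_div, integral_div, hEU₁, hEU₂]
  simp only [zero_div, sub_zero, zero_sub, abs_neg]
  have hfin := (MeasureTheory.abs_integral_le_integral_abs (μ := P) (f := Rm)).trans
    (integral_mono hRi.abs (l6.add l5) hRb)
  simp only [Pi.add_apply] at hfin
  rw [integral_add l6 l5, integral_add l1 l2, integral_const_mul, integral_const_mul,
    integral_const_mul, integral_add l3 k2, integral_const_mul] at hfin
  refine hfin.trans ?_
  have hv : 0 ≤ c + c / δ := by positivity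
  calc _ ≤ 1 / δ ^ 2 * (s * (E₁ * D) * (s * 1)) + 1 / δ ^ 2 * (s * (c + c / δ) * (s * D)) +
        1 / δ ^ 4 * (2 * D * (s * (c + c / δ) * (s * 1)) + s * (c + c / δ) * (s * D)) := by
        gcongr
    _ = (s * s) * D * (1 / δ ^ 2 * E₁ + 1 / δ ^ 2 * (c + c / δ) +
        1 / δ ^ 4 * (2 * (c + c / δ) + (c + c / δ))) := by ring
    _ = _ := by rw [hss, ratioBiasConst]; ring

end RatioBias

end VolterraMCMC

namespace VolterraMCMC

/-! ### Elementary properties of the Euler scheme and of the likelihood -/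

theorem euler_zero (K b σ : ℝ → ℝ) (v₀ Δ : ℝ) (w : ℕ → ℝ) : euler K b σ v₀ Δ w 0 = v₀ := by
  rw [euler]

theorem euler_succ (K b σ : ℝ → ℝ) (v₀ Δ : ℝ) (w : ℕ → ℝ) (k : ℕ) :
    euler K b σ v₀ Δ w (k + 1) = v₀ + ∑ j ∈ Finset.range (k + 1),
      K (((k : ℝ) + 1 - (j : ℝ)) * Δ) *
        (b (euler K b σ v₀ Δ w j) * Δ + σ (euler K b σ v₀ Δ w j) * w j) := by
  rw [euler, Finset.sum_range]

/-- Causality of the scheme. Increments are handled as infinite sequences, and finite vectors are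
continued by zero; causality makes the choice of continuation irrelevant. -/
theorem euler_congr (K b σ : ℝ → ℝ) (v₀ Δ : ℝ) {w w' : ℕ → ℝ} (k : ℕ)
    (h : ∀ j < k, w j = w' j) : euler K b σ v₀ Δ w k = euler K b σ v₀ Δ w' k := by
  induction k using Nat.strong_induction_on with
  | _ k ih =>
    cases k with
    | zero => rw [euler_zero, euler_zero]
    | succ k =>
      rw [euler_succ, euler_succ]
      congr 1
      refine Finset.sum_congr rfl fun j hj => ?_
      have hj' := Finset.mem_range.1 hj
      rw [ih j hj' (fun i hi => h i (hi.trans hj')), h j hj']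

theorem coarsen_congr {w w' : ℕ → ℝ} {k : ℕ} (h : ∀ j < 2 * k, w j = w' j) :
    ∀ j < k, coarsen w j = coarsen w' j := fun j hj => by
  rw [coarsen, coarsen, h _ (by omega), h _ (by omega)]

theorem measurable_coarsen : Measurable coarsen :=
  measurable_pi_lambda _ fun j => (measurable_pi_apply (2 * j)).add (measurable_pi_apply _)

/-- Selecting among finitely many measurable functions by a measurable index. -/
theorem measurable_select {α ι β : Type*} [MeasurableSpace α] [MeasurableSpace β]
    [MeasurableSpace ι] [Countable ι] [MeasurableSingletonClass ι] {f : ι → α → β} {g : α → ι}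
    (hf : ∀ i, Measurable (f i)) (hg : Measurable g) : Measurable fun x => f (g x) x := by
  have h : Measurable fun p : ι × α => f p.1 p.2 := measurable_from_prod_countable_right hf
  exact h.comp (hg.prodMk measurable_id)

namespace Model

variable {d : ℕ} {Θ : Set (Fin d → ℝ)} {Y : Type*} {𝓜 : Model Θ Y}

theorem vol_congr (l : ℕ) (θ : Θ) {w w' : ℕ → ℝ} (k : ℕ) (h : ∀ j < k, w j = w' j) :
    𝓜.vol l θ w k = 𝓜.vol l θ w' k := euler_congr _ _ _ _ _ k h

theorem lik_congr (l t : ℕ) (θ : Θ) {w w' : ℕ → ℝ} (h : ∀ j < (t + 1) * 2 ^ l, w j = w' j) :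
    𝓜.lik l t θ w = 𝓜.lik l t θ w' := by
  have hlt : ∀ k ∈ Finset.range (2 ^ l), t * 2 ^ l + k < (t + 1) * 2 ^ l := fun k hk => by
    have := Finset.mem_range.1 hk
    rw [add_mul]; omega
  have hv : ∀ k ∈ Finset.range (2 ^ l),
      𝓜.vol l θ w (t * 2 ^ l + k) = 𝓜.vol l θ w' (t * 2 ^ l + k) := fun k hk =>
    vol_congr l θ _ fun j hj => h j (hj.trans (hlt k hk))
  unfold lik
  congr 1
  · congr 1
    exact Finset.sum_congr rfl fun k hk => by rw [hv k hk]
  · exact Finset.sum_congr rfl fun k hk => by rw [hv k hk, h _ (hlt k hk)]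

theorem coarse_lik_congr (l t : ℕ) (θ : Θ) {w w' : ℕ → ℝ}
    (h : ∀ j < (t + 1) * 2 ^ (l + 1), w j = w' j) :
    𝓜.lik l t θ (coarsen w) = 𝓜.lik l t θ (coarsen w') :=
  lik_congr l t θ (coarsen_congr fun j hj => h j (by rw [pow_succ]; linarith))

/-- The level is written `l + 1` because `maxLik` uses the truncated `l - 1`: at level zero its
second likelihood would be evaluated at coarsened increments that reach beyond time `t + 1`. -/
theorem maxLik_congr (l t : ℕ) (θ : Θ) {w w' : ℕ → ℝ}
    (h : ∀ j < (t + 1) * 2 ^ (l + 1), w j = w' j) :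
    𝓜.maxLik (l + 1) t θ w = 𝓜.maxLik (l + 1) t θ w' := by
  unfold maxLik
  rw [lik_congr (l + 1) t θ h, Nat.add_sub_cancel, coarse_lik_congr l t θ h]

theorem index_lt {T t l j : ℕ} (ht : t < T) (hj : j < (t + 1) * 2 ^ l) : j < T * 2 ^ l :=
  hj.trans_le (Nat.mul_le_mul_right _ ht)

theorem skeleton_congr {T l : ℕ} (θ : Θ) {w w' : ℕ → ℝ} (h : ∀ j < T * 2 ^ l, w j = w' j) :
    𝓜.skeleton T l θ w = 𝓜.skeleton T l θ w' :=
  funext fun t => vol_congr l θ _ fun j hj => h j (index_lt t.2 hj)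

theorem coarse_skeleton_congr {T l : ℕ} (θ : Θ) {w w' : ℕ → ℝ}
    (h : ∀ j < T * 2 ^ (l + 1), w j = w' j) :
    𝓜.skeleton T l θ (coarsen w) = 𝓜.skeleton T l θ (coarsen w') :=
  skeleton_congr θ (coarsen_congr fun j hj => h j (by rw [pow_succ]; linarith))

section Measurability

variable {T : ℕ} {β : ℝ} (h𝓜 : 𝓜.IsRegular T β)
include h𝓜

theorem IsRegular.measurable_vol (l k : ℕ) :
    Measurable fun p : Θ × (ℕ → ℝ) => 𝓜.vol l p.1 p.2 k := by
  unfold vol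
  induction k using Nat.strong_induction_on with
  | _ k ih =>
    cases k with
    | zero => simp only [euler_zero]; exact measurable_const
    | succ k =>
      simp only [euler_succ]
      refine measurable_const.add (Finset.measurable_sum _ fun j hj => ?_)
      have hj' := ih j (Finset.mem_range.1 hj)
      have hb := h𝓜.b_meas.comp (measurable_fst.prodMk hj')
      have hσ := h𝓜.σ_meas.comp (measurable_fst.prodMk hj')
      exact ((hb.mul_const _).add
        (hσ.mul ((measurable_pi_apply j).comp measurable_snd))).const_mul _

theorem IsRegular.measurable_skeleton (l : ℕ) :
    Measurable fun p : Θ × (ℕ → ℝ) => 𝓜.skeleton T l p.1 p.2 :=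
  measurable_pi_lambda _ fun _ => h𝓜.measurable_vol l _

theorem IsRegular.measurable_lik (hA1 : 𝓜.A1) (l t : ℕ) :
    Measurable fun p : Θ × (ℕ → ℝ) => 𝓜.lik l t p.1 p.2 := by
  obtain ⟨Lf, hf⟩ := hA1.f_lip
  obtain ⟨Lh, hh⟩ := hA1.h_lip
  obtain ⟨c, hc⟩ := hA1.g_lip (𝓜.y (t + 1)) (𝓜.y t)
  have hc0 : ∀ p q : ℝ × ℝ, |𝓜.g (𝓜.y (t + 1)) (𝓜.y t) p.1 p.2 -
      𝓜.g (𝓜.y (t + 1)) (𝓜.y t) q.1 q.2| ≤ |c| * 2 * dist p q := fun p q => by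
    refine (hc _ _ _ _).trans ?_
    have h1 : |p.1 - q.1| ≤ dist p q := by rw [← Real.dist_eq]; exact le_max_left _ _
    have h2 : |p.2 - q.2| ≤ dist p q := by rw [← Real.dist_eq]; exact le_max_right _ _
    calc _ ≤ |c| * (dist p q + dist p q) :=
          mul_le_mul (le_abs_self c) (add_le_add h1 h2) (by positivity) (abs_nonneg c)
      _ = _ := by ring
  have hg : Continuous fun p : ℝ × ℝ => 𝓜.g (𝓜.y (t + 1)) (𝓜.y t) p.1 p.2 :=
    (LipschitzWith.of_dist_le' (K := |c| * 2) fun p q => by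
      rw [Real.dist_eq]; exact hc0 p q).continuous
  unfold lik
  refine hg.measurable.comp (Measurable.prodMk ?_ ?_)
  · exact (Finset.measurable_sum _ fun k _ =>
      hf.continuous.measurable.comp (h𝓜.measurable_vol l _)).const_mul _
  · refine Finset.measurable_sum (f := fun k (p : Θ × (ℕ → ℝ)) =>
      𝓜.h (𝓜.vol l p.1 p.2 (t * 2 ^ l + k)) * p.2 (t * 2 ^ l + k)) (Finset.range (2 ^ l))
      fun k _ => ?_
    exact (hh.continuous.measurable.comp (h𝓜.measurable_vol l _)).mul
      ((measurable_pi_apply _).comp measurable_snd)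

theorem IsRegular.measurable_coarse_lik (hA1 : 𝓜.A1) (l t : ℕ) :
    Measurable fun p : Θ × (ℕ → ℝ) => 𝓜.lik l t p.1 (coarsen p.2) :=
  (h𝓜.measurable_lik hA1 l t).comp
    (measurable_fst.prodMk (measurable_coarsen.comp measurable_snd))

theorem IsRegular.measurable_maxLik (hA1 : 𝓜.A1) (l t : ℕ) :
    Measurable fun p : Θ × (ℕ → ℝ) => 𝓜.maxLik l t p.1 p.2 :=
  (h𝓜.measurable_lik hA1 l t).max (h𝓜.measurable_coarse_lik hA1 (l - 1) t)

end Measurability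

/-- The bounds in (A1) may depend on the pair of observations. Only the `T` consecutive pairs of the
data occur, so minima and maxima over them are uniform in level, parameter and increments. -/
theorem A1.exists_lik_bounds (hA1 : 𝓜.A1) (T : ℕ) : ∃ c c' : ℝ, 0 < c ∧ c ≤ c' ∧
    ∀ t < T, ∀ l θ w, c ≤ 𝓜.lik l t θ w ∧ 𝓜.lik l t θ w ≤ c' := by
  induction T with
  | zero => exact ⟨1, 1, one_pos, le_rfl, fun t ht => absurd ht (Nat.not_lt_zero t)⟩
  | succ T ih =>
    obtain ⟨c, c', hc, hcc, h⟩ := ih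
    obtain ⟨e, e', he, h'⟩ := hA1.g_bdd (𝓜.y (T + 1)) (𝓜.y T)
    refine ⟨min c e, max c' e', lt_min hc he,
      (min_le_left _ _).trans (hcc.trans (le_max_left _ _)), fun t ht l θ w => ?_⟩
    rcases Nat.lt_succ_iff_lt_or_eq.1 ht with ht | rfl
    · exact ⟨(min_le_left _ _).trans (h t ht l θ w).1, (h t ht l θ w).2.trans (le_max_left _ _)⟩
    · exact ⟨(min_le_right _ _).trans (h' _ _).1, (h' _ _).2.trans (le_max_right _ _)⟩

theorem A1.lik_pos (hA1 : 𝓜.A1) (l t : ℕ) (θ : Θ) (w : ℕ → ℝ) : 0 < 𝓜.lik l t θ w := by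
  obtain ⟨e, e', he, h'⟩ := hA1.g_bdd (𝓜.y (t + 1)) (𝓜.y t)
  exact he.trans_le (h' _ _).1

theorem A1.maxLik_pos (hA1 : 𝓜.A1) (l t : ℕ) (θ : Θ) (w : ℕ → ℝ) : 0 < 𝓜.maxLik l t θ w :=
  (hA1.lik_pos l t θ w).trans_le (le_max_left _ _)

end Model

/-! ### Sums over genealogies -/

section Genealogy

/-- Extension of a finite sequence of ancestor maps by the identity. -/
def extendAnc {N n : ℕ} (a : Fin n → Fin N → Fin N) (t : ℕ) (i : Fin N) : Fin N :=
  if ht : t < n then a ⟨t, ht⟩ i else i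

/-- The states of a population with initial states `x₀`, moves `m` and ancestor maps `a`. -/
def population {E : Type*} {N : ℕ} (x₀ : Fin N → E) (m : ℕ → Fin N → E → E)
    (a : ℕ → Fin N → Fin N) : ℕ → Fin N → E
  | 0, i => x₀ i
  | t + 1, i => m t i (population x₀ m a t (a t i))

/-- The states along a single line of descent through the particles `b 0, b 1, …`. -/
def lineage {E : Type*} {N : ℕ} (x₀ : Fin N → E) (m : ℕ → Fin N → E → E)
    (b : ℕ → Fin N) : ℕ → E
  | 0 => x₀ (b 0)
  | t + 1 => m t (b (t + 1)) (lineage x₀ m b t)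

/-- Extension of a finite sequence by its last entry. -/
def extendLast {α : Type*} {n : ℕ} (b : Fin (n + 1) → α) (t : ℕ) : α :=
  b ⟨min t n, Nat.lt_succ_of_le (min_le_right t n)⟩

variable {E : Type*} {N : ℕ} (x₀ : Fin N → E) (m : ℕ → Fin N → E → E)

theorem population_congr {a a' : ℕ → Fin N → Fin N} (t : ℕ) (h : ∀ s < t, a s = a' s) :
    population x₀ m a t = population x₀ m a' t := by
  induction t with
  | zero => rfl
  | succ t ih =>
    funext i
    simp only [population]
    rw [ih fun s hs => h s (hs.trans (Nat.lt_succ_self t)), h t (Nat.lt_succ_self t)]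

theorem lineage_congr {b b' : ℕ → Fin N} (t : ℕ) (h : ∀ s ≤ t, b s = b' s) :
    lineage x₀ m b t = lineage x₀ m b' t := by
  induction t with
  | zero => simp only [lineage]; rw [h 0 le_rfl]
  | succ t ih =>
    simp only [lineage]
    rw [ih fun s hs => h s (hs.trans (Nat.le_succ t)), h (t + 1) le_rfl]

theorem extendAnc_snoc {n : ℕ} (a : Fin n → Fin N → Fin N) (α : Fin N → Fin N) {s : ℕ}
    (hs : s < n) :
    extendAnc (Fin.snoc a α : Fin (n + 1) → Fin N → Fin N) s = extendAnc a s := by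
  funext i
  simp only [extendAnc, hs, hs.trans (Nat.lt_succ_self n), dif_pos]
  simp [Fin.snoc, hs]

theorem extendAnc_snoc_last {n : ℕ} (a : Fin n → Fin N → Fin N) (α : Fin N → Fin N) :
    extendAnc (Fin.snoc a α : Fin (n + 1) → Fin N → Fin N) n = α := by
  funext i
  simp [extendAnc, Fin.snoc]

theorem extendLast_snoc {α : Type*} {n : ℕ} (b : Fin (n + 1) → α) (k : α) {s : ℕ} (hs : s ≤ n) :
    extendLast (Fin.snoc b k : Fin (n + 2) → α) s = extendLast b s := by
  have h1 : min s (n + 1) = s := min_eq_left (by omega)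
  have h2 : min s n = s := min_eq_left hs
  simp only [extendLast, h1, h2]
  simp [Fin.snoc, Nat.lt_succ_of_le hs]

theorem extendLast_snoc_last {α : Type*} {n : ℕ} (b : Fin (n + 1) → α) (k : α) :
    extendLast (Fin.snoc b k : Fin (n + 2) → α) (n + 1) = k := by
  simp [extendLast, Fin.snoc]

theorem sum_snoc {α : Type*} [Fintype α] {M : Type*} [AddCommMonoid M] {n : ℕ}
    [Fintype (Fin n → α)] [Fintype (Fin (n + 1) → α)] (F : (Fin (n + 1) → α) → M) :
    ∑ a, F a = ∑ a : Fin n → α, ∑ x : α, F (Fin.snoc a x) := by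
  rw [Finset.sum_comm, ← Fintype.sum_prod_type']
  exact (Fintype.sum_equiv (Fin.snocEquiv (fun _ => α)) _ _ fun p => rfl).symm

/-- Summing out independent choices of ancestors, of which only one matters. -/
theorem sum_prod_mul_apply {p : Fin N → ℝ} (hp : ∑ j, p j = 1) (k : Fin N) (g : Fin N → ℝ) :
    ∑ α : Fin N → Fin N, (∏ i, p (α i)) * g (α k) = ∑ j, p j * g j := by
  have h1 : ∀ α : Fin N → Fin N, (∏ i, p (α i)) * g (α k) =
      ∏ i, p (α i) * (if i = k then g (α i) else 1) := fun α => by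
    rw [Finset.prod_mul_distrib, Finset.prod_ite_eq' Finset.univ k (fun i => g (α i))]
    simp
  simp_rw [h1]
  have h2 := (Finset.prod_univ_sum (fun _ : Fin N => (Finset.univ : Finset (Fin N)))
    (fun i j => p j * (if i = k then g j else 1)))
  rw [Fintype.piFinset_univ] at h2
  rw [← h2, Finset.prod_eq_single k]
  · simp
  · intro i _ hi; simp [hi, hp]
  · simp

variable (w : ℕ → E → ℝ)

/-- The normalized weights of generation `t`. -/
noncomputable def popWeight (a : ℕ → Fin N → Fin N) (t : ℕ) (i : Fin N) : ℝ :=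
  w t (population x₀ m a t i) / ∑ j, w t (population x₀ m a t j)

variable {w}

theorem popWeight_congr {a a' : ℕ → Fin N → Fin N} (t : ℕ) (h : ∀ s < t, a s = a' s) :
    popWeight x₀ m w a t = popWeight x₀ m w a' t := by
  funext i
  simp only [popWeight, population_congr x₀ m t h]

variable (hw : ∀ t e, 0 < w t e) (hN : 1 ≤ N)
include hw hN

theorem sum_weight_pos (a : ℕ → Fin N → Fin N) (t : ℕ) :
    0 < ∑ j, w t (population x₀ m a t j) :=
  Finset.sum_pos (fun _ _ => hw _ _) ⟨⟨0, hN⟩, Finset.mem_univ _⟩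

theorem sum_popWeight (a : ℕ → Fin N → Fin N) (t : ℕ) : ∑ i, popWeight x₀ m w a t i = 1 := by
  simp only [popWeight, ← Finset.sum_div]
  exact div_self (sum_weight_pos x₀ m hw hN a t).ne'

/-- The weights of generation `n` depend on earlier ancestor maps only, so the last map can be
summed out first as a product of probability vectors. -/
theorem sum_genealogy_eq_one (n : ℕ) :
    ∑ a : Fin n → Fin N → Fin N, ∏ t ∈ Finset.range n,
      ∏ i, popWeight x₀ m w (extendAnc a) t (extendAnc a t i) = 1 := by
  induction n with
  | zero => simp
  | succ n ih =>
    rw [sum_snoc, ← ih]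
    refine Finset.sum_congr rfl fun a _ => ?_
    have h : ∀ α : Fin N → Fin N, ∏ t ∈ Finset.range (n + 1), ∏ i, popWeight x₀ m w
        (extendAnc (Fin.snoc a α : Fin (n + 1) → Fin N → Fin N)) t
        (extendAnc (Fin.snoc a α : Fin (n + 1) → Fin N → Fin N) t i) =
        (∏ t ∈ Finset.range n, ∏ i, popWeight x₀ m w (extendAnc a) t (extendAnc a t i)) *
        ((∏ i, popWeight x₀ m w (extendAnc a) n (α i)) * (1 : ℝ)) := fun α => by
      rw [Finset.prod_range_succ, extendAnc_snoc_last, popWeight_congr x₀ m n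
        (fun s hs => extendAnc_snoc a α hs), mul_one]
      congr 1
      refine Finset.prod_congr rfl fun t ht => ?_
      have ht' := Finset.mem_range.1 ht
      rw [extendAnc_snoc a α ht', popWeight_congr x₀ m t
        (fun s hs => extendAnc_snoc a α (hs.trans ht'))]
    simp_rw [h]
    rw [← Finset.mul_sum, sum_prod_mul_apply (sum_popWeight x₀ m hw hN _ n) ⟨0, hN⟩ (fun _ => 1)]
    simp [sum_popWeight x₀ m hw hN]

/-- This is the combinatorial core of unbiasedness. Summing out the last ancestor map leaves, for an
offspring `k`, the normalized weight of its ancestor; the denominator of this weight cancels against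
the average weight of that generation in `p̂`. What remains is an instance one generation shorter
with a new test function, so the induction runs over all `G`. In the end resampling has disappeared:
all lines of descent `b` contribute with the same factor, each with the product of its unnormalized
weights. -/
theorem sum_genealogy (n : ℕ) (G : E → ℝ) :
    ∑ a : Fin n → Fin N → Fin N, (∏ t ∈ Finset.range n,
      ((1 / (N : ℝ)) * ∑ j, w t (population x₀ m (extendAnc a) t j)) *
        ∏ i, popWeight x₀ m w (extendAnc a) t (extendAnc a t i)) *
      ((1 / (N : ℝ)) * ∑ k, w n (population x₀ m (extendAnc a) n k) *
        G (population x₀ m (extendAnc a) n k)) =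
    (1 / (N : ℝ)) ^ (n + 1) * ∑ b : Fin (n + 1) → Fin N,
      (∏ t ∈ Finset.range (n + 1), w t (lineage x₀ m (extendLast b) t)) *
        G (lineage x₀ m (extendLast b) n) := by
  induction n generalizing G with
  | zero =>
    simp only [Finset.univ_unique, Finset.range_zero, Finset.prod_empty, one_mul,
      Finset.sum_const, Finset.card_singleton, one_smul, zero_add, pow_one, Finset.range_one,
      Finset.prod_singleton, population, lineage]
    congr 1
    refine Fintype.sum_equiv (Equiv.funUnique (Fin 1) (Fin N)).symm _ _ fun k => ?_
    simp [extendLast]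
  | succ n ih =>
    -- The new test function looks one generation ahead: it averages, over the offspring index `k`,
    -- the weight and `G` after the move of `k`.
    have ih' := ih fun e => (1 / (N : ℝ)) * ∑ k, w (n + 1) (m n k e) * G (m n k e)
    rw [sum_snoc, sum_snoc]
    calc _ = ∑ a : Fin n → Fin N → Fin N, (∏ t ∈ Finset.range n,
          ((1 / (N : ℝ)) * ∑ j, w t (population x₀ m (extendAnc a) t j)) *
            ∏ i, popWeight x₀ m w (extendAnc a) t (extendAnc a t i)) *
          ((1 / (N : ℝ)) * ∑ k, w n (population x₀ m (extendAnc a) n k) *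
            ((1 / (N : ℝ)) * ∑ k', w (n + 1) (m n k' (population x₀ m (extendAnc a) n k)) *
              G (m n k' (population x₀ m (extendAnc a) n k)))) := by
          refine Finset.sum_congr rfl fun a _ => ?_
          have h : ∀ α : Fin N → Fin N, (∏ t ∈ Finset.range (n + 1),
              ((1 / (N : ℝ)) * ∑ j, w t (population x₀ m
                (extendAnc (Fin.snoc a α : Fin (n + 1) → Fin N → Fin N)) t j)) *
              ∏ i, popWeight x₀ m w (extendAnc (Fin.snoc a α : Fin (n + 1) → Fin N → Fin N)) t
                (extendAnc (Fin.snoc a α : Fin (n + 1) → Fin N → Fin N) t i)) *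
              ((1 / (N : ℝ)) * ∑ k, w (n + 1) (population x₀ m
                (extendAnc (Fin.snoc a α : Fin (n + 1) → Fin N → Fin N)) (n + 1) k) *
                G (population x₀ m
                (extendAnc (Fin.snoc a α : Fin (n + 1) → Fin N → Fin N)) (n + 1) k)) =
              (∏ t ∈ Finset.range n,
                ((1 / (N : ℝ)) * ∑ j, w t (population x₀ m (extendAnc a) t j)) *
                ∏ i, popWeight x₀ m w (extendAnc a) t (extendAnc a t i)) *
              ((1 / (N : ℝ)) * ∑ j, w n (population x₀ m (extendAnc a) n j)) *
              (1 / (N : ℝ)) * ∑ k, (∏ i, popWeight x₀ m w (extendAnc a) n (α i)) *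
                (fun j => w (n + 1) (m n k (population x₀ m (extendAnc a) n j)) *
                  G (m n k (population x₀ m (extendAnc a) n j))) (α k) := fun α => by
            have hpop : ∀ t ≤ n, population x₀ m
                (extendAnc (Fin.snoc a α : Fin (n + 1) → Fin N → Fin N)) t =
                population x₀ m (extendAnc a) t := fun t ht =>
              population_congr x₀ m t fun s hs => extendAnc_snoc a α (hs.trans_le ht)
            have hpw : ∀ t ≤ n, popWeight x₀ m w
                (extendAnc (Fin.snoc a α : Fin (n + 1) → Fin N → Fin N)) t =
                popWeight x₀ m w (extendAnc a) t := fun t ht =>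
              popWeight_congr x₀ m t fun s hs => extendAnc_snoc a α (hs.trans_le ht)
            have hprod : ∏ t ∈ Finset.range n,
                ((1 / (N : ℝ)) * ∑ j, w t (population x₀ m
                  (extendAnc (Fin.snoc a α : Fin (n + 1) → Fin N → Fin N)) t j)) *
                ∏ i, popWeight x₀ m w (extendAnc (Fin.snoc a α : Fin (n + 1) → Fin N → Fin N)) t
                  (extendAnc (Fin.snoc a α : Fin (n + 1) → Fin N → Fin N) t i) =
                ∏ t ∈ Finset.range n,
                ((1 / (N : ℝ)) * ∑ j, w t (population x₀ m (extendAnc a) t j)) *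
                ∏ i, popWeight x₀ m w (extendAnc a) t (extendAnc a t i) := by
              refine Finset.prod_congr rfl fun t ht => ?_
              have ht' := Finset.mem_range.1 ht
              rw [hpop t ht'.le, hpw t ht'.le, extendAnc_snoc a α ht']
            rw [Finset.prod_range_succ, hprod]
            simp only [population, extendAnc_snoc_last, hpop n le_rfl, hpw n le_rfl]
            rw [← Finset.mul_sum]
            ring
          simp_rw [h]
          rw [← Finset.mul_sum, Finset.sum_comm]
          refine (congrArg (fun z => _ * z) (Finset.sum_congr rfl fun k _ =>
            sum_prod_mul_apply (sum_popWeight x₀ m hw hN (extendAnc a) n) k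
            (fun j => w (n + 1) (m n k (population x₀ m (extendAnc a) n j)) *
                  G (m n k (population x₀ m (extendAnc a) n j))))).trans ?_
          -- The total weight `S` of generation `n` occurs once in `p̂` and once as the
          -- normalization of the ancestor probabilities; its positivity permits the cancellation.
          have hS := (sum_weight_pos x₀ m hw hN (extendAnc a) n).ne'
          rw [mul_assoc, mul_assoc]
          congr 1
          simp only [popWeight]
          generalize ∑ j, w n (population x₀ m (extendAnc a) n j) = S at hS ⊢
          rw [Finset.sum_comm]
          simp only [Finset.mul_sum]
          refine Finset.sum_congr rfl fun j _ => Finset.sum_congr rfl fun k _ => ?_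
          field_simp
      _ = _ := ih'
      _ = _ := by
        simp only [Finset.mul_sum]
        refine Finset.sum_congr rfl fun b _ => Finset.sum_congr rfl fun k _ => ?_
        have hlin : ∀ t ≤ n, lineage x₀ m (extendLast (Fin.snoc b k : Fin (n + 2) → Fin N)) t =
            lineage x₀ m (extendLast b) t := fun t ht =>
          lineage_congr x₀ m t fun s hs => extendLast_snoc b k (hs.trans ht)
        rw [Finset.prod_range_succ _ (n + 1)]
        have hprod : ∏ t ∈ Finset.range (n + 1), w t (lineage x₀ m
            (extendLast (Fin.snoc b k : Fin (n + 2) → Fin N)) t) =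
            ∏ t ∈ Finset.range (n + 1), w t (lineage x₀ m (extendLast b) t) :=
          Finset.prod_congr rfl fun t ht => by
            rw [hlin t (Nat.lt_succ_iff.1 (Finset.mem_range.1 ht))]
        rw [hprod]
        simp only [lineage, extendLast_snoc_last, hlin n le_rfl]
        ring

end Genealogy

end VolterraMCMC

namespace VolterraMCMC

namespace Model

variable {d : ℕ} {Θ : Set (Fin d → ℝ)} {Y : Type*} {𝓜 : Model Θ Y}

/-! ### Measurability of the particle filter -/

section FilterMeasurability

variable {T N l : ℕ}

theorem measurable_inc (t : ℕ) (i : Fin N) (k : ℕ) :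
    Measurable fun u : Particles T N l => inc u t i k := by
  unfold inc
  split_ifs with ht hk
  · exact (measurable_pi_apply (⟨k, hk⟩ : Fin (2 ^ l))).comp ((measurable_pi_apply i).comp
      ((measurable_pi_apply (⟨t, ht⟩ : Fin T)).comp measurable_fst))
  · exact measurable_const
  · exact measurable_const

theorem measurable_anc (t : ℕ) (i : Fin N) :
    Measurable fun u : Particles T N l => anc u t i := by
  unfold anc
  split_ifs with ht
  · exact (measurable_pi_apply i).comp ((measurable_pi_apply (⟨t, ht⟩ : Fin (T - 1))).comp
      (measurable_fst.comp measurable_snd))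
  · exact measurable_const

theorem measurable_path (t : ℕ) (i : Fin N) :
    Measurable fun u : Particles T N l => path u t i := by
  induction t generalizing i with
  | zero => exact measurable_pi_lambda _ fun j => measurable_inc 0 i j
  | succ t ih =>
    refine measurable_pi_lambda _ fun j => ?_
    simp only [path]
    split_ifs
    · exact (measurable_pi_apply j).comp (measurable_select ih (measurable_anc t i))
    · exact measurable_inc _ _ _

theorem measurable_output : Measurable fun u : Particles T N l => output u :=
  measurable_select (fun i => measurable_path (T - 1) i) (measurable_snd.comp measurable_snd)

variable {β : ℝ} {T' : ℕ} (h𝓜 : 𝓜.IsRegular T' β) (hA1 : 𝓜.A1)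
include h𝓜 hA1

theorem measurable_weight (t : ℕ) (i : Fin N) :
    Measurable fun x : State Θ T N l => 𝓜.weight x.1 x.2 t i :=
  (h𝓜.measurable_maxLik hA1 l t).comp
    (measurable_fst.prodMk ((measurable_path t i).comp measurable_snd))

theorem measurable_normWeight (t : ℕ) (i : Fin N) :
    Measurable fun x : State Θ T N l => 𝓜.normWeight x.1 x.2 t i :=
  (measurable_weight h𝓜 hA1 t i).div
    (Finset.measurable_sum _ fun j _ => measurable_weight h𝓜 hA1 t j)

theorem measurable_normConst :
    Measurable fun x : State Θ T N l => 𝓜.normConst x.1 x.2 :=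
  Finset.measurable_prod _ fun t _ =>
    (Finset.measurable_sum _ fun j _ => measurable_weight h𝓜 hA1 t j).const_mul _

theorem measurable_filterDensity :
    Measurable fun x : State Θ T N l => 𝓜.filterDensity x.1 x.2 := by
  refine Measurable.mul (Finset.measurable_prod _ fun t _ => Finset.measurable_prod _ fun i _ => ?_)
    ?_
  · exact measurable_select (f := fun j (x : State Θ T N l) => 𝓜.normWeight x.1 x.2 t.1 j)
      (fun j => measurable_normWeight h𝓜 hA1 t.1 j) ((measurable_pi_apply i).comp
        ((measurable_pi_apply t).comp (measurable_fst.comp (measurable_snd.comp measurable_snd))))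
  · exact measurable_select (f := fun j (x : State Θ T N l) => 𝓜.normWeight x.1 x.2 (T - 1) j)
      (fun j => measurable_normWeight h𝓜 hA1 (T - 1) j)
      (measurable_snd.comp (measurable_snd.comp measurable_snd))

end FilterMeasurability

/-! ### Unbiasedness of the particle filter -/

section Unbiased

variable {n N l : ℕ}

/-- The increments `z`, continued by zero. -/
def increments {T : ℕ} (z : Fin T → Fin N → Fin (2 ^ l) → ℝ) (t : ℕ) (i : Fin N) (k : ℕ) : ℝ :=
  if ht : t < T then if hk : k < 2 ^ l then z ⟨t, ht⟩ i ⟨k, hk⟩ else 0 else 0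

/-- Continuation of a trajectory by the increments of particle `i` on the next unit interval. -/
def continuation {T : ℕ} (z : Fin T → Fin N → Fin (2 ^ l) → ℝ) (t : ℕ) (i : Fin N) (e : ℕ → ℝ)
    (j : ℕ) : ℝ :=
  if j < (t + 1) * 2 ^ l then e j else increments z (t + 1) i (j - (t + 1) * 2 ^ l)

theorem path_eq_population {T : ℕ} (u : Particles T N l) (t : ℕ) :
    path u t = population (increments u.1 0) (continuation u.1) (extendAnc u.2.1) t := by
  induction t with
  | zero => rfl
  | succ t ih =>
    funext i j
    simp only [path, population, ih]
    rfl

theorem normWeight_eq_popWeight {T : ℕ} (θ : Θ) (u : Particles T N l) (t : ℕ) :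
    𝓜.normWeight θ u t = popWeight (increments u.1 0) (continuation u.1)
      (fun t e => 𝓜.maxLik l t θ e) (extendAnc u.2.1) t := by
  funext i
  simp only [normWeight, weight, popWeight, path_eq_population]

theorem filterDensity_eq (θ : Θ) (z : Fin (n + 1) → Fin N → Fin (2 ^ l) → ℝ)
    (a : Fin n → Fin N → Fin N) (k : Fin N) :
    𝓜.filterDensity (T := n + 1) θ (z, a, k) =
      (∏ t ∈ Finset.range n, ∏ i, popWeight (increments z 0) (continuation z)
        (fun t e => 𝓜.maxLik l t θ e) (extendAnc a) t (extendAnc a t i)) *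
      popWeight (increments z 0) (continuation z) (fun t e => 𝓜.maxLik l t θ e)
        (extendAnc a) n k := by
  rw [filterDensity, Finset.prod_range]
  simp only [normWeight_eq_popWeight]
  congr 1
  refine Finset.prod_congr rfl fun t _ => Finset.prod_congr rfl fun i _ => ?_
  congr 1
  simp [extendAnc]

theorem sum_filterDensity (hA1 : 𝓜.A1) (hN : 1 ≤ N) (θ : Θ)
    (z : Fin (n + 1) → Fin N → Fin (2 ^ l) → ℝ) :
    ∑ a : Fin n → Fin N → Fin N, ∑ k : Fin N, 𝓜.filterDensity (T := n + 1) θ (z, a, k) = 1 := by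
  have hw : ∀ (t : ℕ) (e : ℕ → ℝ), 0 < 𝓜.maxLik l t θ e := fun t e => hA1.maxLik_pos l t θ e
  simp_rw [filterDensity_eq, ← Finset.mul_sum]
  rw [← sum_genealogy_eq_one (increments z 0) (continuation z) hw hN n]
  refine Finset.sum_congr rfl fun a _ => ?_
  rw [sum_popWeight _ _ hw hN, mul_one]

theorem filterDensity_nonneg (hA1 : 𝓜.A1) {T : ℕ} (θ : Θ) (u : Particles T N l) :
    0 ≤ 𝓜.filterDensity θ u := by
  have h : ∀ t i, 0 ≤ 𝓜.normWeight θ u t i := fun t i =>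
    div_nonneg (hA1.maxLik_pos _ _ _ _).le
      (Finset.sum_nonneg fun j _ => (hA1.maxLik_pos _ _ _ _).le)
  exact mul_nonneg (Finset.prod_nonneg fun t _ => Finset.prod_nonneg fun i _ => h _ _) (h _ _)

theorem normConst_pos (hA1 : 𝓜.A1) (hN : 1 ≤ N) {T : ℕ} (θ : Θ) (u : Particles T N l) :
    0 < 𝓜.normConst θ u := by
  have hN' : (0 : ℝ) < N := by exact_mod_cast hN
  exact Finset.prod_pos fun t _ => mul_pos (by positivity)
    (Finset.sum_pos (fun j _ => hA1.maxLik_pos _ _ _ _) ⟨⟨0, hN⟩, Finset.mem_univ _⟩)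

/-- The final selection at time `T` is one more normalized weight, whose denominator cancels against
the last factor of `p̂`. This brings the sum into the form of `sum_genealogy`. -/
theorem sum_normConst_mul_filterDensity (hA1 : 𝓜.A1) (hN : 1 ≤ N) (θ : Θ)
    (z : Fin (n + 1) → Fin N → Fin (2 ^ l) → ℝ) (G : (ℕ → ℝ) → ℝ) :
    ∑ a : Fin n → Fin N → Fin N, ∑ k : Fin N,
      𝓜.normConst (T := n + 1) θ (z, a, k) * 𝓜.filterDensity (T := n + 1) θ (z, a, k) *
        G (output (T := n + 1) (z, a, k)) =
    (1 / (N : ℝ)) ^ (n + 1) * ∑ b : Fin (n + 1) → Fin N,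
      (∏ t ∈ Finset.range (n + 1), 𝓜.maxLik l t θ
        (lineage (increments z 0) (continuation z) (extendLast b) t)) *
        G (lineage (increments z 0) (continuation z) (extendLast b) n) := by
  have hw : ∀ (t : ℕ) (e : ℕ → ℝ), 0 < 𝓜.maxLik l t θ e := fun t e => hA1.maxLik_pos l t θ e
  rw [← sum_genealogy (increments z 0) (continuation z) hw hN n G]
  refine Finset.sum_congr rfl fun a _ => ?_
  rw [Finset.mul_sum, Finset.mul_sum]
  refine Finset.sum_congr rfl fun k _ => ?_
  have hS := (sum_weight_pos (increments z 0) (continuation z) hw hN (extendAnc a) n).ne'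
  rw [filterDensity_eq, normConst, Finset.prod_range_succ]
  simp only [weight, output, path_eq_population, Nat.add_sub_cancel]
  conv_rhs => rw [Finset.prod_mul_distrib]
  generalize (∏ t ∈ Finset.range n, ∏ i, popWeight (increments z 0) (continuation z)
    (fun t e => 𝓜.maxLik l t θ e) (extendAnc a) t (extendAnc a t i)) = B
  generalize (∏ t ∈ Finset.range n, ((1 / (N : ℝ)) * ∑ j, 𝓜.maxLik l t θ
    (population (increments z 0) (continuation z) (extendAnc a) t j))) = A
  rw [popWeight]
  field_simp

/-- Position `j` lies in the unit interval number `j / 2 ^ l`, where the line of descent follows the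
particle `b (j / 2 ^ l)`. Beyond the horizon the value is zero because `increments` vanishes for
local indices from `2 ^ l` on. -/
theorem lineage_increments (z : Fin (n + 1) → Fin N → Fin (2 ^ l) → ℝ) (b : ℕ → Fin N) (t j : ℕ) :
    lineage (increments z 0) (continuation z) b t j =
      if j < (t + 1) * 2 ^ l then increments z (j / 2 ^ l) (b (j / 2 ^ l)) (j % 2 ^ l) else 0 := by
  have hpos : 0 < 2 ^ l := Nat.two_pow_pos l
  have hzero : ∀ s i k, 2 ^ l ≤ k → increments z s i k = 0 := fun s i k hk => by
    simp only [increments, not_lt.2 hk, dif_neg, not_false_eq_true]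
    split_ifs <;> rfl
  induction t generalizing j with
  | zero =>
    simp only [lineage, zero_add, one_mul]
    split_ifs with h
    · rw [Nat.div_eq_of_lt h, Nat.mod_eq_of_lt h]
    · exact hzero _ _ _ (not_lt.1 h)
  | succ t ih =>
    simp only [lineage, continuation, ih]
    split_ifs with h1 h2 h2
    · rfl
    · exact absurd (h1.trans (Nat.mul_lt_mul_of_pos_right (Nat.lt_succ_self _) hpos)) h2
    · have h3 : j / 2 ^ l = t + 1 := by
        refine Nat.div_eq_of_lt_le (not_lt.1 h1) ?_
        simpa using h2
      have h4 : j % 2 ^ l = j - (t + 1) * 2 ^ l := by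
        rw [Nat.mod_eq_sub_div_mul, h3]
      rw [h3, h4]
    · refine hzero _ _ _ ?_
      rw [not_lt] at h2
      have : (t + 1 + 1) * 2 ^ l = (t + 1) * 2 ^ l + 2 ^ l := by ring
      omega

/-- The increments selected along the line of descent `b`. -/
def pick (b : Fin (n + 1) → Fin N) (z : Fin (n + 1) → Fin N → Fin (2 ^ l) → ℝ)
    (j : Fin ((n + 1) * 2 ^ l)) : ℝ :=
  z (finProdFinEquiv.symm j).1 (b (finProdFinEquiv.symm j).1) (finProdFinEquiv.symm j).2

theorem lineage_eq_extend_pick (b : Fin (n + 1) → Fin N)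
    (z : Fin (n + 1) → Fin N → Fin (2 ^ l) → ℝ) :
    lineage (increments z 0) (continuation z) (extendLast b) n = extend (pick b z) := by
  have hpos : 0 < 2 ^ l := Nat.two_pow_pos l
  funext j
  rw [lineage_increments, extend]
  split_ifs with h
  · have h1 : j / 2 ^ l < n + 1 := (Nat.div_lt_iff_lt_mul hpos).2 h
    have h2 : j % 2 ^ l < 2 ^ l := Nat.mod_lt _ hpos
    have e1 : (⟨min (j / 2 ^ l) n, Nat.lt_succ_of_le (min_le_right _ n)⟩ : Fin (n + 1)) =
        ⟨j / 2 ^ l, h1⟩ := Fin.ext (min_eq_left (Nat.lt_succ_iff.1 h1))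
    simp only [increments, h1, h2, dif_pos, extendLast, e1]
    rfl
  · rfl

/-- Later generations extend a trajectory without changing its past, so all factors along a line can
be read off the final trajectory. -/
theorem maxLik_lineage (θ : Θ) (z : Fin (n + 1) → Fin N → Fin (2 ^ (l + 1)) → ℝ)
    (b : ℕ → Fin N) {t : ℕ} (ht : t < n + 1) :
    𝓜.maxLik (l + 1) t θ (lineage (increments z 0) (continuation z) b t) =
      𝓜.maxLik (l + 1) t θ (lineage (increments z 0) (continuation z) b n) := by
  refine maxLik_congr l t θ fun j hj => ?_
  rw [lineage_increments, lineage_increments, if_pos hj, if_pos (index_lt ht hj)]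

theorem measurable_pick (b : Fin (n + 1) → Fin N) :
    Measurable (pick b : (Fin (n + 1) → Fin N → Fin (2 ^ l) → ℝ) → _) := by
  refine measurable_pi_lambda _ fun j => ?_
  exact (measurable_pi_apply _).comp ((measurable_pi_apply _).comp (measurable_pi_apply _))

/-- A fixed line of descent reads exactly one particle in each time interval, hence distinct
coordinates of the product space. The selected increments are therefore again independent with law
`μ`, whatever the line is. -/
theorem map_pick (μ : Measure ℝ) [IsProbabilityMeasure μ] (b : Fin (n + 1) → Fin N) :
    (Measure.pi fun _ : Fin (n + 1) => Measure.pi fun _ : Fin N =>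
      Measure.pi fun _ : Fin (2 ^ l) => μ).map (pick b) = Measure.pi fun _ => μ := by
  refine (Measure.pi_eq fun s hs => ?_).symm
  rw [Measure.map_apply (measurable_pick b) (MeasurableSet.univ_pi hs)]
  have hset : pick b ⁻¹' Set.univ.pi s = Set.univ.pi fun t : Fin (n + 1) =>
      Set.univ.pi fun i : Fin N => if i = b t then
        Set.univ.pi fun k : Fin (2 ^ l) => s (finProdFinEquiv (t, k)) else Set.univ := by
    ext z
    simp only [Set.mem_preimage, Set.mem_univ_pi, pick]
    constructor
    · intro h t i
      split_ifs with hi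
      · subst hi
        intro k _
        have := h (finProdFinEquiv (t, k))
        rwa [Equiv.symm_apply_apply] at this
      · trivial
    · intro h j
      have h1 := h (finProdFinEquiv.symm j).1 (b (finProdFinEquiv.symm j).1)
      rw [if_pos rfl] at h1
      have h2 := h1 (finProdFinEquiv.symm j).2 trivial
      dsimp only at h2
      rwa [Prod.mk.eta, Equiv.apply_symm_apply] at h2
  rw [hset, Measure.pi_pi]
  have h1 : ∀ t : Fin (n + 1), (Measure.pi fun _ : Fin N => Measure.pi fun _ : Fin (2 ^ l) => μ)
      (Set.univ.pi fun i : Fin N => if i = b t then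
        Set.univ.pi fun k : Fin (2 ^ l) => s (finProdFinEquiv (t, k)) else Set.univ) =
      ∏ k, μ (s (finProdFinEquiv (t, k))) := fun t => by
    rw [Measure.pi_pi, Finset.prod_eq_single (b t)]
    · rw [if_pos rfl, Measure.pi_pi]
    · intro i _ hi; rw [if_neg hi, measure_univ]
    · simp
  simp_rw [h1]
  rw [← Fintype.prod_prod_type']
  exact Fintype.prod_equiv finProdFinEquiv _ _ fun p => rfl

theorem measurable_extend {k : ℕ} : Measurable (extend : (Fin k → ℝ) → ℕ → ℝ) := by
  refine measurable_pi_lambda _ fun j => ?_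
  unfold extend
  split_ifs
  · exact measurable_pi_apply _
  · exact measurable_const

/-- The increments on `[0, T]` of the trajectory that the filter returns. -/
def outputIncr {T : ℕ} (u : Particles T N l) (j : Fin (T * 2 ^ l)) : ℝ := output u j

theorem measurable_outputIncr {T : ℕ} :
    Measurable (outputIncr : Particles T N l → Fin (T * 2 ^ l) → ℝ) :=
  measurable_pi_lambda _ fun j => (measurable_pi_apply j.1).comp measurable_output

theorem lintegral_particleRef {T : ℕ} {F : Particles T N l → ℝ≥0∞} (hF : Measurable F) :
    ∫⁻ u, F u ∂(particleRef T N l) = ∫⁻ z, ∑ a, ∑ k, F (z, a, k) ∂(Measure.pi fun _ : Fin T =>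
      Measure.pi fun _ : Fin N => Measure.pi fun _ : Fin (2 ^ l) => gaussianReal 0 (step l)) := by
  rw [particleRef, lintegral_prod _ hF.aemeasurable]
  refine lintegral_congr fun z => ?_
  have h1 : Measurable fun p : (Fin (T - 1) → Fin N → Fin N) × Fin N => F (z, p) :=
    hF.comp measurable_prodMk_left
  rw [lintegral_prod _ h1.aemeasurable, lintegral_count, tsum_fintype]
  exact Finset.sum_congr rfl fun a _ => by rw [lintegral_count, tsum_fintype]

/-- Unbiasedness of the filter, with a test function of the returned trajectory: after the indices
are summed out, every line of descent contributes the same integral, by `map_pick`. -/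
theorem lintegral_normConst_mul_filterDensity {T' : ℕ} {β : ℝ} (h𝓜 : 𝓜.IsRegular T' β)
    (hA1 : 𝓜.A1) {T : ℕ} (hT : 1 ≤ T) (hN : 1 ≤ N) (θ : Θ) {G : (ℕ → ℝ) → ℝ}
    (hG : Measurable G) (hG0 : ∀ w, 0 ≤ G w) :
    ∫⁻ u, ENNReal.ofReal (𝓜.normConst θ u * 𝓜.filterDensity θ u * G (output u))
      ∂(particleRef T N (l + 1)) =
    ∫⁻ w : Fin (T * 2 ^ (l + 1)) → ℝ,
      ENNReal.ofReal ((∏ t ∈ Finset.range T, 𝓜.maxLik (l + 1) t θ (extend w)) * G (extend w))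
      ∂(Measure.pi fun _ => gaussianReal 0 (step (l + 1))) := by
  obtain ⟨n, rfl⟩ : ∃ n, T = n + 1 := ⟨T - 1, (Nat.sub_add_cancel hT).symm⟩
  have hN' : (N : ℝ) ≠ 0 := by exact_mod_cast (Nat.one_le_iff_ne_zero.1 hN)
  have hp : Measurable fun u : Particles (n + 1) N (l + 1) =>
      ((θ, u) : State Θ (n + 1) N (l + 1)) := measurable_prodMk_left
  have hm0 : Measurable fun x : State Θ (n + 1) N (l + 1) =>
      𝓜.normConst x.1 x.2 * 𝓜.filterDensity x.1 x.2 :=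
    (measurable_normConst h𝓜 hA1).mul (measurable_filterDensity h𝓜 hA1)
  have hm1 : Measurable fun u : Particles (n + 1) N (l + 1) =>
      𝓜.normConst θ u * 𝓜.filterDensity θ u * G (output u) :=
    (hm0.comp hp).mul (hG.comp measurable_output)
  have hm2 : Measurable fun w : Fin ((n + 1) * 2 ^ (l + 1)) → ℝ =>
      (∏ t ∈ Finset.range (n + 1), 𝓜.maxLik (l + 1) t θ (extend w)) * G (extend w) :=
    (Finset.measurable_prod _ fun t _ => (h𝓜.measurable_maxLik hA1 (l + 1) t).comp
      (measurable_const.prodMk measurable_extend)).mul (hG.comp measurable_extend)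
  rw [lintegral_particleRef hm1.ennreal_ofReal]
  have hnn : ∀ u : Particles (n + 1) N (l + 1),
      0 ≤ 𝓜.normConst θ u * 𝓜.filterDensity θ u * G (output u) := fun u =>
    mul_nonneg (mul_nonneg (normConst_pos hA1 hN θ u).le (filterDensity_nonneg hA1 θ u)) (hG0 _)
  have hnn2 : ∀ w : Fin ((n + 1) * 2 ^ (l + 1)) → ℝ,
      0 ≤ (∏ t ∈ Finset.range (n + 1), 𝓜.maxLik (l + 1) t θ (extend w)) * G (extend w) := fun w =>
    mul_nonneg (Finset.prod_nonneg fun t _ => (hA1.maxLik_pos _ _ _ _).le) (hG0 _)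
  have h1 : ∀ z : Fin (n + 1) → Fin N → Fin (2 ^ (l + 1)) → ℝ,
      ∑ a : Fin (n + 1 - 1) → Fin N → Fin N, ∑ k : Fin N,
        ENNReal.ofReal (𝓜.normConst (T := n + 1) θ (z, a, k) *
        𝓜.filterDensity (T := n + 1) θ (z, a, k) * G (output (T := n + 1) (z, a, k))) =
      ∑ b : Fin (n + 1) → Fin N, ENNReal.ofReal ((1 / (N : ℝ)) ^ (n + 1)) *
        ENNReal.ofReal ((∏ t ∈ Finset.range (n + 1),
          𝓜.maxLik (l + 1) t θ (extend (pick b z))) * G (extend (pick b z))) := by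
    intro z
    simp_rw [← ENNReal.ofReal_sum_of_nonneg (fun k _ => hnn _)]
    rw [← ENNReal.ofReal_sum_of_nonneg (fun a _ => Finset.sum_nonneg fun k _ => hnn _)]
    have h2 := sum_normConst_mul_filterDensity hA1 hN θ z G
    refine (congrArg ENNReal.ofReal h2).trans ?_
    rw [ENNReal.ofReal_mul (by positivity), ← Finset.mul_sum,
      ← ENNReal.ofReal_sum_of_nonneg (fun b _ => hnn2 _)]
    congr 2
    refine Finset.sum_congr rfl fun b _ => ?_
    rw [← lineage_eq_extend_pick]
    congr 1
    exact Finset.prod_congr rfl fun t ht => maxLik_lineage θ z _ (Finset.mem_range.1 ht)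
  have hm3 : ∀ b : Fin (n + 1) → Fin N, Measurable fun z : Fin (n + 1) → Fin N →
      Fin (2 ^ (l + 1)) → ℝ => ENNReal.ofReal ((1 / (N : ℝ)) ^ (n + 1)) *
        ENNReal.ofReal ((∏ t ∈ Finset.range (n + 1),
          𝓜.maxLik (l + 1) t θ (extend (pick b z))) * G (extend (pick b z))) := fun b =>
    (hm2.ennreal_ofReal.comp (measurable_pick b)).const_mul _
  rw [lintegral_congr h1, lintegral_finsetSum _ fun b _ => hm3 b]
  have h3 : ∀ b : Fin (n + 1) → Fin N, ∫⁻ z, ENNReal.ofReal ((1 / (N : ℝ)) ^ (n + 1)) *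
        ENNReal.ofReal ((∏ t ∈ Finset.range (n + 1),
          𝓜.maxLik (l + 1) t θ (extend (pick b z))) * G (extend (pick b z)))
        ∂(Measure.pi fun _ : Fin (n + 1) => Measure.pi fun _ : Fin N =>
          Measure.pi fun _ : Fin (2 ^ (l + 1)) => gaussianReal 0 (step (l + 1))) =
      ENNReal.ofReal ((1 / (N : ℝ)) ^ (n + 1)) * ∫⁻ w : Fin ((n + 1) * 2 ^ (l + 1)) → ℝ,
        ENNReal.ofReal ((∏ t ∈ Finset.range (n + 1), 𝓜.maxLik (l + 1) t θ (extend w)) *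
          G (extend w)) ∂(Measure.pi fun _ => gaussianReal 0 (step (l + 1))) := fun b => by
    have hm4 : Measurable fun z : Fin (n + 1) → Fin N → Fin (2 ^ (l + 1)) → ℝ =>
        ENNReal.ofReal ((∏ t ∈ Finset.range (n + 1),
          𝓜.maxLik (l + 1) t θ (extend (pick b z))) * G (extend (pick b z))) :=
      hm2.ennreal_ofReal.comp (measurable_pick b)
    rw [lintegral_const_mul _ hm4,
      ← map_pick (gaussianReal 0 (step (l + 1))) b,
      lintegral_map hm2.ennreal_ofReal (measurable_pick b)]
  simp_rw [h3]
  rw [Finset.sum_const, Finset.card_univ, Fintype.card_fun, Fintype.card_fin, Fintype.card_fin,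
    nsmul_eq_mul, ← mul_assoc]
  -- The number of lines of descent cancels the factors `1/N` of the `n + 1` averages in `p̂`.
  have h4 : ((N ^ (n + 1) : ℕ) : ℝ≥0∞) * ENNReal.ofReal ((1 / (N : ℝ)) ^ (n + 1)) = 1 := by
    rw [← ENNReal.ofReal_natCast, ← ENNReal.ofReal_mul (by positivity)]
    push_cast
    rw [← mul_pow, mul_one_div_cancel hN', one_pow, ENNReal.ofReal_one]
  rw [h4, one_mul]

theorem lintegral_filterDensity {T' : ℕ} {β : ℝ} (h𝓜 : 𝓜.IsRegular T' β)
    (hA1 : 𝓜.A1) {T : ℕ} (hT : 1 ≤ T) (hN : 1 ≤ N) (θ : Θ) :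
    ∫⁻ u, ENNReal.ofReal (𝓜.filterDensity θ u) ∂(particleRef T N l) = 1 := by
  obtain ⟨n, rfl⟩ : ∃ n, T = n + 1 := ⟨T - 1, (Nat.sub_add_cancel hT).symm⟩
  have hp : Measurable fun u : Particles (n + 1) N l => ((θ, u) : State Θ (n + 1) N l) :=
    measurable_prodMk_left
  have hm0 : Measurable fun x : State Θ (n + 1) N l => 𝓜.filterDensity x.1 x.2 :=
    measurable_filterDensity h𝓜 hA1
  have hm : Measurable fun u : Particles (n + 1) N l => 𝓜.filterDensity θ u := by
    have h := hm0.comp hp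
    simp only [Function.comp_def] at h
    exact h
  rw [lintegral_particleRef hm.ennreal_ofReal]
  have h1 : ∀ z : Fin (n + 1) → Fin N → Fin (2 ^ l) → ℝ,
      ∑ a : Fin (n + 1 - 1) → Fin N → Fin N, ∑ k : Fin N,
        ENNReal.ofReal (𝓜.filterDensity (T := n + 1) θ (z, a, k)) = 1 := fun z => by
    simp_rw [← ENNReal.ofReal_sum_of_nonneg (fun k _ => filterDensity_nonneg hA1 θ _)]
    rw [← ENNReal.ofReal_sum_of_nonneg
      (fun a _ => Finset.sum_nonneg fun k _ => filterDensity_nonneg hA1 θ _)]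
    exact (congrArg ENNReal.ofReal (sum_filterDensity hA1 hN θ z)).trans ENNReal.ofReal_one
  rw [lintegral_congr h1, lintegral_one, measure_univ]

end Unbiased

end Model

end VolterraMCMC

namespace VolterraMCMC

/-! ### Metropolis–Hastings kernels -/

section MetropolisHastings

variable {S : Type*} [MeasurableSpace S] {μ : Measure S} [SFinite μ]

/-- The Metropolis–Hastings kernel with accepted proposal density `f` with respect to `μ`. -/
noncomputable def mhKernel (μ : Measure S) [SFinite μ] {f : S → S → ℝ≥0∞}
    (hf : Measurable (Function.uncurry f)) : Kernel S S where
  toFun x := μ.withDensity (f x) + (1 - ∫⁻ y, f x y ∂μ) • Measure.dirac x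
  measurable' := by
    refine Measure.measurable_of_measurable_coe _ fun A hA => ?_
    simp only [Measure.add_apply, Measure.smul_apply, withDensity_apply _ hA,
      Measure.dirac_apply' _ hA, smul_eq_mul]
    have h1 : Measurable fun x => ∫⁻ y in A, f x y ∂μ := hf.lintegral_prod_right
    have h2 : Measurable fun x => ∫⁻ y, f x y ∂μ := hf.lintegral_prod_right
    exact h1.add ((measurable_const.sub h2).mul (measurable_one.indicator hA))

theorem isMarkovKernel_mhKernel {f : S → S → ℝ≥0∞} (hf : Measurable (Function.uncurry f))
    (hle : ∀ x, ∫⁻ y, f x y ∂μ ≤ 1) : IsMarkovKernel (mhKernel μ hf) :=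
  ⟨fun x => ⟨by
    change (μ.withDensity (f x) + (1 - ∫⁻ y, f x y ∂μ) • Measure.dirac x) Set.univ = 1
    simp only [Measure.add_apply, Measure.smul_apply, withDensity_apply _ MeasurableSet.univ,
      Measure.restrict_univ, measure_univ, smul_eq_mul, mul_one]
    exact add_tsub_cancel_of_le (hle x)⟩⟩

/-- The flow from `A` to `B` has an accepted part, symmetric by detailed balance and Tonelli, and a
rejected part that stays put and so lives on `A ∩ B`. -/
theorem isReversible_mhKernel {f : S → S → ℝ≥0∞} (hf : Measurable (Function.uncurry f))
    {p : S → ℝ≥0∞} (hp : Measurable p) (hsymm : ∀ x y, p x * f x y = p y * f y x) :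
    (mhKernel μ hf).IsReversible (μ.withDensity p) := by
  have key : ∀ A B : Set S, MeasurableSet A → MeasurableSet B →
      ∫⁻ x in A, mhKernel μ hf x B ∂(μ.withDensity p) =
        ∫⁻ x in A, ∫⁻ y in B, p x * f x y ∂μ ∂μ +
        ∫⁻ x in A ∩ B, p x * (1 - ∫⁻ y, f x y ∂μ) ∂μ := by
    intro A B hA hB
    have h1 : Measurable fun x => ∫⁻ y in B, f x y ∂μ := hf.lintegral_prod_right
    have h2 : Measurable fun x => ∫⁻ y, f x y ∂μ := hf.lintegral_prod_right
    have h3 : Measurable fun x => p x * ∫⁻ y in B, f x y ∂μ := hp.mul h1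
    rw [setLIntegral_withDensity_eq_setLIntegral_mul μ hp ((mhKernel μ hf).measurable_coe hB) hA]
    have e : ∀ x, (p * fun x => mhKernel μ hf x B) x = p x * ∫⁻ y in B, f x y ∂μ +
        B.indicator (fun x => p x * (1 - ∫⁻ y, f x y ∂μ)) x := fun x => by
      change p x * (μ.withDensity (f x) + (1 - ∫⁻ y, f x y ∂μ) • Measure.dirac x) B = _
      simp only [Measure.add_apply, Measure.smul_apply, withDensity_apply _ hB,
        Measure.dirac_apply' _ hB, smul_eq_mul, mul_add]
      by_cases hx : x ∈ B <;> simp [hx]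
    simp_rw [e]
    rw [lintegral_add_left h3, lintegral_indicator hB, Measure.restrict_restrict hB,
      Set.inter_comm B A]
    congr 1
    refine lintegral_congr fun x => ?_
    have hfx : Measurable (f x) := hf.comp measurable_prodMk_left
    rw [lintegral_const_mul _ hfx]
  intro A B hA hB
  rw [key A B hA hB, key B A hB hA, Set.inter_comm]
  congr 1
  have hm : Measurable (Function.uncurry fun x y => p x * f x y) :=
    (hp.comp measurable_fst).mul hf
  rw [lintegral_lintegral_swap hm.aemeasurable]
  simp_rw [hsymm]

end MetropolisHastings

namespace Model

variable {d : ℕ} {Θ : Set (Fin d → ℝ)} {Y : Type*} {𝓜 : Model Θ Y} {T N l : ℕ}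

instance : IsProbabilityMeasure (gaussianReal 0 (step l)) := inferInstance

instance : SigmaFinite (particleRef T N l) := by
  unfold particleRef; infer_instance

/-- Both sides equal `min a b` for the forward and backward flows `a`, `b`, since `a · min(1, b/a) =
min(a, b)`. The convention of accepting when `a = 0` is compatible with this. -/
theorem accept_mul_symm (hA1 : 𝓜.A1) (hN : 1 ≤ N) (q : Θ → Θ → ℝ≥0) (x x' : State Θ T N l) :
    𝓜.normConst x.1 x.2 * 𝓜.prior x.1 * q x.1 x'.1 * 𝓜.accept q x x' =
      𝓜.normConst x'.1 x'.2 * 𝓜.prior x'.1 * q x'.1 x.1 * 𝓜.accept q x' x := by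
  have key : ∀ a b : ℝ, 0 ≤ a → 0 ≤ b →
      a * (if a = 0 then 1 else min 1 (b / a)) = min a b := fun a b ha hb => by
    split_ifs with h
    · rw [h, zero_mul, min_eq_left hb]
    · rw [mul_min_of_nonneg _ _ ha, mul_one, mul_div_cancel₀ _ h]
  have h1 := (normConst_pos hA1 hN x.1 x.2).le
  have h2 := (normConst_pos hA1 hN x'.1 x'.2).le
  unfold accept
  rw [key _ _ (by positivity) (by positivity), key _ _ (by positivity) (by positivity), min_comm]

theorem accept_le_one (q : Θ → Θ → ℝ≥0) (x x' : State Θ T N l) : 𝓜.accept q x x' ≤ 1 := by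
  unfold accept
  split_ifs
  · exact le_rfl
  · exact min_le_left _ _

/-- The density of accepted proposals. -/
noncomputable def acceptedDensity (𝓜 : Model Θ Y) (q : Θ → Θ → ℝ≥0) (x x' : State Θ T N l) :
    ℝ≥0∞ :=
  (q x.1 x'.1 : ℝ≥0∞) * ENNReal.ofReal (𝓜.filterDensity x'.1 x'.2) *
    ENNReal.ofReal (𝓜.accept q x x')

/-- The unnormalized density of the invariant law of coupled MCMC. -/
noncomputable def targetDensity (𝓜 : Model Θ Y) (x : State Θ T N l) : ℝ≥0∞ :=
  ENNReal.ofReal (𝓜.normConst x.1 x.2 * 𝓜.filterDensity x.1 x.2) * 𝓜.prior x.1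

/-- Detailed balance on the extended space: the filter density of the current state comes from the
target, that of the proposed state from the proposal. Their product is symmetric, and it drops out
of the acceptance ratio. -/
theorem targetDensity_symm (hA1 : 𝓜.A1) (hN : 1 ≤ N) (q : Θ → Θ → ℝ≥0) (x x' : State Θ T N l) :
    𝓜.targetDensity x * 𝓜.acceptedDensity q x x' =
      𝓜.targetDensity x' * 𝓜.acceptedDensity q x' x := by
  have key : ∀ x x' : State Θ T N l, 𝓜.targetDensity x * 𝓜.acceptedDensity q x x' =
      ENNReal.ofReal (𝓜.filterDensity x.1 x.2 * 𝓜.filterDensity x'.1 x'.2 *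
        (𝓜.normConst x.1 x.2 * 𝓜.prior x.1 * q x.1 x'.1 * 𝓜.accept q x x')) := fun x x' => by
    have h1 := (normConst_pos hA1 hN x.1 x.2).le
    have h2 := filterDensity_nonneg hA1 x.1 x.2
    have h3 := filterDensity_nonneg hA1 x'.1 x'.2
    rw [targetDensity, acceptedDensity, ← ENNReal.ofReal_coe_nnreal (p := 𝓜.prior x.1),
      ← ENNReal.ofReal_coe_nnreal (p := q x.1 x'.1),
      ← ENNReal.ofReal_mul (by positivity), ← ENNReal.ofReal_mul (by positivity),
      ← ENNReal.ofReal_mul (by positivity), ← ENNReal.ofReal_mul (by positivity)]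
    congr 1
    ring
  rw [key, key, accept_mul_symm hA1 hN q x x', mul_comm (𝓜.filterDensity x.1 x.2)]

section Invariance

variable {T' : ℕ} {β : ℝ} (h𝓜 : 𝓜.IsRegular T' β) (hA1 : 𝓜.A1)
include h𝓜 hA1

theorem measurable_targetDensity :
    Measurable (𝓜.targetDensity : State Θ T N l → ℝ≥0∞) :=
  ((measurable_normConst h𝓜 hA1).mul (measurable_filterDensity h𝓜 hA1)).ennreal_ofReal.mul
    (h𝓜.prior_meas.comp measurable_fst).coe_nnreal_ennreal

theorem measurable_accept {q : Θ → Θ → ℝ≥0} (hq : IsProposal 𝓜.dθ q) :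
    Measurable (Function.uncurry (𝓜.accept q : State Θ T N l → State Θ T N l → ℝ)) := by
  have hnc : Measurable fun x : State Θ T N l => 𝓜.normConst x.1 x.2 * 𝓜.prior x.1 :=
    (measurable_normConst h𝓜 hA1).mul (h𝓜.prior_meas.comp measurable_fst).coe_nnreal_real
  have hq1 : Measurable fun p : State Θ T N l × State Θ T N l => (q p.1.1 p.2.1 : ℝ) :=
    (hq.meas.comp ((measurable_fst.comp measurable_fst).prodMk
      (measurable_fst.comp measurable_snd))).coe_nnreal_real
  have hq2 : Measurable fun p : State Θ T N l × State Θ T N l => (q p.2.1 p.1.1 : ℝ) :=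
    (hq.meas.comp ((measurable_fst.comp measurable_snd).prodMk
      (measurable_fst.comp measurable_fst))).coe_nnreal_real
  have ha := (hnc.comp measurable_fst).mul hq1
  have hb := (hnc.comp measurable_snd).mul hq2
  exact Measurable.ite (ha (measurableSet_singleton 0)) measurable_const
    (measurable_const.min (hb.div ha))

theorem measurable_acceptedDensity {q : Θ → Θ → ℝ≥0} (hq : IsProposal 𝓜.dθ q) :
    Measurable (Function.uncurry
      (𝓜.acceptedDensity q : State Θ T N l → State Θ T N l → ℝ≥0∞)) := by
  have hq1 : Measurable fun p : State Θ T N l × State Θ T N l => (q p.1.1 p.2.1 : ℝ≥0∞) :=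
    (hq.meas.comp ((measurable_fst.comp measurable_fst).prodMk
      (measurable_fst.comp measurable_snd))).coe_nnreal_ennreal
  have hf : Measurable fun x : State Θ T N l => ENNReal.ofReal (𝓜.filterDensity x.1 x.2) :=
    (measurable_filterDensity h𝓜 hA1).ennreal_ofReal
  exact (hq1.mul (hf.comp measurable_snd)).mul (measurable_accept h𝓜 hA1 hq).ennreal_ofReal

theorem transition_eq {q : Θ → Θ → ℝ≥0} (hq : IsProposal 𝓜.dθ q) (x : State Θ T N l) :
    haveI := h𝓜.sigmaFinite
    𝓜.transition q x = mhKernel (𝓜.dθ.prod (particleRef T N l))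
      (measurable_acceptedDensity h𝓜 hA1 hq) x := by
  have := h𝓜.sigmaFinite
  have hq1 : Measurable fun x' : State Θ T N l => (q x.1 x'.1 : ℝ≥0∞) :=
    (hq.meas.comp (measurable_const.prodMk measurable_fst)).coe_nnreal_ennreal
  have hf : Measurable fun x' : State Θ T N l => ENNReal.ofReal (𝓜.filterDensity x'.1 x'.2) :=
    (measurable_filterDensity h𝓜 hA1).ennreal_ofReal
  have ha : Measurable fun x' : State Θ T N l => ENNReal.ofReal (𝓜.accept q x x') :=
    ((measurable_accept h𝓜 hA1 hq).comp measurable_prodMk_left).ennreal_ofReal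
  change _ = (𝓜.dθ.prod (particleRef T N l)).withDensity (𝓜.acceptedDensity q x) +
    (1 - ∫⁻ y, 𝓜.acceptedDensity q x y ∂(𝓜.dθ.prod (particleRef T N l))) • Measure.dirac x
  have hp : Measurable fun x' : State Θ T N l =>
      (q x.1 x'.1 : ℝ≥0∞) * ENNReal.ofReal (𝓜.filterDensity x'.1 x'.2) := hq1.mul hf
  rw [transition, proposal, ← withDensity_mul _ hp ha,
    lintegral_withDensity_eq_lintegral_mul _ hp ha]
  rfl

theorem lintegral_acceptedDensity_le (hT : 1 ≤ T) (hN : 1 ≤ N) {q : Θ → Θ → ℝ≥0}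
    (hq : IsProposal 𝓜.dθ q) (x : State Θ T N l) :
    ∫⁻ y, 𝓜.acceptedDensity q x y ∂(𝓜.dθ.prod (particleRef T N l)) ≤ 1 := by
  have := h𝓜.sigmaFinite
  have hq1 : Measurable fun x' : State Θ T N l => (q x.1 x'.1 : ℝ≥0∞) :=
    (hq.meas.comp (measurable_const.prodMk measurable_fst)).coe_nnreal_ennreal
  have hf : Measurable fun x' : State Θ T N l => ENNReal.ofReal (𝓜.filterDensity x'.1 x'.2) :=
    (measurable_filterDensity h𝓜 hA1).ennreal_ofReal
  calc _ ≤ ∫⁻ y : State Θ T N l, (q x.1 y.1 : ℝ≥0∞) * ENNReal.ofReal (𝓜.filterDensity y.1 y.2)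
        ∂(𝓜.dθ.prod (particleRef T N l)) := by
        refine lintegral_mono fun y => ?_
        refine mul_le_of_le_one_right' ?_
        rw [← ENNReal.ofReal_one]
        exact ENNReal.ofReal_le_ofReal (accept_le_one q x y)
    _ = 1 := by
      have hm : Measurable fun y : State Θ T N l =>
          (q x.1 y.1 : ℝ≥0∞) * ENNReal.ofReal (𝓜.filterDensity y.1 y.2) := hq1.mul hf
      rw [lintegral_prod _ hm.aemeasurable]
      have h : ∀ θ, ∫⁻ u, (q x.1 θ : ℝ≥0∞) * ENNReal.ofReal (𝓜.filterDensity θ u)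
          ∂(particleRef T N l) = q x.1 θ := fun θ => by
        rw [lintegral_const_mul' _ _ ENNReal.coe_ne_top, lintegral_filterDensity h𝓜 hA1 hT hN,
          mul_one]
      simp_rw [h]
      exact hq.mass x.1

end Invariance

/-! ### The invariant law of coupled MCMC -/

/-- The prior law of the parameter and of the increments. -/
noncomputable def baseLaw (𝓜 : Model Θ Y) (T l : ℕ) : Measure (Θ × (Fin (T * 2 ^ l) → ℝ)) :=
  (𝓜.dθ.withDensity (fun θ => (𝓜.prior θ : ℝ≥0∞))).prod
    (Measure.pi (fun _ => gaussianReal 0 (step l)))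

theorem IsRegular.isProbabilityMeasure_prior {T' : ℕ} {β : ℝ} (h𝓜 : 𝓜.IsRegular T' β) :
    IsProbabilityMeasure (𝓜.dθ.withDensity (fun θ => (𝓜.prior θ : ℝ≥0∞))) :=
  ⟨by rw [withDensity_apply _ MeasurableSet.univ, Measure.restrict_univ, h𝓜.prior_proper]⟩

theorem IsRegular.isProbabilityMeasure_baseLaw {T' : ℕ} {β : ℝ} (h𝓜 : 𝓜.IsRegular T' β) :
    IsProbabilityMeasure (𝓜.baseLaw T l) := by
  have := h𝓜.isProbabilityMeasure_prior
  unfold baseLaw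
  infer_instance

/-- The density, with respect to the prior law, of the parameter and of the returned trajectory. -/
noncomputable def maxLikProd (𝓜 : Model Θ Y) (T l : ℕ) (p : Θ × (Fin (T * 2 ^ l) → ℝ)) : ℝ :=
  ∏ t ∈ Finset.range T, 𝓜.maxLik l t p.1 (extend p.2)

theorem measurable_prodMap_extend {k : ℕ} :
    Measurable fun p : Θ × (Fin k → ℝ) => (p.1, (extend p.2 : ℕ → ℝ)) :=
  measurable_fst.prodMk (measurable_extend.comp measurable_snd)

theorem measurable_maxLikProd {T' : ℕ} {β : ℝ} (h𝓜 : 𝓜.IsRegular T' β) (hA1 : 𝓜.A1) :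
    Measurable (𝓜.maxLikProd T l) :=
  Finset.measurable_prod _ fun t _ =>
    (h𝓜.measurable_maxLik hA1 l t).comp measurable_prodMap_extend

/-- The parameter and the returned trajectory of a state. -/
def returned (x : State Θ T N l) : Θ × (Fin (T * 2 ^ l) → ℝ) := (x.1, outputIncr x.2)

theorem measurable_returned : Measurable (returned : State Θ T N l → _) :=
  measurable_fst.prodMk (measurable_outputIncr.comp measurable_snd)

/-- For fixed `θ` the randomness of the filter is integrated out by unbiasedness; the prior density
in the target then combines with `dθ` to give `baseLaw`. -/
theorem map_returned {T' : ℕ} {β : ℝ} (h𝓜 : 𝓜.IsRegular T' β) (hA1 : 𝓜.A1) (hT : 1 ≤ T)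
    (hN : 1 ≤ N) :
    ((𝓜.dθ.prod (particleRef T N (l + 1))).withDensity 𝓜.targetDensity).map returned =
      (𝓜.baseLaw T (l + 1)).withDensity fun p => ENNReal.ofReal (𝓜.maxLikProd T (l + 1) p) := by
  have := h𝓜.sigmaFinite
  have := h𝓜.isProbabilityMeasure_prior
  ext A hA
  have hpr : Measurable fun θ => (𝓜.prior θ : ℝ≥0∞) := h𝓜.prior_meas.coe_nnreal_ennreal
  have htd : Measurable (𝓜.targetDensity : State Θ T N (l + 1) → ℝ≥0∞) :=
    measurable_targetDensity h𝓜 hA1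
  have hml : Measurable fun p => ENNReal.ofReal (𝓜.maxLikProd T (l + 1) p) :=
    (measurable_maxLikProd h𝓜 hA1).ennreal_ofReal
  have hA' : MeasurableSet (returned ⁻¹' A : Set (State Θ T N (l + 1))) := measurable_returned hA
  rw [Measure.map_apply measurable_returned hA, withDensity_apply _ hA',
    withDensity_apply _ hA, ← lintegral_indicator hA', ← lintegral_indicator hA,
    lintegral_prod _ (htd.indicator hA').aemeasurable, baseLaw,
    lintegral_prod _ (hml.indicator hA).aemeasurable]
  have hin : Measurable fun θ => ∫⁻ w, A.indicator
      (fun p => ENNReal.ofReal (𝓜.maxLikProd T (l + 1) p)) (θ, w)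
      ∂(Measure.pi fun _ => gaussianReal 0 (step (l + 1))) :=
    (hml.indicator hA).lintegral_prod_right'
  rw [lintegral_withDensity_eq_lintegral_mul _ hpr hin]
  refine lintegral_congr fun θ => ?_
  rw [Pi.mul_apply]
  let r : (ℕ → ℝ) → Fin (T * 2 ^ (l + 1)) → ℝ := fun w j => w j
  have hr : Measurable r := measurable_pi_lambda _ fun j => measurable_pi_apply _
  -- The test function for unbiasedness is the indicator of the `θ`-section of `A`, read off the
  -- first increments.
  let G : (ℕ → ℝ) → ℝ := fun w => A.indicator 1 (θ, r w)
  have hG : Measurable G :=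
    (measurable_one.indicator hA).comp (measurable_const.prodMk hr)
  have hG0 : ∀ w, 0 ≤ G w := fun w => Set.indicator_nonneg (fun _ _ => zero_le_one) _
  have h := lintegral_normConst_mul_filterDensity h𝓜 hA1 hT hN θ (l := l) hG hG0
  have hext : ∀ w : Fin (T * 2 ^ (l + 1)) → ℝ, r (extend w) = w := fun w => by
    funext j; simp [r, extend]
  have e1 : ∀ u, (returned ⁻¹' A).indicator 𝓜.targetDensity ((θ, u) : State Θ T N (l + 1)) =
      𝓜.prior θ * ENNReal.ofReal (𝓜.normConst θ u * 𝓜.filterDensity θ u * G (output u)) := by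
    intro u
    have hmem : ((θ, u) : State Θ T N (l + 1)) ∈ returned ⁻¹' A ↔ (θ, r (output u)) ∈ A := Iff.rfl
    by_cases hx : (θ, r (output u)) ∈ A
    · rw [Set.indicator_of_mem (hmem.2 hx)]
      simp only [G, Set.indicator_of_mem hx, Pi.one_apply, mul_one, targetDensity]
      rw [mul_comm]
    · rw [Set.indicator_of_notMem (fun h => hx (hmem.1 h))]
      simp only [G, Set.indicator_of_notMem hx, mul_zero, ENNReal.ofReal_zero]
  have e2 : ∀ w : Fin (T * 2 ^ (l + 1)) → ℝ,
      A.indicator (fun p => ENNReal.ofReal (𝓜.maxLikProd T (l + 1) p)) (θ, w) =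
      ENNReal.ofReal ((∏ t ∈ Finset.range T, 𝓜.maxLik (l + 1) t θ (extend w)) * G (extend w)) := by
    intro w
    simp only [G, hext]
    by_cases hx : (θ, w) ∈ A
    · simp only [Set.indicator_of_mem hx, Pi.one_apply, mul_one]; rfl
    · simp only [Set.indicator_of_notMem hx, mul_zero, ENNReal.ofReal_zero]
  simp_rw [e1, e2]
  rw [lintegral_const_mul' _ _ ENNReal.coe_ne_top, h]

theorem lintegral_maxLikProd_bounds {T' : ℕ} {β : ℝ} (h𝓜 : 𝓜.IsRegular T' β) {c c' : ℝ}
    (hc : 0 < c)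
    (hlik : ∀ t < T, ∀ l θ w, c ≤ 𝓜.lik l t θ w ∧ 𝓜.lik l t θ w ≤ c') (l : ℕ) :
    ENNReal.ofReal (c ^ T) ≤ ∫⁻ p, ENNReal.ofReal (𝓜.maxLikProd T l p) ∂(𝓜.baseLaw T l) ∧
    ∫⁻ p, ENNReal.ofReal (𝓜.maxLikProd T l p) ∂(𝓜.baseLaw T l) ≤ ENNReal.ofReal (c' ^ T) := by
  have := h𝓜.isProbabilityMeasure_baseLaw (T := T) (l := l)
  have hp : ∀ p, c ^ T ≤ 𝓜.maxLikProd T l p ∧ 𝓜.maxLikProd T l p ≤ c' ^ T := fun p => by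
    have h1 : ∀ t ∈ Finset.range T, c ≤ 𝓜.maxLik l t p.1 (extend p.2) ∧
        𝓜.maxLik l t p.1 (extend p.2) ≤ c' := fun t ht => by
      have ht' := Finset.mem_range.1 ht
      exact ⟨(hlik t ht' _ _ _).1.trans (le_max_left _ _),
        max_le (hlik t ht' _ _ _).2 (hlik t ht' _ _ _).2⟩
    constructor
    · calc c ^ T = ∏ t ∈ Finset.range T, c := by simp
        _ ≤ _ := Finset.prod_le_prod (fun _ _ => hc.le) fun t ht => (h1 t ht).1
    · calc _ ≤ ∏ t ∈ Finset.range T, c' :=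
            Finset.prod_le_prod (fun t ht => hc.le.trans (h1 t ht).1) fun t ht => (h1 t ht).2
        _ = _ := by simp
  constructor
  · calc _ = ∫⁻ _, ENNReal.ofReal (c ^ T) ∂(𝓜.baseLaw T l) := by simp
      _ ≤ _ := lintegral_mono fun p => ENNReal.ofReal_le_ofReal (hp p).1
  · calc _ ≤ ∫⁻ _, ENNReal.ofReal (c' ^ T) ∂(𝓜.baseLaw T l) :=
          lintegral_mono fun p => ENNReal.ofReal_le_ofReal (hp p).2
      _ = _ := by simp

/-- Reversibility and minorization identify the stationary law of the chain; its image under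
`returned` is the prior law reweighted by the product of the maxima of the likelihoods. -/
theorem map_returned_of_reversible {T' : ℕ} {β : ℝ} (h𝓜 : 𝓜.IsRegular T' β) (hA1 : 𝓜.A1)
    (hT : 1 ≤ T) (hN : 1 ≤ N) {q : Θ → Θ → ℝ≥0} (hq : IsProposal 𝓜.dθ q)
    {η : Measure (State Θ T N (l + 1))} [IsProbabilityMeasure η]
    {κ : Kernel (State Θ T N (l + 1)) (State Θ T N (l + 1))} [IsMarkovKernel κ]
    (hκ : ∀ x, κ x = 𝓜.transition q x) (hη : Kernel.Invariant κ η) {ξ : ℝ} (hξ₀ : 0 < ξ)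
    (hξ₁ : ξ < 1) {ν : Measure (State Θ T N (l + 1))} [IsProbabilityMeasure ν]
    (hmin : ∀ x, ENNReal.ofReal ξ • ν ≤ κ x) :
    η.map returned = (∫⁻ p, ENNReal.ofReal (𝓜.maxLikProd T (l + 1) p) ∂(𝓜.baseLaw T (l + 1)))⁻¹ •
      (𝓜.baseLaw T (l + 1)).withDensity fun p => ENNReal.ofReal (𝓜.maxLikProd T (l + 1) p) := by
  have := h𝓜.sigmaFinite
  obtain ⟨c, c', hc, hcc, hlik⟩ := hA1.exists_lik_bounds T
  obtain ⟨hZ1, hZ2⟩ := lintegral_maxLikProd_bounds h𝓜 hc hlik (l + 1)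
  set Z := ∫⁻ p, ENNReal.ofReal (𝓜.maxLikProd T (l + 1) p) ∂(𝓜.baseLaw T (l + 1)) with hZ
  have hZ0 : Z ≠ 0 := ((ENNReal.ofReal_pos.2 (pow_pos hc T)).trans_le hZ1).ne'
  have hZt : Z ≠ ∞ := (hZ2.trans_lt ENNReal.ofReal_lt_top).ne
  set τ := (𝓜.dθ.prod (particleRef T N (l + 1))).withDensity 𝓜.targetDensity with hτ
  have hτmap : τ.map returned = _ := map_returned h𝓜 hA1 hT hN
  have hτ1 : τ Set.univ = Z := by
    rw [← Set.preimage_univ (f := returned), ← Measure.map_apply measurable_returned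
      MeasurableSet.univ, hτmap, withDensity_apply _ MeasurableSet.univ, Measure.restrict_univ]
  have hprob : IsProbabilityMeasure (Z⁻¹ • τ) :=
    ⟨by rw [Measure.smul_apply, hτ1, smul_eq_mul, ENNReal.inv_mul_cancel hZ0 hZt]⟩
  have hκ' : κ = mhKernel (𝓜.dθ.prod (particleRef T N (l + 1)))
      (measurable_acceptedDensity h𝓜 hA1 hq) := by
    ext1 x
    rw [hκ, transition_eq h𝓜 hA1 hq]
  have hrev : κ.IsReversible τ := by
    rw [hκ']
    exact isReversible_mhKernel _ (measurable_targetDensity h𝓜 hA1) (targetDensity_symm hA1 hN q)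
  have hinv : Kernel.Invariant κ (Z⁻¹ • τ) := by
    rw [Kernel.Invariant, Measure.comp_smul, hrev.invariant.def]
  rw [eq_of_invariant_of_minorization hη hinv hξ₀ hξ₁ hmin, Measure.map_smul, hτmap]

end Model

end VolterraMCMC

namespace VolterraMCMC

/-! ### A discrete Gronwall inequality with a singular kernel -/

/-- A Riemann sum of `x^(β - 1)` at right end points. Bernoulli's inequality `(1 - 1/(k+1))^β ≤ 1 -
β/(k+1)` shows that each term is at most the growth of `x^β / β` over the corresponding step. -/
theorem sum_rpow_le {β Δ : ℝ} (hβ₀ : 0 < β) (hβ₁ : β < 1) (hΔ : 0 < Δ) (k : ℕ) :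
    ∑ i ∈ Finset.range k, (((i : ℝ) + 1) * Δ) ^ (β - 1) * Δ ≤ ((k : ℝ) * Δ) ^ β / β := by
  induction k with
  | zero => simp [Real.zero_rpow hβ₀.ne']
  | succ k ih =>
    rw [Finset.sum_range_succ]
    have hy : 0 < ((k : ℝ) + 1) * Δ := by positivity
    have hs : -1 ≤ -(1 / ((k : ℝ) + 1)) := by
      rw [neg_le_neg_iff, div_le_one (by positivity)]; linarith [(Nat.cast_nonneg k : (0 : ℝ) ≤ k)]
    have h := rpow_one_add_le_one_add_mul_self hs hβ₀.le hβ₁.le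
    have e : (k : ℝ) * Δ = (1 + -(1 / ((k : ℝ) + 1))) * (((k : ℝ) + 1) * Δ) := by
      field_simp; ring
    have e2 : ((k : ℝ) * Δ) ^ β = (1 + -(1 / ((k : ℝ) + 1))) ^ β * (((k : ℝ) + 1) * Δ) ^ β := by
      rw [e, Real.mul_rpow (by linarith) hy.le]
    have h2 : ((k : ℝ) * Δ) ^ β ≤ (1 + β * -(1 / ((k : ℝ) + 1))) * (((k : ℝ) + 1) * Δ) ^ β := by
      rw [e2]; exact mul_le_mul_of_nonneg_right h (by positivity)
    have e3 : (((k : ℝ) + 1) * Δ) ^ (β - 1) * Δ =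
        1 / ((k : ℝ) + 1) * (((k : ℝ) + 1) * Δ) ^ β := by
      rw [Real.rpow_sub_one hy.ne']; field_simp
    push_cast
    calc _ ≤ ((k : ℝ) * Δ) ^ β / β + (((k : ℝ) + 1) * Δ) ^ (β - 1) * Δ := by linarith
      _ ≤ (1 + β * -(1 / ((k : ℝ) + 1))) * (((k : ℝ) + 1) * Δ) ^ β / β +
          (((k : ℝ) + 1) * Δ) ^ (β - 1) * Δ := by gcongr
      _ = _ := by rw [e3]; field_simp; ring

/-- By `(μ x)^β ≤ exp(μ x)`, the exponential trades the factor `x^β` of `x^(2β-1) = x^(β-1) x^β` for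
`μ^(-β)`. The remaining `x^(β-1)` is still summable, with a constant that is small for large `μ`. -/
theorem rpow_mul_exp_neg_le {β x μ : ℝ} (hβ₀ : 0 < β) (hβ₁ : β < 1) (hx : 0 < x) (hμ : 0 < μ) :
    x ^ (2 * β - 1) * Real.exp (-(μ * x)) ≤ (μ ^ β)⁻¹ * x ^ (β - 1) := by
  have h1 : (μ * x) ^ β ≤ Real.exp (μ * x) := by
    have hy : 0 < μ * x := by positivity
    have h2 := rpow_one_add_le_one_add_mul_self (s := μ * x - 1) (by linarith) hβ₀.le hβ₁.le
    rw [add_sub_cancel] at h2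
    have h3 := Real.add_one_le_exp (μ * x)
    nlinarith
  have h4 : Real.exp (-(μ * x)) ≤ ((μ * x) ^ β)⁻¹ := by
    rw [Real.exp_neg]
    exact inv_anti₀ (by positivity) h1
  have e : x ^ (2 * β - 1) = x ^ (β - 1) * x ^ β := by rw [← Real.rpow_add hx]; ring_nf
  calc _ ≤ x ^ (2 * β - 1) * ((μ * x) ^ β)⁻¹ := by gcongr
    _ = _ := by
      rw [Real.mul_rpow hμ.le hx.le, e]
      have : x ^ β ≠ 0 := by positivity
      field_simp

/-- Measured against the weight `exp(μ k Δ)`, the convolution with the singular kernel has norm at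
most `1/2` once `μ` is large, so strong induction propagates `u k ≤ 2 A exp(μ k Δ)`. The choice of
`μ` involves only `β`, `B` and `T`, which makes the bound uniform in the step. -/
theorem discrete_gronwall {β : ℝ} (hβ₀ : 0 < β) (hβ₁ : β < 1) {A B T : ℝ} (hA : 0 ≤ A)
    (hB : 0 ≤ B) (hT : 0 ≤ T) : ∃ C : ℝ, ∀ Δ : ℝ, 0 < Δ → ∀ n : ℕ, n * Δ ≤ T → ∀ u : ℕ → ℝ,
      (∀ k ≤ n, u k ≤ A + B * ∑ j ∈ Finset.range k,
        (((k : ℝ) - j) * Δ) ^ (2 * β - 1) * Δ * u j) → ∀ k ≤ n, u k ≤ C := by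
  -- Chosen so that `B c⁻¹ T^β/β ≤ 1/2`; the summand `1` keeps `c` positive when `B` or `T`
  -- vanishes.
  set c : ℝ := 2 * B * (T ^ β / β) + 1 with hc
  have hc0 : 0 < c := by positivity
  set μ : ℝ := c ^ (1 / β) with hμ
  have hμ0 : 0 < μ := by positivity
  have hμβ : μ ^ β = c := by
    rw [hμ, ← Real.rpow_mul hc0.le, one_div, inv_mul_cancel₀ hβ₀.ne', Real.rpow_one]
  refine ⟨2 * A * Real.exp (μ * T), fun Δ hΔ n hn u hu => ?_⟩
  have key : ∀ k ≤ n, u k ≤ 2 * A * Real.exp (μ * (k * Δ)) := by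
    intro k
    induction k using Nat.strong_induction_on with
    | _ k ih =>
      intro hk
      refine (hu k hk).trans ?_
      have hkT : (k : ℝ) * Δ ≤ T :=
        (mul_le_mul_of_nonneg_right (by exact_mod_cast hk) hΔ.le).trans hn
      have h1 : ∑ j ∈ Finset.range k, (((k : ℝ) - j) * Δ) ^ (2 * β - 1) * Δ * u j ≤
          ∑ j ∈ Finset.range k, 2 * A * Real.exp (μ * (k * Δ)) *
            (c⁻¹ * ((((k : ℝ) - j) * Δ) ^ (β - 1) * Δ)) := by
        refine Finset.sum_le_sum fun j hj => ?_
        have hj' := Finset.mem_range.1 hj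
        have hkj : 0 < (k : ℝ) - j := sub_pos.2 (by exact_mod_cast hj')
        have hx : 0 < ((k : ℝ) - j) * Δ := by positivity
        have h2 := ih j hj' (hj'.le.trans hk)
        have h3 := rpow_mul_exp_neg_le hβ₀ hβ₁ hx hμ0
        rw [hμβ] at h3
        calc _ ≤ (((k : ℝ) - j) * Δ) ^ (2 * β - 1) * Δ * (2 * A * Real.exp (μ * (j * Δ))) := by
              gcongr
          _ = 2 * A * Real.exp (μ * (k * Δ)) * ((((k : ℝ) - j) * Δ) ^ (2 * β - 1) *
              Real.exp (-(μ * (((k : ℝ) - j) * Δ))) * Δ) := by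
              have : Real.exp (μ * (j * Δ)) = Real.exp (μ * (k * Δ)) *
                  Real.exp (-(μ * (((k : ℝ) - j) * Δ))) := by rw [← Real.exp_add]; ring_nf
              rw [this]; ring
          _ ≤ 2 * A * Real.exp (μ * (k * Δ)) * (c⁻¹ * (((k : ℝ) - j) * Δ) ^ (β - 1) * Δ) := by
              gcongr
          _ = _ := by ring
      have h4 : ∑ j ∈ Finset.range k, (((k : ℝ) - j) * Δ) ^ (β - 1) * Δ ≤ T ^ β / β := by
        have e : ∑ j ∈ Finset.range k, (((k : ℝ) - j) * Δ) ^ (β - 1) * Δ =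
            ∑ i ∈ Finset.range k, (((i : ℝ) + 1) * Δ) ^ (β - 1) * Δ := by
          rw [← Finset.sum_range_reflect]
          refine Finset.sum_congr rfl fun j hj => ?_
          have hj' := Finset.mem_range.1 hj
          have : ((k - 1 - j : ℕ) : ℝ) = k - 1 - j := by
            rw [Nat.cast_sub (by omega), Nat.cast_sub (by omega)]; simp
          rw [this]
          congr 3; ring
        rw [e]
        refine (sum_rpow_le hβ₀ hβ₁ hΔ k).trans ?_
        gcongr
      rw [← Finset.mul_sum, ← Finset.mul_sum] at h1
      set E := Real.exp (μ * (k * Δ)) with hE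
      have hE1 : 1 ≤ E := Real.one_le_exp (by positivity)
      have h5 : B * (c⁻¹ * ∑ j ∈ Finset.range k, (((k : ℝ) - j) * Δ) ^ (β - 1) * Δ) ≤ 1 / 2 := by
        calc _ ≤ B * (c⁻¹ * (T ^ β / β)) := by gcongr
          _ ≤ 1 / 2 := by
            rw [inv_mul_eq_div, mul_div_assoc', div_le_div_iff₀ hc0 two_pos, hc]
            linarith
      calc _ ≤ A + B * (2 * A * E *
            (c⁻¹ * ∑ j ∈ Finset.range k, (((k : ℝ) - j) * Δ) ^ (β - 1) * Δ)) := by gcongr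
        _ = A + 2 * A * E *
            (B * (c⁻¹ * ∑ j ∈ Finset.range k, (((k : ℝ) - j) * Δ) ^ (β - 1) * Δ)) := by ring
        _ ≤ A + 2 * A * E * (1 / 2) := by gcongr
        _ ≤ _ := by nlinarith
  intro k hk
  refine (key k hk).trans ?_
  have hkT : (k : ℝ) * Δ ≤ T :=
    (mul_le_mul_of_nonneg_right (by exact_mod_cast hk) hΔ.le).trans hn
  gcongr

/-! ### Discrete stochastic integrals -/

/-- Centred, square integrable increments of variance `Δ` that are independent of the past. -/
structure IsNoise {Ω : Type*} {mΩ : MeasurableSpace Ω} (P : Measure Ω)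
    (𝒢 : ℕ → MeasurableSpace Ω) (w : ℕ → Ω → ℝ) (Δ : ℝ) : Prop where
  mono : Monotone 𝒢
  le : ∀ j, 𝒢 j ≤ mΩ
  adapted : ∀ j, Measurable[𝒢 (j + 1)] (w j)
  indep : ∀ j, Indep (MeasurableSpace.comap (w j) inferInstance) (𝒢 j) P
  memLp : ∀ j, MemLp (w j) 2 P
  mean : ∀ j, ∫ ω, w j ω ∂P = 0
  var : ∀ j, ∫ ω, w j ω ^ 2 ∂P = Δ

namespace IsNoise

variable {Ω : Type*} {mΩ : MeasurableSpace Ω} {P : Measure Ω}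
  {𝒢 : ℕ → MeasurableSpace Ω} {w : ℕ → Ω → ℝ} {Δ : ℝ}

theorem shift (h : IsNoise P 𝒢 w Δ) (s : ℕ) :
    IsNoise P (fun j => 𝒢 (s + j)) (fun j => w (s + j)) Δ where
  mono _ _ hij := h.mono (Nat.add_le_add_left hij s)
  le _ := h.le _
  adapted _ := h.adapted _
  indep _ := h.indep _
  memLp _ := h.memLp _
  mean _ := h.mean _
  var _ := h.var _

theorem indepFun (h : IsNoise P 𝒢 w Δ) {j : ℕ} {X : Ω → ℝ} (hX : Measurable[𝒢 j] X) :
    IndepFun X (w j) P := by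
  rw [IndepFun_iff_Indep]
  exact (indep_of_indep_of_le_right (h.indep j) hX.comap_le).symm

theorem integral_sq_mul (h : IsNoise P 𝒢 w Δ) {j : ℕ} {X : Ω → ℝ} (hX : Measurable[𝒢 j] X)
    (hX2 : MemLp X 2 P) : MemLp (fun ω => X ω * w j ω) 2 P ∧
      ∫ ω, (X ω * w j ω) ^ 2 ∂P = Δ * ∫ ω, X ω ^ 2 ∂P := by
  have hi : IndepFun (fun ω => X ω ^ 2) (fun ω => w j ω ^ 2) P :=
    (h.indepFun hX).comp (φ := fun x => x ^ 2) (ψ := fun x => x ^ 2) (by fun_prop) (by fun_prop)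
  have e : ∀ ω, (X ω * w j ω) ^ 2 = X ω ^ 2 * w j ω ^ 2 := fun ω => mul_pow _ _ _
  have hm : AEStronglyMeasurable (fun ω => X ω * w j ω) P := hX2.1.mul (h.memLp j).1
  constructor
  · rw [memLp_two_iff_integrable_sq hm]
    simp_rw [e]
    exact hi.integrable_mul hX2.integrable_sq (h.memLp j).integrable_sq
  · simp_rw [e]
    rw [hi.integral_fun_mul_eq_mul_integral hX2.integrable_sq.1 (h.memLp j).integrable_sq.1,
      h.var, mul_comm]

theorem integral_mul_mul_eq_zero (h : IsNoise P 𝒢 w Δ) {j : ℕ} {X Z : Ω → ℝ}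
    (hX : Measurable[𝒢 j] X) (hZ : Measurable[𝒢 j] Z) :
    ∫ ω, Z ω * (X ω * w j ω) ∂P = 0 := by
  have hZX : Measurable[𝒢 j] fun ω => Z ω * X ω := hZ.mul hX
  simp_rw [← mul_assoc]
  rw [(h.indepFun hZX).integral_fun_mul_eq_mul_integral
    (hZX.mono (h.le j) le_rfl).aestronglyMeasurable (h.memLp j).1, h.mean, mul_zero]

/-- Discrete Itô isometry: the newest increment is centred and independent of `𝒢 n`, which contains
the earlier sum and the newest integrand, so the cross term vanishes. -/
theorem integral_sq_sum [IsProbabilityMeasure P] (h : IsNoise P 𝒢 w Δ) {X : ℕ → Ω → ℝ} (n : ℕ)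
    (hX : ∀ j < n, Measurable[𝒢 j] (X j)) (hX2 : ∀ j < n, MemLp (X j) 2 P) :
    Measurable[𝒢 n] (fun ω => ∑ j ∈ Finset.range n, X j ω * w j ω) ∧
    MemLp (fun ω => ∑ j ∈ Finset.range n, X j ω * w j ω) 2 P ∧
    ∫ ω, (∑ j ∈ Finset.range n, X j ω * w j ω) ^ 2 ∂P =
      Δ * ∑ j ∈ Finset.range n, ∫ ω, X j ω ^ 2 ∂P := by
  induction n with
  | zero => simp [measurable_const]
  | succ n ih =>
    obtain ⟨i1, i2, i3⟩ := ih (fun j hj => hX j (hj.trans (Nat.lt_succ_self n)))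
      (fun j hj => hX2 j (hj.trans (Nat.lt_succ_self n)))
    have hXn := hX n (Nat.lt_succ_self n)
    obtain ⟨j1, j2⟩ := h.integral_sq_mul hXn (hX2 n (Nat.lt_succ_self n))
    have hle := h.mono (Nat.le_succ n)
    simp only [Finset.sum_range_succ]
    refine ⟨(i1.mono hle le_rfl).add ((hXn.mono hle le_rfl).mul (h.adapted n)), i2.add j1, ?_⟩
    have e : ∀ ω, (∑ j ∈ Finset.range n, X j ω * w j ω + X n ω * w n ω) ^ 2 =
        (∑ j ∈ Finset.range n, X j ω * w j ω) ^ 2 +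
        2 * ((∑ j ∈ Finset.range n, X j ω * w j ω) * (X n ω * w n ω)) +
        (X n ω * w n ω) ^ 2 := fun ω => by ring
    simp_rw [e]
    have k1 : Integrable (fun ω => 2 * ((∑ j ∈ Finset.range n, X j ω * w j ω) *
        (X n ω * w n ω))) P := (i2.integrable_mul j1).const_mul _
    have k2 : Integrable (fun ω => (∑ j ∈ Finset.range n, X j ω * w j ω) ^ 2 +
        2 * ((∑ j ∈ Finset.range n, X j ω * w j ω) * (X n ω * w n ω))) P :=
      i2.integrable_sq.add k1
    rw [integral_add k2 j1.integrable_sq, integral_add i2.integrable_sq k1, integral_const_mul,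
      h.integral_mul_mul_eq_zero hXn i1, i3, j2]
    ring

variable {K b σ : ℝ → ℝ} {v₀ : ℝ}

theorem abs_le_of_growth {c : ℝ} (hbσ : ∀ v, |b v| + |σ v| ≤ c * (1 + |v|)) (v : ℝ) :
    b v ^ 2 ≤ 2 * c ^ 2 * (1 + v ^ 2) ∧ σ v ^ 2 ≤ 2 * c ^ 2 * (1 + v ^ 2) := by
  have h := hbσ v
  have h1 : (c * (1 + |v|)) ^ 2 ≤ 2 * c ^ 2 * (1 + v ^ 2) := by
    have : (1 + |v|) ^ 2 ≤ 2 * (1 + v ^ 2) := by nlinarith [sq_nonneg (1 - |v|), sq_abs v]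
    nlinarith [mul_le_mul_of_nonneg_left this (sq_nonneg c)]
  constructor
  · refine le_trans ?_ h1
    rw [← sq_abs (b v)]
    exact pow_le_pow_left₀ (abs_nonneg _) (by linarith [abs_nonneg (σ v)]) 2
  · refine le_trans ?_ h1
    rw [← sq_abs (σ v)]
    exact pow_le_pow_left₀ (abs_nonneg _) (by linarith [abs_nonneg (b v)]) 2

theorem memLp_comp_of_sq_le [IsProbabilityMeasure P] {f : ℝ → ℝ} (hf : Measurable f) {C : ℝ}
    (hfC : ∀ v, f v ^ 2 ≤ C * (1 + v ^ 2)) {V : Ω → ℝ} (hVm : Measurable V) (hV : MemLp V 2 P) :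
    MemLp (fun ω => f (V ω)) 2 P ∧ ∫ ω, f (V ω) ^ 2 ∂P ≤ C * (1 + ∫ ω, V ω ^ 2 ∂P) := by
  have hi : Integrable (fun ω => C * (1 + V ω ^ 2)) P :=
    ((integrable_const 1).add hV.integrable_sq).const_mul C
  have hfm : AEStronglyMeasurable (fun ω => f (V ω)) P := (hf.comp hVm).aestronglyMeasurable
  have hL : MemLp (fun ω => f (V ω)) 2 P := by
    rw [memLp_two_iff_integrable_sq hfm]
    exact hi.mono' (hfm.pow 2) (ae_of_all _ fun ω => by
      rw [Real.norm_of_nonneg (sq_nonneg _)]; exact hfC _)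
  refine ⟨hL, (integral_mono hL.integrable_sq hi fun ω => hfC _).trans (le_of_eq ?_)⟩
  rw [integral_const_mul, integral_add (integrable_const _) hV.integrable_sq]
  simp

theorem euler_eq (K b σ : ℝ → ℝ) (v₀ Δ : ℝ) (w : ℕ → ℝ) (k : ℕ) :
    euler K b σ v₀ Δ w k = v₀ + ∑ j ∈ Finset.range k, K (((k : ℝ) - (j : ℝ)) * Δ) *
      (b (euler K b σ v₀ Δ w j) * Δ + σ (euler K b σ v₀ Δ w j) * w j) := by
  cases k with
  | zero => simp [euler_zero]
  | succ k => rw [euler_succ]; push_cast; rfl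

section Euler

variable [IsProbabilityMeasure P] (hw : IsNoise P 𝒢 w Δ) (hb : Measurable b) (hσ : Measurable σ) {c : ℝ}
  (hbσ : ∀ v, |b v| + |σ v| ≤ c * (1 + |v|))
include hw hb hσ hbσ

theorem measurable_memLp_euler (k : ℕ) :
    Measurable[𝒢 k] (fun ω => euler K b σ v₀ Δ (fun j => w j ω) k) ∧
      MemLp (fun ω => euler K b σ v₀ Δ (fun j => w j ω) k) 2 P := by
  induction k using Nat.strong_induction_on with
  | _ k ih =>
    simp only [euler_eq K b σ v₀ Δ _ k]
    have key : ∀ j ∈ Finset.range k, Measurable[𝒢 k] (fun ω => K (((k : ℝ) - (j : ℝ)) * Δ) *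
        (b (euler K b σ v₀ Δ (fun j => w j ω) j) * Δ +
          σ (euler K b σ v₀ Δ (fun j => w j ω) j) * w j ω)) ∧
        MemLp (fun ω => K (((k : ℝ) - (j : ℝ)) * Δ) *
        (b (euler K b σ v₀ Δ (fun j => w j ω) j) * Δ +
          σ (euler K b σ v₀ Δ (fun j => w j ω) j) * w j ω)) 2 P := by
      intro j hj
      have hj' := Finset.mem_range.1 hj
      obtain ⟨m1, m2⟩ := ih j hj'
      have m0 := m1.mono (hw.le j) le_rfl
      have mσ : Measurable[𝒢 j] (fun ω => σ (euler K b σ v₀ Δ (fun j => w j ω) j)) := hσ.comp m1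
      have mb : Measurable[𝒢 j] (fun ω => b (euler K b σ v₀ Δ (fun j => w j ω) j)) := hb.comp m1
      have hjk := hw.mono (show j ≤ k from hj'.le)
      constructor
      · exact (((mb.mono hjk le_rfl).mul_const _).add ((mσ.mono hjk le_rfl).mul
          ((hw.adapted j).mono (hw.mono hj') le_rfl))).const_mul _
      · have L1 := (memLp_comp_of_sq_le hb (fun v => (abs_le_of_growth hbσ v).1) m0 m2).1
        have L2 := (memLp_comp_of_sq_le hσ (fun v => (abs_le_of_growth hbσ v).2) m0 m2).1
        exact ((L1.mul_const Δ).add (hw.integral_sq_mul mσ L2).1).const_mul _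
    constructor
    · exact measurable_const.add (Finset.measurable_sum _ fun j hj => (key j hj).1)
    · exact (memLp_const v₀).add (memLp_finsetSum _ fun j hj => (key j hj).2)

/-- The drift part is estimated by Cauchy–Schwarz, which costs `n Δ`, and the noise part by the
isometry. The weights `a` are arbitrary so that the bound serves both for values of the scheme
(weights `K`) and for its increments (differences of `K`). -/
theorem integral_sq_linear_le (hΔ : 0 ≤ Δ) (a : ℕ → ℝ) (n : ℕ) :
    MemLp (fun ω => ∑ j ∈ Finset.range n, a j *
      (b (euler K b σ v₀ Δ (fun j => w j ω) j) * Δ +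
        σ (euler K b σ v₀ Δ (fun j => w j ω) j) * w j ω)) 2 P ∧
    ∫ ω, (∑ j ∈ Finset.range n, a j * (b (euler K b σ v₀ Δ (fun j => w j ω) j) * Δ +
        σ (euler K b σ v₀ Δ (fun j => w j ω) j) * w j ω)) ^ 2 ∂P ≤
      4 * c ^ 2 * (n * Δ + 1) * ∑ j ∈ Finset.range n, a j ^ 2 * Δ *
        (1 + ∫ ω, euler K b σ v₀ Δ (fun j => w j ω) j ^ 2 ∂P) := by
  set V : ℕ → Ω → ℝ := fun k ω => euler K b σ v₀ Δ (fun j => w j ω) k with hV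
  have hVm : ∀ k, Measurable[𝒢 k] (V k) := fun k => (hw.measurable_memLp_euler hb hσ hbσ k).1
  have hVm0 : ∀ k, Measurable (V k) := fun k => (hVm k).mono (hw.le k) le_rfl
  have hV2 : ∀ k, MemLp (V k) 2 P := fun k => (hw.measurable_memLp_euler hb hσ hbσ k).2
  have Lb : ∀ j, MemLp (fun ω => b (V j ω)) 2 P ∧ _ := fun j =>
    memLp_comp_of_sq_le hb (fun v => (abs_le_of_growth hbσ v).1) (hVm0 j) (hV2 j)
  have Lσ : ∀ j, MemLp (fun ω => σ (V j ω)) 2 P ∧ _ := fun j =>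
    memLp_comp_of_sq_le hσ (fun v => (abs_le_of_growth hbσ v).2) (hVm0 j) (hV2 j)
  have mσ : ∀ j, Measurable[𝒢 j] (fun ω => a j * σ (V j ω)) := fun j =>
    (hσ.comp (hVm j)).const_mul _
  obtain ⟨-, s2, s3⟩ := hw.integral_sq_sum n (X := fun j ω => a j * σ (V j ω))
    (fun j _ => mσ j) (fun j _ => (Lσ j).1.const_mul _)
  have d2 : MemLp (fun ω => ∑ j ∈ Finset.range n, a j * (b (V j ω) * Δ)) 2 P :=
    memLp_finsetSum _ fun j _ => ((Lb j).1.mul_const _).const_mul _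
  have e : ∀ ω, ∑ j ∈ Finset.range n, a j * (b (V j ω) * Δ + σ (V j ω) * w j ω) =
      ∑ j ∈ Finset.range n, a j * (b (V j ω) * Δ) +
      ∑ j ∈ Finset.range n, a j * σ (V j ω) * w j ω := fun ω => by
    rw [← Finset.sum_add_distrib]; exact Finset.sum_congr rfl fun j _ => by ring
  change MemLp (fun ω => ∑ j ∈ Finset.range n, a j * (b (V j ω) * Δ + σ (V j ω) * w j ω)) 2 P ∧
    ∫ ω, (∑ j ∈ Finset.range n, a j * (b (V j ω) * Δ + σ (V j ω) * w j ω)) ^ 2 ∂P ≤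
      4 * c ^ 2 * (n * Δ + 1) * ∑ j ∈ Finset.range n, a j ^ 2 * Δ * (1 + ∫ ω, V j ω ^ 2 ∂P)
  simp_rw [e]
  refine ⟨d2.add s2, ?_⟩
  have hd : ∫ ω, (∑ j ∈ Finset.range n, a j * (b (V j ω) * Δ)) ^ 2 ∂P ≤
      (n * Δ) * ∑ j ∈ Finset.range n, a j ^ 2 * Δ * (2 * c ^ 2 * (1 + ∫ ω, V j ω ^ 2 ∂P)) := by
    have hpt : ∀ ω, (∑ j ∈ Finset.range n, a j * (b (V j ω) * Δ)) ^ 2 ≤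
        ∑ j ∈ Finset.range n, (n * Δ) * (a j ^ 2 * Δ) * b (V j ω) ^ 2 := fun ω => by
      refine (sq_sum_le_card_mul_sum_sq).trans (le_of_eq ?_)
      rw [Finset.card_range, Finset.mul_sum]
      exact Finset.sum_congr rfl fun j _ => by ring
    have hi : ∀ j ∈ Finset.range n,
        Integrable (fun ω => (n * Δ) * (a j ^ 2 * Δ) * b (V j ω) ^ 2) P :=
      fun j _ => (Lb j).1.integrable_sq.const_mul _
    refine (integral_mono d2.integrable_sq (integrable_finsetSum _ hi) hpt).trans ?_
    rw [integral_finsetSum _ hi, Finset.mul_sum]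
    refine Finset.sum_le_sum fun j _ => ?_
    rw [integral_const_mul, mul_assoc]
    have := (Lb j).2
    gcongr
  have hs : ∫ ω, (∑ j ∈ Finset.range n, a j * σ (V j ω) * w j ω) ^ 2 ∂P ≤
      ∑ j ∈ Finset.range n, a j ^ 2 * Δ * (2 * c ^ 2 * (1 + ∫ ω, V j ω ^ 2 ∂P)) := by
    rw [s3, Finset.mul_sum]
    refine Finset.sum_le_sum fun j _ => ?_
    simp_rw [mul_pow]
    rw [integral_const_mul, ← mul_assoc, mul_comm Δ]
    have := (Lσ j).2
    gcongr
  have hpt2 : ∀ ω, (∑ j ∈ Finset.range n, a j * (b (V j ω) * Δ) +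
      ∑ j ∈ Finset.range n, a j * σ (V j ω) * w j ω) ^ 2 ≤
      2 * (∑ j ∈ Finset.range n, a j * (b (V j ω) * Δ)) ^ 2 +
      2 * (∑ j ∈ Finset.range n, a j * σ (V j ω) * w j ω) ^ 2 := fun ω => by
    have := add_sq_le (a := ∑ j ∈ Finset.range n, a j * (b (V j ω) * Δ))
      (b := ∑ j ∈ Finset.range n, a j * σ (V j ω) * w j ω)
    linarith
  have I1 : Integrable (fun ω => 2 * (∑ j ∈ Finset.range n, a j * (b (V j ω) * Δ)) ^ 2) P :=
    d2.integrable_sq.const_mul _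
  have I2 : Integrable (fun ω => 2 * (∑ j ∈ Finset.range n, a j * σ (V j ω) * w j ω) ^ 2) P :=
    s2.integrable_sq.const_mul _
  have h := integral_mono (d2.add s2).integrable_sq (I1.add I2) hpt2
  simp only [Pi.add_apply] at h
  rw [integral_add I1 I2, integral_const_mul, integral_const_mul] at h
  refine h.trans ?_
  have e3 : ∑ j ∈ Finset.range n, a j ^ 2 * Δ * (2 * c ^ 2 * (1 + ∫ ω, V j ω ^ 2 ∂P)) =
      2 * c ^ 2 * ∑ j ∈ Finset.range n, a j ^ 2 * Δ * (1 + ∫ ω, V j ω ^ 2 ∂P) := by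
    rw [Finset.mul_sum]; exact Finset.sum_congr rfl fun j _ => by ring
  rw [e3] at hd hs
  linarith

end Euler

end IsNoise

end VolterraMCMC

/-! ### Uniform moments and one-step increments of the Euler scheme; Brownian increments. -/

namespace VolterraMCMC

/-- Since `β < 1` the exponent is below `-1`. The sum arises from squared kernel differences
measured in units of the step. -/
theorem exists_sum_rpow_le {β : ℝ} (hβ₁ : β < 1) : ∃ S : ℝ, 0 ≤ S ∧ ∀ k : ℕ,
    ∑ j ∈ Finset.range k, ((k : ℝ) - j) ^ (2 * β - 3) ≤ S := by
  have hs : Summable fun n : ℕ => (n : ℝ) ^ (2 * β - 3) :=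
    Real.summable_nat_rpow.2 (by linarith)
  have hs' : Summable fun n : ℕ => ((n + 1 : ℕ) : ℝ) ^ (2 * β - 3) :=
    (summable_nat_add_iff 1).2 hs
  refine ⟨∑' n : ℕ, ((n + 1 : ℕ) : ℝ) ^ (2 * β - 3), tsum_nonneg fun n => by positivity,
    fun k => ?_⟩
  have e : ∑ j ∈ Finset.range k, ((k : ℝ) - j) ^ (2 * β - 3) =
      ∑ i ∈ Finset.range k, ((i + 1 : ℕ) : ℝ) ^ (2 * β - 3) := by
    rw [← Finset.sum_range_reflect]
    refine Finset.sum_congr rfl fun j hj => ?_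
    have hj' := Finset.mem_range.1 hj
    have : ((k - 1 - j : ℕ) : ℝ) = k - 1 - j := by
      rw [Nat.cast_sub (by omega), Nat.cast_sub (by omega)]; simp
    rw [this]
    push_cast
    congr 1; ring
  rw [e]
  exact hs'.sum_le_tsum _ fun i _ => by positivity

namespace IsNoise

variable {Ω : Type*} {mΩ : MeasurableSpace Ω} {P : Measure Ω} [IsProbabilityMeasure P]

/-- The numbers `1 + E[V_k²]` satisfy the Gronwall recursion, because `K(x)²` is at most `cK²
x^(2β-1)`. The constant is fixed before the step and the coefficients, hence serves all levels and
all parameters. -/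
theorem exists_integral_sq_euler_le {β : ℝ} (hβ₀ : 0 < β) (hβ₁ : β < 1) (T : ℕ) {K : ℝ → ℝ}
    {c cK : ℝ} (hK : ∀ t : ℝ, 0 < t → t ≤ T → |K t| ≤ cK * t ^ (β - 1 / 2)) (v₀ : ℝ) :
    ∃ C : ℝ, 0 ≤ C ∧ ∀ (𝒢 : ℕ → MeasurableSpace Ω) (w : ℕ → Ω → ℝ) (Δ : ℝ) (b σ : ℝ → ℝ),
      IsNoise P 𝒢 w Δ → 0 < Δ → Measurable b → Measurable σ →
      (∀ v, |b v| + |σ v| ≤ c * (1 + |v|)) → ∀ k : ℕ, k * Δ ≤ T →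
      ∫ ω, euler K b σ v₀ Δ (fun j => w j ω) k ^ 2 ∂P ≤ C := by
  -- `B` is the constant `4 c² (k Δ + 1)` of `integral_sq_linear_le` with `k Δ ≤ T`, times `cK²`
  -- from the kernel, times `2` from `(v₀ + S)² ≤ 2 v₀² + 2 S²`.
  obtain ⟨C, hC⟩ := discrete_gronwall hβ₀ hβ₁ (A := 1 + 2 * v₀ ^ 2)
    (B := 8 * c ^ 2 * (T + 1) * cK ^ 2) (T := T) (by positivity) (by positivity) (by positivity)
  refine ⟨max C 0, le_max_right _ _, fun 𝒢 w Δ b σ hw hΔ hb hσ hbσ n hn => ?_⟩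
  set V : ℕ → Ω → ℝ := fun k ω => euler K b σ v₀ Δ (fun j => w j ω) k with hV
  have hu := hC Δ hΔ n hn (fun k => 1 + ∫ ω, V k ω ^ 2 ∂P) ?_ n le_rfl
  · have : ∫ ω, V n ω ^ 2 ∂P ≤ C := by linarith
    exact this.trans (le_max_left _ _)
  intro k hk
  have hkT : (k : ℝ) * Δ ≤ T :=
    (mul_le_mul_of_nonneg_right (by exact_mod_cast hk) hΔ.le).trans hn
  obtain ⟨s1, s2⟩ := hw.integral_sq_linear_le (K := K) (v₀ := v₀) hb hσ hbσ hΔ.le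
    (fun j => K (((k : ℝ) - (j : ℝ)) * Δ)) k
  set S : Ω → ℝ := fun ω => ∑ j ∈ Finset.range k, K (((k : ℝ) - (j : ℝ)) * Δ) *
      (b (euler K b σ v₀ Δ (fun j => w j ω) j) * Δ +
        σ (euler K b σ v₀ Δ (fun j => w j ω) j) * w j ω) with hS
  have hVS : ∀ ω, V k ω = v₀ + S ω := fun ω => euler_eq K b σ v₀ Δ _ k
  have h1 : ∫ ω, V k ω ^ 2 ∂P ≤ 2 * v₀ ^ 2 + 2 * ∫ ω, S ω ^ 2 ∂P := by
    have i2 : Integrable (fun ω => 2 * S ω ^ 2) P := s1.integrable_sq.const_mul _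
    have hm : MemLp (fun ω => v₀ + S ω) 2 P := (memLp_const v₀).add s1
    have h2 : ∫ ω, (v₀ + S ω) ^ 2 ∂P ≤ ∫ ω, (2 * v₀ ^ 2 + 2 * S ω ^ 2) ∂P :=
      integral_mono hm.integrable_sq ((integrable_const _).add i2) fun ω => by
        have := add_sq_le (a := v₀) (b := S ω)
        simp only; linarith
    rw [integral_add (integrable_const _) i2, integral_const_mul 2 fun ω => S ω ^ 2] at h2
    simp_rw [hVS]
    simpa using h2
  have h3 : ∑ j ∈ Finset.range k, K (((k : ℝ) - (j : ℝ)) * Δ) ^ 2 * Δ * (1 + ∫ ω, V j ω ^ 2 ∂P) ≤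
      cK ^ 2 * ∑ j ∈ Finset.range k, (((k : ℝ) - j) * Δ) ^ (2 * β - 1) * Δ *
        (1 + ∫ ω, V j ω ^ 2 ∂P) := by
    rw [Finset.mul_sum]
    refine Finset.sum_le_sum fun j hj => ?_
    have hj' := Finset.mem_range.1 hj
    have hkj : 0 < (k : ℝ) - j := sub_pos.2 (by exact_mod_cast hj')
    have hx : 0 < ((k : ℝ) - j) * Δ := by positivity
    have hxT : ((k : ℝ) - j) * Δ ≤ T := by
      refine le_trans (mul_le_mul_of_nonneg_right ?_ hΔ.le) hkT
      linarith [(Nat.cast_nonneg j : (0 : ℝ) ≤ j)]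
    have h4 : K (((k : ℝ) - j) * Δ) ^ 2 ≤ cK ^ 2 * (((k : ℝ) - j) * Δ) ^ (2 * β - 1) := by
      rw [← sq_abs]
      refine (pow_le_pow_left₀ (abs_nonneg _) (hK _ hx hxT) 2).trans (le_of_eq ?_)
      rw [mul_pow, ← Real.rpow_natCast (_ ^ _) 2, ← Real.rpow_mul hx.le]
      congr 2; push_cast; ring
    have h5 : 0 ≤ ∫ ω, V j ω ^ 2 ∂P := integral_nonneg fun ω => sq_nonneg _
    rw [← mul_assoc, ← mul_assoc]
    gcongr
  have h6 : 0 ≤ ∑ j ∈ Finset.range k, K (((k : ℝ) - (j : ℝ)) * Δ) ^ 2 * Δ *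
      (1 + ∫ ω, V j ω ^ 2 ∂P) := Finset.sum_nonneg fun j _ => by
    have h5 : 0 ≤ ∫ ω, V j ω ^ 2 ∂P := integral_nonneg fun ω => sq_nonneg _
    positivity
  have h7 : ∫ ω, S ω ^ 2 ∂P ≤ 4 * c ^ 2 * (T + 1) * (cK ^ 2 *
      ∑ j ∈ Finset.range k, (((k : ℝ) - j) * Δ) ^ (2 * β - 1) * Δ *
        (1 + ∫ ω, V j ω ^ 2 ∂P)) := by
    refine s2.trans (mul_le_mul ?_ h3 h6 (by positivity))
    gcongr
  linarith

/-- In one step the past terms are reweighted by kernel differences of size `Δ ((k - j)Δ)^(β -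
3/2)`. Their squares times `Δ` are `(k - j)^(2β - 3) Δ^(2β)`, summable over `j`. The newest term
contributes `K(Δ)² Δ = O(Δ^(2β))`. -/
theorem exists_integral_sq_euler_sub_le {β : ℝ} (hβ₀ : 0 < β) (hβ₁ : β < 1) (T : ℕ) {K : ℝ → ℝ}
    {c cK : ℝ} (hK : ∀ t : ℝ, 0 < t → t ≤ T → |K t| ≤ cK * t ^ (β - 1 / 2))
    (hK' : ∀ s t : ℝ, 0 < s → s ≤ t → t ≤ T → |K t - K s| ≤ cK * (t - s) * s ^ (β - 3 / 2))
    (v₀ : ℝ) :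
    ∃ C : ℝ, 0 ≤ C ∧ ∀ (𝒢 : ℕ → MeasurableSpace Ω) (w : ℕ → Ω → ℝ) (Δ : ℝ) (b σ : ℝ → ℝ),
      IsNoise P 𝒢 w Δ → 0 < Δ → Measurable b → Measurable σ →
      (∀ v, |b v| + |σ v| ≤ c * (1 + |v|)) → ∀ k : ℕ, (k + 1 : ℕ) * Δ ≤ T →
      ∫ ω, (euler K b σ v₀ Δ (fun j => w j ω) (k + 1) -
        euler K b σ v₀ Δ (fun j => w j ω) k) ^ 2 ∂P ≤ C * Δ ^ (2 * β) := by
  obtain ⟨Cm, hCm0, hCm⟩ := exists_integral_sq_euler_le (P := P) hβ₀ hβ₁ T (c := c) hK v₀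
  obtain ⟨S, hS0, hS⟩ := exists_sum_rpow_le hβ₁
  refine ⟨4 * c ^ 2 * (T + 1) * (cK ^ 2 * (S + 1) * (1 + Cm)), by positivity,
    fun 𝒢 w Δ b σ hw hΔ hb hσ hbσ k hk => ?_⟩
  -- The case distinction accounts for `j = k`: that term enters the value at `k + 1` but not the
  -- value at `k`.
  set a : ℕ → ℝ := fun j => K ((((k + 1 : ℕ) : ℝ) - (j : ℝ)) * Δ) -
    if j < k then K (((k : ℝ) - (j : ℝ)) * Δ) else 0 with ha
  obtain ⟨-, s2⟩ := hw.integral_sq_linear_le (K := K) (v₀ := v₀) hb hσ hbσ hΔ.le a (k + 1)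
  have e : ∀ ω, euler K b σ v₀ Δ (fun j => w j ω) (k + 1) -
      euler K b σ v₀ Δ (fun j => w j ω) k = ∑ j ∈ Finset.range (k + 1), a j *
      (b (euler K b σ v₀ Δ (fun j => w j ω) j) * Δ +
        σ (euler K b σ v₀ Δ (fun j => w j ω) j) * w j ω) := fun ω => by
    rw [euler_eq K b σ v₀ Δ _ (k + 1), euler_eq K b σ v₀ Δ _ k]
    simp only [ha, sub_mul, Finset.sum_sub_distrib, ite_mul, zero_mul]
    rw [Finset.sum_range_succ (fun j => if j < k then _ else _), if_neg (lt_irrefl k), add_zero,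
      add_sub_add_left_eq_sub]
    congr 1
    exact Finset.sum_congr rfl fun j hj => by rw [if_pos (Finset.mem_range.1 hj)]
  simp_rw [e]
  have hΔT : ∀ j : ℕ, j ≤ k + 1 → (j : ℝ) * Δ ≤ T := fun j hj =>
    (mul_le_mul_of_nonneg_right (by exact_mod_cast hj) hΔ.le).trans hk
  have h1 : ∀ j < k, a j ^ 2 * Δ ≤ cK ^ 2 * ((k : ℝ) - j) ^ (2 * β - 3) * Δ ^ (2 * β) := by
    intro j hj
    have hkj : 0 < (k : ℝ) - j := sub_pos.2 (by exact_mod_cast hj)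
    have hx : 0 < ((k : ℝ) - j) * Δ := by positivity
    have hle := hΔT (k + 1) le_rfl
    push_cast at hle
    have h2 := hK' (((k : ℝ) - j) * Δ) (((k + 1 : ℕ) - (j : ℝ)) * Δ) hx
      (by push_cast; nlinarith) (by push_cast; nlinarith [(Nat.cast_nonneg j : (0 : ℝ) ≤ j)])
    have e1 : (((k + 1 : ℕ) : ℝ) - (j : ℝ)) * Δ - ((k : ℝ) - j) * Δ = Δ := by push_cast; ring
    rw [e1] at h2
    simp only [ha, if_pos hj]
    have h3 := pow_le_pow_left₀ (abs_nonneg _) h2 2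
    rw [sq_abs] at h3
    refine (mul_le_mul_of_nonneg_right h3 hΔ.le).trans (le_of_eq ?_)
    have e2 : ((((k : ℝ) - j) * Δ) ^ (β - 3 / 2)) ^ 2 =
        ((k : ℝ) - j) ^ (2 * β - 3) * Δ ^ (2 * β - 3) := by
      rw [← Real.rpow_natCast (_ ^ _) 2, ← Real.rpow_mul hx.le, Real.mul_rpow hkj.le hΔ.le]
      push_cast
      congr 2 <;> ring
    have e3 : Δ ^ (2 * β) = Δ ^ (2 * β - 3) * Δ ^ 3 := by
      rw [← Real.rpow_natCast Δ 3, ← Real.rpow_add hΔ]; congr 1; push_cast; ring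
    rw [mul_pow, e2, e3]; ring
  have h2 : a k ^ 2 * Δ ≤ cK ^ 2 * Δ ^ (2 * β) := by
    have h3 := hK Δ hΔ (by simpa using hΔT 1 (by omega))
    have e1 : a k = K Δ := by simp [ha]
    rw [e1]
    have h4 := pow_le_pow_left₀ (abs_nonneg _) h3 2
    rw [sq_abs] at h4
    refine (mul_le_mul_of_nonneg_right h4 hΔ.le).trans (le_of_eq ?_)
    have e2 : (Δ ^ (β - 1 / 2)) ^ 2 = Δ ^ (2 * β - 1) := by
      rw [← Real.rpow_natCast (_ ^ _) 2, ← Real.rpow_mul hΔ.le]; congr 1; push_cast; ring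
    rw [mul_pow, e2, Real.rpow_sub_one hΔ.ne']; field_simp
  have h3 : ∑ j ∈ Finset.range (k + 1), a j ^ 2 * Δ ≤ cK ^ 2 * (S + 1) * Δ ^ (2 * β) := by
    rw [Finset.sum_range_succ]
    have h4 : ∑ j ∈ Finset.range k, a j ^ 2 * Δ ≤ cK ^ 2 * S * Δ ^ (2 * β) := by
      refine (Finset.sum_le_sum fun j hj => h1 j (Finset.mem_range.1 hj)).trans ?_
      rw [← Finset.sum_mul, ← Finset.mul_sum]
      have := hS k
      gcongr
    linarith
  have h5 : ∑ j ∈ Finset.range (k + 1), a j ^ 2 * Δ *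
      (1 + ∫ ω, euler K b σ v₀ Δ (fun j => w j ω) j ^ 2 ∂P) ≤
      cK ^ 2 * (S + 1) * Δ ^ (2 * β) * (1 + Cm) := by
    refine le_trans (Finset.sum_le_sum fun j hj => ?_)
      ((Finset.sum_mul _ _ _).symm.le.trans (mul_le_mul_of_nonneg_right h3 (by positivity)))
    have := hCm 𝒢 w Δ b σ hw hΔ hb hσ hbσ j (hΔT j (Finset.mem_range.1 hj).le)
    gcongr
  calc _ ≤ 4 * c ^ 2 * (((k + 1 : ℕ) : ℝ) * Δ + 1) * ∑ j ∈ Finset.range (k + 1), a j ^ 2 * Δ *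
      (1 + ∫ ω, euler K b σ v₀ Δ (fun j => w j ω) j ^ 2 ∂P) := s2
    _ ≤ 4 * c ^ 2 * (T + 1) * (cK ^ 2 * (S + 1) * Δ ^ (2 * β) * (1 + Cm)) := by
      refine mul_le_mul (by gcongr) h5 (Finset.sum_nonneg fun j _ => ?_) (by positivity)
      have h6 : 0 ≤ ∫ ω, euler K b σ v₀ Δ (fun j => w j ω) j ^ 2 ∂P :=
        integral_nonneg fun ω => sq_nonneg _
      positivity
    _ = _ := by ring

end IsNoise

/-! ### Brownian increments -/

/-- The increments of `W` on the grid of step `Δ_l`. -/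
noncomputable def incr {Ω : Type*} (W : ℝ≥0 → Ω → ℝ) (l : ℕ) (ω : Ω) (j : ℕ) : ℝ :=
  W ((j + 1 : ℕ) * step l) ω - W (j * step l) ω

theorem step_pos (l : ℕ) : 0 < step l := by unfold step; positivity

theorem step_succ (l : ℕ) : 2 * step (l + 1) = step l := by
  unfold step; rw [pow_succ, mul_comm, mul_assoc, inv_mul_cancel₀ two_ne_zero, mul_one]

theorem step_mul_two_pow (l : ℕ) : (step l : ℝ) * 2 ^ l = 1 := by
  simp [step]

theorem coarsen_incr {Ω : Type*} (W : ℝ≥0 → Ω → ℝ) (l : ℕ) (ω : Ω) :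
    coarsen (incr W (l + 1) ω) = incr W l ω := by
  funext j
  have e1 : ((2 * j : ℕ) : ℝ≥0) * step (l + 1) = j * step l := by
    rw [← step_succ l]; push_cast; ring
  have e2 : ((2 * j + 1 + 1 : ℕ) : ℝ≥0) * step (l + 1) = (j + 1 : ℕ) * step l := by
    rw [← step_succ l]; push_cast; ring
  simp only [coarsen, incr, e1, e2]
  ring

section Brownian

variable {Ω : Type*} {mΩ : MeasurableSpace Ω} {P : Measure Ω} {ℱ : Filtration ℝ≥0 mΩ}
  {W : ℝ≥0 → Ω → ℝ}

theorem IsBrownianWrt.measurable (hW : IsBrownianWrt P ℱ W) (t : ℝ≥0) : Measurable (W t) :=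
  (hW.adapted t).mono (ℱ.le t) le_rfl

theorem IsBrownianWrt.measurable_incr (hW : IsBrownianWrt P ℱ W) (l : ℕ) :
    Measurable (incr W l) :=
  measurable_pi_lambda _ fun _ => (hW.measurable _).sub (hW.measurable _)

theorem IsBrownianWrt.hasLaw_incr (hW : IsBrownianWrt P ℱ W) (l j : ℕ) :
    HasLaw (fun ω => incr W l ω j) (gaussianReal 0 (step l)) P := by
  have h := hW.brownian.hasLaw_sub ((j + 1 : ℕ) * step l) (j * step l)
  have e : nndist (((((j + 1 : ℕ) : ℝ≥0) * step l : ℝ≥0)) : ℝ) ((j * step l : ℝ≥0) : ℝ) =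
      step l := by
    rw [← NNReal.coe_inj, coe_nndist, Real.dist_eq]
    push_cast
    rw [add_mul, one_mul, add_sub_cancel_left, abs_of_nonneg (NNReal.coe_nonneg _)]
  rw [← e]
  exact h

theorem IsBrownianWrt.isNoise (hW : IsBrownianWrt P ℱ W) (l : ℕ) :
    IsNoise P (fun j => ℱ (j * step l)) (fun j ω => incr W l ω j) (step l) where
  mono i j hij := ℱ.mono (by gcongr)
  le _ := ℱ.le _
  adapted j := (hW.adapted _).sub ((hW.adapted _).mono (ℱ.mono (by gcongr; omega)) le_rfl)
  indep j := hW.indep _ _ (by gcongr; omega)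
  memLp j := by
    have h := hW.hasLaw_incr l j
    have h2 : MemLp id 2 (gaussianReal 0 (step l)) := memLp_id_gaussianReal 2
    rw [← h.map_eq] at h2
    exact h2.comp_of_map h.aemeasurable
  mean j := by
    rw [(hW.hasLaw_incr l j).integral_eq, integral_id_gaussianReal]
  var j := by
    have h := hW.hasLaw_incr l j
    have h2 := variance_id_gaussianReal (μ := 0) (v := step l)
    rw [variance_of_integral_eq_zero aemeasurable_id (by simp [integral_id_gaussianReal])] at h2
    rw [← h2]
    exact h.integral_comp (f := fun x : ℝ => x ^ 2) (by fun_prop)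

end Brownian

end VolterraMCMC

namespace VolterraMCMC

/-! ### Strong rates for two consecutive levels -/

theorem sum_range_two_mul (F : ℕ → ℝ) (n : ℕ) :
    ∑ k ∈ Finset.range (2 * n), F k = ∑ k ∈ Finset.range n, (F (2 * k) + F (2 * k + 1)) := by
  induction n with
  | zero => simp
  | succ n ih =>
    rw [Nat.mul_succ, Finset.sum_range_succ, Finset.sum_range_succ, ih, Finset.sum_range_succ,
      add_assoc]

theorem integral_sq_le_of_eLpNorm_le {Ω : Type*} {mΩ : MeasurableSpace Ω} {P : Measure Ω}
    {f : Ω → ℝ} (hf : MemLp f 2 P) {a : ℝ} (ha : 0 ≤ a)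
    (h : eLpNorm f 2 P ≤ ENNReal.ofReal a) : ∫ ω, f ω ^ 2 ∂P ≤ a ^ 2 := by
  rw [hf.eLpNorm_eq_integral_rpow_norm two_ne_zero ENNReal.ofNat_ne_top,
    ENNReal.ofReal_le_ofReal_iff ha] at h
  have e : ∫ ω, ‖f ω‖ ^ (2 : ℝ≥0∞).toReal ∂P = ∫ ω, f ω ^ 2 ∂P := by
    refine integral_congr_ae (ae_of_all _ fun ω => ?_)
    simp
  rw [e] at h
  have h0 : 0 ≤ ∫ ω, f ω ^ 2 ∂P := integral_nonneg fun ω => sq_nonneg _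
  have h2 := pow_le_pow_left₀ (by positivity) h 2
  rwa [← Real.rpow_natCast (_ ^ _) 2, ← Real.rpow_mul h0, ENNReal.toReal_ofNat, Nat.cast_ofNat,
    inv_mul_cancel₀ two_ne_zero, Real.rpow_one] at h2

theorem memLp_comp_sub {Ω : Type*} {mΩ : MeasurableSpace Ω} {P : Measure Ω} {f : ℝ → ℝ}
    {L : ℝ≥0} (hf : LipschitzWith L f) {A B : Ω → ℝ}
    (hA : MemLp A 2 P) (hB : MemLp B 2 P) (hAm : Measurable A) (hBm : Measurable B) :
    MemLp (fun ω => f (A ω) - f (B ω)) 2 P ∧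
      ∫ ω, (f (A ω) - f (B ω)) ^ 2 ∂P ≤ (L : ℝ) ^ 2 * ∫ ω, (A ω - B ω) ^ 2 ∂P := by
  have h1 : ∀ ω, |f (A ω) - f (B ω)| ≤ L * |A ω - B ω| := fun ω => by
    have := hf.dist_le_mul (A ω) (B ω)
    rwa [Real.dist_eq, Real.dist_eq] at this
  have hD : MemLp (fun ω => A ω - B ω) 2 P := hA.sub hB
  have hm : Measurable fun ω => f (A ω) - f (B ω) :=
    (hf.continuous.measurable.comp hAm).sub (hf.continuous.measurable.comp hBm)
  have hL : MemLp (fun ω => f (A ω) - f (B ω)) 2 P := by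
    refine MemLp.mono (g := fun ω => (L : ℝ) * |A ω - B ω|) (hD.abs.const_mul (L : ℝ))
      hm.aestronglyMeasurable (ae_of_all _ fun ω => ?_)
    rw [Real.norm_eq_abs, Real.norm_of_nonneg (by positivity)]
    exact h1 ω
  refine ⟨hL, ?_⟩
  rw [← integral_const_mul]
  refine integral_mono hL.integrable_sq (hD.integrable_sq.const_mul _) fun ω => ?_
  simp only
  rw [← sq_abs, ← sq_abs (A ω - B ω), ← mul_pow]
  exact pow_le_pow_left₀ (abs_nonneg _) (h1 ω) 2

namespace Model

variable {d : ℕ} {Θ : Set (Fin d → ℝ)} {Y : Type*} {𝓜 : Model Θ Y} {T : ℕ} {β : ℝ}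
  {Ω : Type*} {mΩ : MeasurableSpace Ω} {P : Measure Ω} [IsProbabilityMeasure P]
  {ℱ : Filtration ℝ≥0 mΩ} {W : ℝ≥0 → Ω → ℝ} {V : Θ → ℝ≥0 → Ω → ℝ}

theorem IsRegular.measurable_memLp_vol (h𝓜 : 𝓜.IsRegular T β) (hW : IsBrownianWrt P ℱ W)
    (l : ℕ) (θ : Θ) (k : ℕ) :
    Measurable[ℱ (k * step l)] (fun ω => 𝓜.vol l θ (incr W l ω) k) ∧
      MemLp (fun ω => 𝓜.vol l θ (incr W l ω) k) 2 P := by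
  obtain ⟨c, hc⟩ := h𝓜.growth
  exact (hW.isNoise l).measurable_memLp_euler (h𝓜.b_meas.comp measurable_prodMk_left)
    (h𝓜.σ_meas.comp measurable_prodMk_left) (hc θ) k

/-- The coarse scheme is frozen between its grid points, whence `j / 2`. At even `j` both schemes
approximate `V` at the same time, and (A2) with `r = 2` applies to each. An odd `j` is one fine
Euler step further. -/
theorem exists_integral_sq_vol_sub_le (hβ₀ : 0 < β) (hβ₁ : β < 1) (h𝓜 : 𝓜.IsRegular T β)
    (hW : IsBrownianWrt P ℱ W) (hVm : ∀ θ t, Measurable (V θ t)) (hA2 : 𝓜.A2 P W V T β) :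
    ∃ C : ℝ, 0 ≤ C ∧ ∀ (l : ℕ) (θ : Θ) (j : ℕ), j ≤ T * 2 ^ (l + 1) →
      ∫ ω, (𝓜.vol (l + 1) θ (incr W (l + 1) ω) j - 𝓜.vol l θ (incr W l ω) (j / 2)) ^ 2 ∂P ≤
        C * (step (l + 1) : ℝ) ^ (2 * β) := by
  obtain ⟨c, hc⟩ := h𝓜.growth
  obtain ⟨cK, hK, hK'⟩ := h𝓜.kernel
  obtain ⟨C₁, hC₁0, hC₁⟩ := IsNoise.exists_integral_sq_euler_sub_le (P := P) hβ₀ hβ₁ T (c := c)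
    hK hK' 𝓜.v₀
  obtain ⟨C₂, hC₂⟩ := hA2 2 one_le_two le_rfl
  have hV : ∀ l θ k, MemLp (fun ω => 𝓜.vol l θ (incr W l ω) k) 2 P := fun l θ k =>
    (h𝓜.measurable_memLp_vol hW l θ k).2
  have heven : ∀ (l : ℕ) (θ : Θ) (i : ℕ), 2 * i ≤ T * 2 ^ (l + 1) →
      ∫ ω, (𝓜.vol (l + 1) θ (incr W (l + 1) ω) (2 * i) - 𝓜.vol l θ (incr W l ω) i) ^ 2 ∂P ≤
        (3 * max C₂ 0) ^ 2 * (step (l + 1) : ℝ) ^ (2 * β) := by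
    intro l θ i hi
    have hs : (0 : ℝ) < step (l + 1) := step_pos _
    -- Time zero is not covered by (A2), but there both schemes equal `v₀`.
    rcases Nat.eq_zero_or_pos i with rfl | hi0
    · simp only [vol, mul_zero, euler_zero, sub_self]
      simp only [ne_eq, OfNat.ofNat_ne_zero, not_false_eq_true, zero_pow, integral_zero]
      positivity
    have hi' : i ≤ T * 2 ^ l := by rw [pow_succ] at hi; linarith
    have h1 := hC₂ (l + 1) (2 * i) (by omega) hi θ
    have h2 := hC₂ l i hi0 hi' θ
    have et : ((2 * i : ℕ) : ℝ≥0) * step (l + 1) = i * step l := by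
      rw [← step_succ l]; push_cast; ring
    rw [et] at h1
    set U : Ω → ℝ := V θ (i * step l) with hU
    set A : Ω → ℝ := fun ω => 𝓜.vol (l + 1) θ (incr W (l + 1) ω) (2 * i) with hA
    set B : Ω → ℝ := fun ω => 𝓜.vol l θ (incr W l ω) i with hB
    have hUm : AEStronglyMeasurable U P := (hVm θ _).aestronglyMeasurable
    have h1' : eLpNorm (A - U) 2 P ≤ ENNReal.ofReal (max C₂ 0 * (step (l + 1) : ℝ) ^ β) := by
      have e : ENNReal.ofReal 2 = 2 := by norm_num
      rw [e] at h1
      refine h1.trans (ENNReal.ofReal_le_ofReal ?_)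
      gcongr
      exact le_max_left _ _
    have h2' : eLpNorm (B - U) 2 P ≤ ENNReal.ofReal (2 * max C₂ 0 * (step (l + 1) : ℝ) ^ β) := by
      have e : ENNReal.ofReal 2 = 2 := by norm_num
      rw [e] at h2
      refine h2.trans (ENNReal.ofReal_le_ofReal ?_)
      -- The coarse step is twice the fine one and `2^β ≤ 2`; with the fine error this makes the
      -- factor `3`.
      have e2 : (step l : ℝ) ^ β ≤ 2 * (step (l + 1) : ℝ) ^ β := by
        rw [← step_succ l, NNReal.coe_mul, Real.mul_rpow (by positivity) hs.le]
        gcongr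
        calc ((2 : ℝ≥0) : ℝ) ^ β ≤ (2 : ℝ) ^ (1 : ℝ) :=
              Real.rpow_le_rpow_of_exponent_le one_le_two hβ₁.le
          _ = 2 := by norm_num
      calc C₂ * (step l : ℝ) ^ β ≤ max C₂ 0 * (2 * (step (l + 1) : ℝ) ^ β) := by
            gcongr; exact le_max_left _ _
        _ = _ := by ring
    have h3 : eLpNorm (A - B) 2 P ≤ ENNReal.ofReal (3 * max C₂ 0 * (step (l + 1) : ℝ) ^ β) := by
      have e : A - B = (A - U) - (B - U) := by abel
      rw [e]
      refine (eLpNorm_sub_le ((hV _ _ _).1.sub hUm) ((hV _ _ _).1.sub hUm) one_le_two).trans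
        ((add_le_add h1' h2').trans (le_of_eq ?_))
      rw [← ENNReal.ofReal_add (by positivity) (by positivity)]
      congr 1; ring
    refine (integral_sq_le_of_eLpNorm_le ((hV _ _ _).sub (hV _ _ _)) (by positivity) h3).trans
      (le_of_eq ?_)
    rw [mul_pow, ← Real.rpow_natCast (_ ^ β) 2, ← Real.rpow_mul hs.le]
    congr 2; push_cast; ring
  refine ⟨2 * C₁ + 2 * (3 * max C₂ 0) ^ 2, by positivity, fun l θ j hj => ?_⟩
  have hs : (0 : ℝ) < step (l + 1) := step_pos _
  rcases Nat.even_or_odd' j with ⟨i, rfl | rfl⟩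
  · rw [Nat.mul_div_cancel_left i two_pos]
    refine (heven l θ i hj).trans ?_
    gcongr
    nlinarith [sq_nonneg (3 * max C₂ 0)]
  · have e : (2 * i + 1) / 2 = i := by omega
    rw [e]
    have h1 := heven l θ i (by omega)
    have hjT : ((2 * i + 1 : ℕ) : ℝ) * (step (l + 1) : ℝ) ≤ T := by
      calc _ ≤ ((T * 2 ^ (l + 1) : ℕ) : ℝ) * (step (l + 1) : ℝ) := by gcongr
        _ = T * ((step (l + 1) : ℝ) * 2 ^ (l + 1)) := by push_cast; ring
        _ = T := by rw [step_mul_two_pow, mul_one]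
    have h2 : ∫ ω, (𝓜.vol (l + 1) θ (incr W (l + 1) ω) (2 * i + 1) -
        𝓜.vol (l + 1) θ (incr W (l + 1) ω) (2 * i)) ^ 2 ∂P ≤
        C₁ * (step (l + 1) : ℝ) ^ (2 * β) :=
      hC₁ _ _ _ _ _ (hW.isNoise (l + 1)) hs (h𝓜.b_meas.comp measurable_prodMk_left)
        (h𝓜.σ_meas.comp measurable_prodMk_left) (hc θ) (2 * i) hjT
    set A' : Ω → ℝ := fun ω => 𝓜.vol (l + 1) θ (incr W (l + 1) ω) (2 * i + 1) with hA'
    set A : Ω → ℝ := fun ω => 𝓜.vol (l + 1) θ (incr W (l + 1) ω) (2 * i) with hA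
    set B : Ω → ℝ := fun ω => 𝓜.vol l θ (incr W l ω) i with hB
    have L1 : MemLp (fun ω => A' ω - A ω) 2 P := (hV _ _ _).sub (hV _ _ _)
    have L2 : MemLp (fun ω => A ω - B ω) 2 P := (hV _ _ _).sub (hV _ _ _)
    have L3 : MemLp (fun ω => A' ω - B ω) 2 P := (hV _ _ _).sub (hV _ _ _)
    have I1 : Integrable (fun ω => 2 * (A' ω - A ω) ^ 2) P := L1.integrable_sq.const_mul _
    have I2 : Integrable (fun ω => 2 * (A ω - B ω) ^ 2) P := L2.integrable_sq.const_mul _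
    have h3 : ∫ ω, (A' ω - B ω) ^ 2 ∂P ≤ ∫ ω, (2 * (A' ω - A ω) ^ 2 + 2 * (A ω - B ω) ^ 2) ∂P :=
      integral_mono L3.integrable_sq (I1.add I2) fun ω => by
        have := add_sq_le (a := A' ω - A ω) (b := A ω - B ω)
        rw [sub_add_sub_cancel] at this
        simp only; linarith
    rw [integral_add I1 I2, integral_const_mul, integral_const_mul] at h3
    calc _ ≤ _ := h3
      _ ≤ 2 * (C₁ * (step (l + 1) : ℝ) ^ (2 * β)) +
          2 * ((3 * max C₂ 0) ^ 2 * (step (l + 1) : ℝ) ^ (2 * β)) := by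
        gcongr
      _ = _ := by ring

/-- The Lipschitz property of the observation density reduces the claim to its two arguments. The
coarse sums are rewritten on the fine grid with the frozen coarse path, so both differences are sums
over the same increments. The time average is handled by Cauchy–Schwarz with `Δ n = 1`, and the
stochastic sum by the isometry, which keeps the full rate. -/
theorem exists_integral_sq_lik_sub_le (hβ₀ : 0 < β) (hβ₁ : β < 1) (h𝓜 : 𝓜.IsRegular T β)
    (hW : IsBrownianWrt P ℱ W) (hVm : ∀ θ t, Measurable (V θ t)) (hA1 : 𝓜.A1)
    (hA2 : 𝓜.A2 P W V T β) (t : ℕ) (ht : t < T) :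
    ∃ C : ℝ, 0 ≤ C ∧ ∀ (l : ℕ) (θ : Θ),
      ∫ ω, (𝓜.lik (l + 1) t θ (incr W (l + 1) ω) - 𝓜.lik l t θ (incr W l ω)) ^ 2 ∂P ≤
        C * (step (l + 1) : ℝ) ^ (2 * β) := by
  obtain ⟨C, hC0, hC⟩ := exists_integral_sq_vol_sub_le hβ₀ hβ₁ h𝓜 hW hVm hA2
  obtain ⟨Lf, hf⟩ := hA1.f_lip
  obtain ⟨Lh, hh⟩ := hA1.h_lip
  obtain ⟨c, hc⟩ := hA1.g_lip (𝓜.y (t + 1)) (𝓜.y t)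
  refine ⟨2 * c ^ 2 * ((Lf : ℝ) ^ 2 * C + (Lh : ℝ) ^ 2 * C), by positivity, fun l θ => ?_⟩
  set Δ : ℝ := NNReal.toReal (step (l + 1)) with hΔ
  have hΔ0 : 0 < Δ := step_pos _
  set s : ℕ := t * 2 ^ (l + 1) with hs
  set n : ℕ := 2 ^ (l + 1) with hn
  have hnΔ : Δ * n = 1 := by rw [hn]; push_cast; exact step_mul_two_pow (l + 1)
  set A : ℕ → Ω → ℝ := fun k ω => 𝓜.vol (l + 1) θ (incr W (l + 1) ω) (s + k) with hA
  set B : ℕ → Ω → ℝ := fun k ω => 𝓜.vol l θ (incr W l ω) ((s + k) / 2) with hB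
  have hA2' : ∀ k, MemLp (A k) 2 P := fun k => (h𝓜.measurable_memLp_vol hW _ θ _).2
  have hB2' : ∀ k, MemLp (B k) 2 P := fun k => (h𝓜.measurable_memLp_vol hW _ θ _).2
  have hAm : ∀ k, Measurable[ℱ ((s + k : ℕ) * step (l + 1))] (A k) := fun k =>
    (h𝓜.measurable_memLp_vol hW _ θ _).1
  -- The frozen coarse value refers to a grid time not later than the fine time, so it is adapted to
  -- the fine filtration, as the isometry requires.
  have hBm : ∀ k, Measurable[ℱ ((s + k : ℕ) * step (l + 1))] (B k) := fun k => by
    refine (h𝓜.measurable_memLp_vol hW _ θ _).1.mono (ℱ.mono ?_) le_rfl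
    rw [← step_succ l, ← mul_assoc]
    gcongr
    have : (s + k) / 2 * 2 ≤ s + k := Nat.div_mul_le_self _ _
    exact_mod_cast this
  have hAm0 : ∀ k, Measurable (A k) := fun k => (hAm k).mono (ℱ.le _) le_rfl
  have hBm0 : ∀ k, Measurable (B k) := fun k => (hBm k).mono (ℱ.le _) le_rfl
  have hAB : ∀ k < n, ∫ ω, (A k ω - B k ω) ^ 2 ∂P ≤ C * Δ ^ (2 * β) := fun k hk =>
    hC l θ (s + k) (by
      have : (t + 1) * 2 ^ (l + 1) ≤ T * 2 ^ (l + 1) := Nat.mul_le_mul_right _ ht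
      rw [add_mul] at this; omega)
  have hdf := fun k => memLp_comp_sub hf (hA2' k) (hB2' k) (hAm0 k) (hBm0 k)
  have hdh := fun k => memLp_comp_sub hh (hA2' k) (hB2' k) (hAm0 k) (hBm0 k)
  have hidx : ∀ k, (s + 2 * k) / 2 = t * 2 ^ l + k ∧ (s + (2 * k + 1)) / 2 = t * 2 ^ l + k :=
    fun k => by
      have : s = 2 * (t * 2 ^ l) := by rw [hs, hn, pow_succ]; ring
      rw [this]; constructor <;> omega
  have h2n : n = 2 * 2 ^ l := by rw [hn, pow_succ, mul_comm]
  -- the two arguments of the observation density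
  set D₁ : Ω → ℝ := fun ω => Δ * ∑ k ∈ Finset.range n, (𝓜.f (A k ω) - 𝓜.f (B k ω)) with hD₁
  set D₂ : Ω → ℝ := fun ω => ∑ k ∈ Finset.range n, (𝓜.h (A k ω) - 𝓜.h (B k ω)) *
    incr W (l + 1) ω (s + k) with hD₂
  have e₁ : ∀ ω, Δ * ∑ k ∈ Finset.range (2 ^ (l + 1)),
      𝓜.f (𝓜.vol (l + 1) θ (incr W (l + 1) ω) (t * 2 ^ (l + 1) + k)) -
      step l * ∑ k ∈ Finset.range (2 ^ l), 𝓜.f (𝓜.vol l θ (incr W l ω) (t * 2 ^ l + k)) =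
      D₁ ω := fun ω => by
    have h1 : (step l : ℝ) * ∑ k ∈ Finset.range (2 ^ l),
        𝓜.f (𝓜.vol l θ (incr W l ω) (t * 2 ^ l + k)) =
        Δ * ∑ k ∈ Finset.range n, 𝓜.f (B k ω) := by
      rw [h2n, sum_range_two_mul, ← step_succ l]
      simp only [hB, (hidx _).1, (hidx _).2, ← two_mul, ← Finset.mul_sum]
      push_cast; ring
    rw [h1, ← mul_sub, ← Finset.sum_sub_distrib]
  have e₂ : ∀ ω, ∑ k ∈ Finset.range (2 ^ (l + 1)),
      𝓜.h (𝓜.vol (l + 1) θ (incr W (l + 1) ω) (t * 2 ^ (l + 1) + k)) *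
        incr W (l + 1) ω (t * 2 ^ (l + 1) + k) -
      ∑ k ∈ Finset.range (2 ^ l), 𝓜.h (𝓜.vol l θ (incr W l ω) (t * 2 ^ l + k)) *
        incr W l ω (t * 2 ^ l + k) = D₂ ω := fun ω => by
    have h1 : ∑ k ∈ Finset.range (2 ^ l), 𝓜.h (𝓜.vol l θ (incr W l ω) (t * 2 ^ l + k)) *
        incr W l ω (t * 2 ^ l + k) =
        ∑ k ∈ Finset.range n, 𝓜.h (B k ω) * incr W (l + 1) ω (s + k) := by
      rw [h2n, sum_range_two_mul]
      refine Finset.sum_congr rfl fun k _ => ?_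
      have h3 : s + 2 * k = 2 * (t * 2 ^ l + k) := by rw [hs, hn, pow_succ]; ring
      simp only [hB, (hidx _).1, (hidx _).2]
      rw [← coarsen_incr W l ω, coarsen, ← add_assoc, h3]
      ring
    rw [h1, ← Finset.sum_sub_distrib]
    exact Finset.sum_congr rfl fun k _ => by rw [sub_mul]
  have hD₁L : MemLp D₁ 2 P :=
    (memLp_finsetSum (f := fun k ω => 𝓜.f (A k ω) - 𝓜.f (B k ω)) (Finset.range n)
      fun k _ => (hdf k).1).const_mul Δ
  have hD₁le : ∫ ω, D₁ ω ^ 2 ∂P ≤ (Lf : ℝ) ^ 2 * C * Δ ^ (2 * β) := by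
    have hpt : ∀ ω, D₁ ω ^ 2 ≤ ∑ k ∈ Finset.range n, Δ * (𝓜.f (A k ω) - 𝓜.f (B k ω)) ^ 2 :=
      fun ω => by
        have h1 := sq_sum_le_card_mul_sum_sq (s := Finset.range n)
          (f := fun k => 𝓜.f (A k ω) - 𝓜.f (B k ω))
        rw [Finset.card_range] at h1
        simp only [hD₁, mul_pow]
        calc _ ≤ Δ ^ 2 * ((n : ℝ) * ∑ k ∈ Finset.range n, (𝓜.f (A k ω) - 𝓜.f (B k ω)) ^ 2) := by
              gcongr
          _ = (Δ * n) * (Δ * ∑ k ∈ Finset.range n, (𝓜.f (A k ω) - 𝓜.f (B k ω)) ^ 2) := by ring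
          _ = _ := by rw [hnΔ, one_mul, Finset.mul_sum]
    have hi : ∀ k ∈ Finset.range n,
        Integrable (fun ω => Δ * (𝓜.f (A k ω) - 𝓜.f (B k ω)) ^ 2) P :=
      fun k _ => (hdf k).1.integrable_sq.const_mul _
    refine (integral_mono hD₁L.integrable_sq (integrable_finsetSum _ hi) hpt).trans ?_
    rw [integral_finsetSum _ hi]
    calc _ ≤ ∑ k ∈ Finset.range n, Δ * ((Lf : ℝ) ^ 2 * (C * Δ ^ (2 * β))) := by
          refine Finset.sum_le_sum fun k hk => ?_
          rw [integral_const_mul]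
          have h1 := hAB k (Finset.mem_range.1 hk)
          have h2 := (hdf k).2
          have h3 := mul_le_mul_of_nonneg_left h1 (sq_nonneg (Lf : ℝ))
          exact mul_le_mul_of_nonneg_left (h2.trans h3) hΔ0.le
      _ = (Δ * n) * ((Lf : ℝ) ^ 2 * (C * Δ ^ (2 * β))) := by
          rw [Finset.sum_const, Finset.card_range, nsmul_eq_mul]; ring
      _ = _ := by rw [hnΔ]; ring
  -- The noise is shifted so that it starts at the beginning of the unit interval `[t, t + 1]`.
  obtain ⟨-, hD₂L, hD₂e⟩ := ((hW.isNoise (l + 1)).shift s).integral_sq_sum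
    (X := fun k ω => 𝓜.h (A k ω) - 𝓜.h (B k ω)) n
    (fun k _ => (hh.continuous.measurable.comp (hAm k)).sub
      (hh.continuous.measurable.comp (hBm k))) (fun k _ => (hdh k).1)
  have hD₂le : ∫ ω, D₂ ω ^ 2 ∂P ≤ (Lh : ℝ) ^ 2 * C * Δ ^ (2 * β) := by
    refine hD₂e.le.trans ?_
    rw [Finset.mul_sum]
    calc _ ≤ ∑ k ∈ Finset.range n, Δ * ((Lh : ℝ) ^ 2 * (C * Δ ^ (2 * β))) := by
          refine Finset.sum_le_sum fun k hk => ?_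
          have h1 := hAB k (Finset.mem_range.1 hk)
          have h2 := (hdh k).2
          have h3 := mul_le_mul_of_nonneg_left h1 (sq_nonneg (Lh : ℝ))
          exact mul_le_mul_of_nonneg_left (h2.trans h3) hΔ0.le
      _ = (Δ * n) * ((Lh : ℝ) ^ 2 * (C * Δ ^ (2 * β))) := by
          rw [Finset.sum_const, Finset.card_range, nsmul_eq_mul]; ring
      _ = _ := by rw [hnΔ]; ring
  have I1 : Integrable (fun ω => D₁ ω ^ 2) P := hD₁L.integrable_sq
  have I2 : Integrable (fun ω => D₂ ω ^ 2) P := hD₂L.integrable_sq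
  have hpt : ∀ ω, (𝓜.lik (l + 1) t θ (incr W (l + 1) ω) - 𝓜.lik l t θ (incr W l ω)) ^ 2 ≤
      2 * c ^ 2 * (D₁ ω ^ 2 + D₂ ω ^ 2) := fun ω => by
    have h1 : |𝓜.lik (l + 1) t θ (incr W (l + 1) ω) - 𝓜.lik l t θ (incr W l ω)| ≤
        c * (|D₁ ω| + |D₂ ω|) := by
      rw [← e₁ ω, ← e₂ ω]
      exact hc _ _ _ _
    have h2 := pow_le_pow_left₀ (abs_nonneg _) h1 2
    rw [sq_abs, mul_pow] at h2
    have h3 := add_sq_le (a := |D₁ ω|) (b := |D₂ ω|)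
    rw [sq_abs, sq_abs] at h3
    calc _ ≤ _ := h2
      _ ≤ c ^ 2 * (2 * (D₁ ω ^ 2 + D₂ ω ^ 2)) := by gcongr
      _ = _ := by ring
  refine (integral_mono_of_nonneg (ae_of_all _ fun ω => sq_nonneg _)
    ((I1.add I2).const_mul (2 * c ^ 2)) (ae_of_all _ hpt)).trans ?_
  rw [integral_const_mul, integral_add' I1 I2, mul_assoc (2 * c ^ 2)]
  refine mul_le_mul_of_nonneg_left ?_ (by positivity)
  linarith

end Model

end VolterraMCMC

/-! ### Correction factors and weighted test functions at two consecutive levels. -/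

namespace VolterraMCMC

theorem abs_prod_sub_prod_le {a b : ℕ → ℝ} (n : ℕ) (ha : ∀ t < n, 0 ≤ a t ∧ a t ≤ 1)
    (hb : ∀ t < n, 0 ≤ b t ∧ b t ≤ 1) :
    |∏ t ∈ Finset.range n, a t - ∏ t ∈ Finset.range n, b t| ≤
      ∑ t ∈ Finset.range n, |a t - b t| := by
  induction n with
  | zero => simp
  | succ n ih =>
    have ih' := ih (fun t ht => ha t (by omega)) (fun t ht => hb t (by omega))
    obtain ⟨a0, a1⟩ := ha n (by omega)
    have hB0 : 0 ≤ ∏ t ∈ Finset.range n, b t :=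
      Finset.prod_nonneg fun t ht => (hb t (by have := Finset.mem_range.1 ht; omega)).1
    have hB1 : ∏ t ∈ Finset.range n, b t ≤ 1 :=
      Finset.prod_le_one (fun t ht => (hb t (by have := Finset.mem_range.1 ht; omega)).1)
        fun t ht => (hb t (by have := Finset.mem_range.1 ht; omega)).2
    rw [Finset.prod_range_succ, Finset.prod_range_succ, Finset.sum_range_succ]
    set A := ∏ t ∈ Finset.range n, a t
    set B := ∏ t ∈ Finset.range n, b t
    have e : A * a n - B * b n = (A - B) * a n + B * (a n - b n) := by ring
    rw [e]
    refine (abs_add_le _ _).trans (add_le_add ?_ ?_)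
    · rw [abs_mul, abs_of_nonneg a0]
      exact (mul_le_of_le_one_right (abs_nonneg _) a1).trans ih'
    · rw [abs_mul, abs_of_nonneg hB0]
      exact mul_le_of_le_one_left (abs_nonneg _) hB1

namespace Model

variable {d : ℕ} {Θ : Set (Fin d → ℝ)} {Y : Type*} {𝓜 : Model Θ Y} {T : ℕ} {β : ℝ}

section Bounds

variable {c c' : ℝ} (hc : 0 < c)
  (hlik : ∀ t < T, ∀ l θ w, c ≤ 𝓜.lik l t θ w ∧ 𝓜.lik l t θ w ≤ c')
include hc hlik

theorem ratio_bounds {t : ℕ} (ht : t < T) (l : ℕ) (θ : Θ) (w : ℕ → ℝ) :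
    (c / c' ≤ 𝓜.lik l t θ w / 𝓜.maxLik l t θ w ∧
      𝓜.lik l t θ w / 𝓜.maxLik l t θ w ≤ 1) ∧
    (c / c' ≤ 𝓜.lik (l - 1) t θ (coarsen w) / 𝓜.maxLik l t θ w ∧
      𝓜.lik (l - 1) t θ (coarsen w) / 𝓜.maxLik l t θ w ≤ 1) := by
  obtain ⟨a1, a2⟩ := hlik t ht l θ w
  obtain ⟨b1, b2⟩ := hlik t ht (l - 1) θ (coarsen w)
  have m1 : 𝓜.lik l t θ w ≤ 𝓜.maxLik l t θ w := le_max_left _ _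
  have m2 : 𝓜.lik (l - 1) t θ (coarsen w) ≤ 𝓜.maxLik l t θ w := le_max_right _ _
  have m3 : 𝓜.maxLik l t θ w ≤ c' := max_le a2 b2
  have m0 : 0 < 𝓜.maxLik l t θ w := hc.trans_le (a1.trans m1)
  exact ⟨⟨div_le_div₀ (hc.le.trans a1) a1 m0 m3, (div_le_one m0).2 m1⟩,
    ⟨div_le_div₀ (hc.le.trans b1) b1 m0 m3, (div_le_one m0).2 m2⟩⟩

theorem H₁_bounds (hcc : c ≤ c') (l : ℕ) (θ : Θ) (w : ℕ → ℝ) :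
    (c / c') ^ T ≤ 𝓜.H₁ T l θ w ∧ 𝓜.H₁ T l θ w ≤ 1 := by
  have h0 : 0 ≤ c / c' := div_nonneg hc.le (hc.le.trans hcc)
  have hb := fun t (ht : t ∈ Finset.range T) =>
    (ratio_bounds hc hlik (Finset.mem_range.1 ht) l θ w).1
  constructor
  · calc (c / c') ^ T = ∏ _t ∈ Finset.range T, c / c' := by simp [div_pow]
      _ ≤ _ := Finset.prod_le_prod (fun _ _ => h0) fun t ht => (hb t ht).1
  · exact Finset.prod_le_one (fun t ht => h0.trans (hb t ht).1) fun t ht => (hb t ht).2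

theorem H₂_bounds (hcc : c ≤ c') (l : ℕ) (θ : Θ) (w : ℕ → ℝ) :
    (c / c') ^ T ≤ 𝓜.H₂ T l θ w ∧ 𝓜.H₂ T l θ w ≤ 1 := by
  have h0 : 0 ≤ c / c' := div_nonneg hc.le (hc.le.trans hcc)
  have hb := fun t (ht : t ∈ Finset.range T) =>
    (ratio_bounds hc hlik (Finset.mem_range.1 ht) l θ w).2
  constructor
  · calc (c / c') ^ T = ∏ _t ∈ Finset.range T, c / c' := by simp [div_pow]
      _ ≤ _ := Finset.prod_le_prod (fun _ _ => h0) fun t ht => (hb t ht).1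
  · exact Finset.prod_le_one (fun t ht => h0.trans (hb t ht).1) fun t ht => (hb t ht).2

/-- The factors of `H₁` and `H₂` lie in `[0, 1]` and share the denominator `maxLik ≥ c`. Telescoping
the products therefore leaves differences of likelihoods divided by `c`. -/
theorem sq_H₁_sub_H₂_le (hcc : c ≤ c') (l : ℕ) (θ : Θ) (w : ℕ → ℝ) :
    (𝓜.H₁ T l θ w - 𝓜.H₂ T l θ w) ^ 2 ≤ T / c ^ 2 *
      ∑ t ∈ Finset.range T, (𝓜.lik l t θ w - 𝓜.lik (l - 1) t θ (coarsen w)) ^ 2 := by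
  have h0 : 0 ≤ c / c' := div_nonneg hc.le (hc.le.trans hcc)
  have h1 : |𝓜.H₁ T l θ w - 𝓜.H₂ T l θ w| ≤
      ∑ t ∈ Finset.range T, |𝓜.lik l t θ w - 𝓜.lik (l - 1) t θ (coarsen w)| / c := by
    refine (abs_prod_sub_prod_le T (fun t ht => ?_) fun t ht => ?_).trans
      (Finset.sum_le_sum fun t ht => ?_)
    · have := (ratio_bounds hc hlik ht l θ w).1
      exact ⟨h0.trans this.1, this.2⟩
    · have := (ratio_bounds hc hlik ht l θ w).2
      exact ⟨h0.trans this.1, this.2⟩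
    · have m : c ≤ 𝓜.maxLik l t θ w :=
        (hlik t (Finset.mem_range.1 ht) l θ w).1.trans (le_max_left _ _)
      rw [← sub_div, abs_div, abs_of_pos (hc.trans_le m)]
      gcongr
  have h2 := pow_le_pow_left₀ (abs_nonneg _) h1 2
  rw [sq_abs] at h2
  refine h2.trans (sq_sum_le_card_mul_sum_sq.trans (le_of_eq ?_))
  rw [Finset.card_range, Finset.mul_sum, Finset.mul_sum]
  refine Finset.sum_congr rfl fun t _ => ?_
  rw [div_pow, sq_abs]; ring

end Bounds

theorem _root_.VolterraMCMC.IsBoundedLipschitz.sq_sub_le {φ : Θ → (Fin T → ℝ) → ℝ} {L : ℝ}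
    (hL : ∀ (θ θ' : Θ) (v v' : Fin T → ℝ),
      |φ θ v - φ θ' v'| ≤ L * (∑ i, |θ.1 i - θ'.1 i| + ∑ t, |v t - v' t|))
    (θ : Θ) (v v' : Fin T → ℝ) :
    (φ θ v - φ θ v') ^ 2 ≤ L ^ 2 * T * ∑ t, (v t - v' t) ^ 2 := by
  have h := hL θ θ v v'
  simp only [sub_self, abs_zero, Finset.sum_const_zero, zero_add] at h
  have h2 := pow_le_pow_left₀ (abs_nonneg _) h 2
  rw [sq_abs, mul_pow] at h2
  refine h2.trans ?_
  rw [mul_assoc]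
  refine mul_le_mul_of_nonneg_left ?_ (sq_nonneg L)
  refine sq_sum_le_card_mul_sum_sq.trans (le_of_eq ?_)
  rw [Finset.card_univ, Fintype.card_fin]
  simp_rw [sq_abs]

variable {Ω : Type*} {mΩ : MeasurableSpace Ω} {P : Measure Ω} [IsProbabilityMeasure P]
  {ℱ : Filtration ℝ≥0 mΩ} {W : ℝ≥0 → Ω → ℝ} {V : Θ → ℝ≥0 → Ω → ℝ}

theorem exists_integral_sq_H_sub_le (hβ₀ : 0 < β) (hβ₁ : β < 1) (h𝓜 : 𝓜.IsRegular T β)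
    (hW : IsBrownianWrt P ℱ W) (hVm : ∀ θ t, Measurable (V θ t)) (hA1 : 𝓜.A1)
    (hA2 : 𝓜.A2 P W V T β) :
    ∃ C : ℝ, 0 ≤ C ∧ ∀ (l : ℕ) (θ : Θ),
      ∫ ω, (𝓜.H₁ T (l + 1) θ (incr W (l + 1) ω) - 𝓜.H₂ T (l + 1) θ (incr W (l + 1) ω)) ^ 2 ∂P ≤
        C * (step (l + 1) : ℝ) ^ (2 * β) := by
  obtain ⟨c, c', hc, hcc, hlik⟩ := hA1.exists_lik_bounds T
  -- A constant is supplied for every natural `t`, with a dummy beyond the horizon, so that `choose`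
  -- yields a plain sequence.
  have hex : ∀ t : ℕ, ∃ C : ℝ, 0 ≤ C ∧ (t < T → ∀ (l : ℕ) (θ : Θ),
      ∫ ω, (𝓜.lik (l + 1) t θ (incr W (l + 1) ω) - 𝓜.lik l t θ (incr W l ω)) ^ 2 ∂P ≤
        C * (step (l + 1) : ℝ) ^ (2 * β)) := fun t => by
    by_cases ht : t < T
    · obtain ⟨C, h0, h1⟩ := exists_integral_sq_lik_sub_le hβ₀ hβ₁ h𝓜 hW hVm hA1 hA2 t ht
      exact ⟨C, h0, fun _ => h1⟩
    · exact ⟨0, le_rfl, fun h => absurd h ht⟩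
  choose C hC0 hC using hex
  refine ⟨T / c ^ 2 * ∑ t ∈ Finset.range T, C t,
    mul_nonneg (by positivity) (Finset.sum_nonneg fun t _ => hC0 t), fun l θ => ?_⟩
  have hm : ∀ l t, Measurable fun ω => 𝓜.lik l t θ (incr W l ω) := fun l t =>
    (h𝓜.measurable_lik hA1 l t).comp (measurable_const.prodMk (hW.measurable_incr l))
  have hi : ∀ t ∈ Finset.range T, Integrable (fun ω =>
      (𝓜.lik (l + 1) t θ (incr W (l + 1) ω) - 𝓜.lik l t θ (incr W l ω)) ^ 2) P := fun t ht => by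
    have ht' := Finset.mem_range.1 ht
    refine MemLp.integrable_sq (memLp_of_abs_le (c := c')
      ((hm (l + 1) t).sub (hm l t)) fun ω => ?_)
    have h1 := hlik t ht' (l + 1) θ (incr W (l + 1) ω)
    have h2 := hlik t ht' l θ (incr W l ω)
    change |𝓜.lik (l + 1) t θ (incr W (l + 1) ω) - 𝓜.lik l t θ (incr W l ω)| ≤ c'
    rw [abs_le]; constructor <;> linarith
  refine (integral_mono_of_nonneg (ae_of_all _ fun ω => sq_nonneg _)
    ((integrable_finsetSum _ hi).const_mul (T / c ^ 2)) (ae_of_all _ fun ω => ?_)).trans ?_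
  · have := sq_H₁_sub_H₂_le hc hlik hcc (l + 1) θ (incr W (l + 1) ω)
    rwa [Nat.add_sub_cancel, coarsen_incr] at this
  · rw [integral_const_mul, integral_finsetSum _ hi, mul_assoc, Finset.sum_mul]
    refine mul_le_mul_of_nonneg_left (Finset.sum_le_sum fun t ht => ?_) (by positivity)
    exact hC t (Finset.mem_range.1 ht) l θ

/-- With test function values `a`, `b` and correction factors `x`, `y`, one has `a x - b y = (a - b)
x + b (x - y)`. The first part is small since `φ` is Lipschitz and `x ≤ 1`, the second since `φ` is
bounded. -/
theorem exists_integral_sq_mul_H_sub_le (hβ₀ : 0 < β) (hβ₁ : β < 1) (h𝓜 : 𝓜.IsRegular T β)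
    (hW : IsBrownianWrt P ℱ W) (hVm : ∀ θ t, Measurable (V θ t)) (hA1 : 𝓜.A1)
    (hA2 : 𝓜.A2 P W V T β) {φ : Θ → (Fin T → ℝ) → ℝ} (hφ : IsBoundedLipschitz φ) :
    ∃ C : ℝ, 0 ≤ C ∧ ∀ (l : ℕ) (θ : Θ),
      ∫ ω, (φ θ (𝓜.skeleton T (l + 1) θ (incr W (l + 1) ω)) *
          𝓜.H₁ T (l + 1) θ (incr W (l + 1) ω) -
        φ θ (𝓜.skeleton T l θ (incr W l ω)) * 𝓜.H₂ T (l + 1) θ (incr W (l + 1) ω)) ^ 2 ∂P ≤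
        C * (step (l + 1) : ℝ) ^ (2 * β) := by
  obtain ⟨c, c', hc, hcc, hlik⟩ := hA1.exists_lik_bounds T
  obtain ⟨B, hB⟩ := hφ.bdd
  obtain ⟨L, hL⟩ := hφ.lip
  obtain ⟨C₁, hC₁0, hC₁⟩ := exists_integral_sq_H_sub_le hβ₀ hβ₁ h𝓜 hW hVm hA1 hA2
  obtain ⟨C₂, hC₂0, hC₂⟩ := exists_integral_sq_vol_sub_le hβ₀ hβ₁ h𝓜 hW hVm hA2
  refine ⟨2 * (L ^ 2 * T * (T * C₂)) + 2 * (B ^ 2 * C₁), by positivity, fun l θ => ?_⟩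
  have h0 : 0 ≤ (c / c') ^ T := pow_nonneg (div_nonneg hc.le (hc.le.trans hcc)) T
  have hHm : Measurable fun ω => 𝓜.H₁ T (l + 1) θ (incr W (l + 1) ω) -
      𝓜.H₂ T (l + 1) θ (incr W (l + 1) ω) := by
    have hm : Measurable fun ω => (θ, incr W (l + 1) ω) :=
      measurable_const.prodMk (hW.measurable_incr (l + 1))
    exact (Finset.measurable_prod _ fun t _ => ((h𝓜.measurable_lik hA1 (l + 1) t).comp hm).div
      ((h𝓜.measurable_maxLik hA1 (l + 1) t).comp hm)).sub
      (Finset.measurable_prod _ fun t _ => ((h𝓜.measurable_coarse_lik hA1 l t).comp hm).div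
      ((h𝓜.measurable_maxLik hA1 (l + 1) t).comp hm))
  have hHi : Integrable (fun ω => (𝓜.H₁ T (l + 1) θ (incr W (l + 1) ω) -
      𝓜.H₂ T (l + 1) θ (incr W (l + 1) ω)) ^ 2) P := by
    refine MemLp.integrable_sq (memLp_of_abs_le (c := 1) hHm fun ω => ?_)
    have h1 := H₁_bounds hc hlik hcc (l + 1) θ (incr W (l + 1) ω)
    have h2 := H₂_bounds hc hlik hcc (l + 1) θ (incr W (l + 1) ω)
    rw [abs_le]; constructor <;> linarith
  have hSi : ∀ t ∈ (Finset.univ : Finset (Fin T)), Integrable (fun ω =>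
      (𝓜.skeleton T (l + 1) θ (incr W (l + 1) ω) t -
        𝓜.skeleton T l θ (incr W l ω) t) ^ 2) P := fun t _ =>
    MemLp.integrable_sq ((h𝓜.measurable_memLp_vol hW _ θ _).2.sub
      (h𝓜.measurable_memLp_vol hW _ θ _).2)
  have hS : ∀ t : Fin T, ∫ ω, (𝓜.skeleton T (l + 1) θ (incr W (l + 1) ω) t -
      𝓜.skeleton T l θ (incr W l ω) t) ^ 2 ∂P ≤ C₂ * (step (l + 1) : ℝ) ^ (2 * β) := fun t => by
    have h1 := hC₂ l θ ((t.1 + 1) * 2 ^ (l + 1)) (Nat.mul_le_mul_right _ t.2)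
    have e : (t.1 + 1) * 2 ^ (l + 1) / 2 = (t.1 + 1) * 2 ^ l := by
      rw [pow_succ, ← mul_assoc, Nat.mul_div_cancel _ two_pos]
    rw [e] at h1
    exact h1
  have I1 : Integrable (fun ω => 2 * (L ^ 2 * T * ∑ t, (𝓜.skeleton T (l + 1) θ
      (incr W (l + 1) ω) t - 𝓜.skeleton T l θ (incr W l ω) t) ^ 2)) P :=
    ((integrable_finsetSum _ hSi).const_mul _).const_mul _
  have I2 : Integrable (fun ω => 2 * (B ^ 2 * (𝓜.H₁ T (l + 1) θ (incr W (l + 1) ω) -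
      𝓜.H₂ T (l + 1) θ (incr W (l + 1) ω)) ^ 2)) P := (hHi.const_mul _).const_mul _
  refine (integral_mono_of_nonneg (ae_of_all _ fun ω => sq_nonneg _) (I1.add I2)
    (ae_of_all _ fun ω => ?_)).trans ?_
  · have h1 := H₁_bounds hc hlik hcc (l + 1) θ (incr W (l + 1) ω)
    have hb := hB θ (𝓜.skeleton T l θ (incr W l ω))
    have hl := IsBoundedLipschitz.sq_sub_le hL θ (𝓜.skeleton T (l + 1) θ (incr W (l + 1) ω))
      (𝓜.skeleton T l θ (incr W l ω))
    simp only [Pi.add_apply]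
    set a := φ θ (𝓜.skeleton T (l + 1) θ (incr W (l + 1) ω))
    set b := φ θ (𝓜.skeleton T l θ (incr W l ω))
    set x := 𝓜.H₁ T (l + 1) θ (incr W (l + 1) ω)
    set y := 𝓜.H₂ T (l + 1) θ (incr W (l + 1) ω)
    have hx : x ^ 2 ≤ 1 := pow_le_one₀ (h0.trans h1.1) h1.2
    have hb2 : b ^ 2 ≤ B ^ 2 := by
      rw [← sq_abs b]; exact pow_le_pow_left₀ (abs_nonneg _) hb 2
    have e : a * x - b * y = (a - b) * x + b * (x - y) := by ring
    have h2 := add_sq_le (a := (a - b) * x) (b := b * (x - y))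
    rw [← e, mul_pow, mul_pow] at h2
    have h3 : (a - b) ^ 2 * x ^ 2 ≤ (a - b) ^ 2 :=
      mul_le_of_le_one_right (sq_nonneg _) hx
    have h4 : b ^ 2 * (x - y) ^ 2 ≤ B ^ 2 * (x - y) ^ 2 :=
      mul_le_mul_of_nonneg_right hb2 (sq_nonneg _)
    linarith
  · rw [integral_add' I1 I2, integral_const_mul, integral_const_mul, integral_const_mul,
      integral_const_mul, integral_finsetSum _ hSi, add_mul]
    refine add_le_add ?_ ?_
    · rw [mul_assoc 2, mul_assoc (L ^ 2 * T)]
      refine mul_le_mul_of_nonneg_left (mul_le_mul_of_nonneg_left ?_ (by positivity)) two_pos.le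
      refine (Finset.sum_le_sum fun t _ => hS t).trans (le_of_eq ?_)
      rw [Finset.sum_const, Finset.card_univ, Fintype.card_fin, nsmul_eq_mul, mul_assoc]
    · rw [mul_assoc 2, mul_assoc (B ^ 2)]
      exact mul_le_mul_of_nonneg_left (mul_le_mul_of_nonneg_left (hC₁ l θ) (sq_nonneg B))
        two_pos.le

end Model

end VolterraMCMC

namespace VolterraMCMC

/-! ### Expectations under the posteriors and under the stationary law -/

theorem integral_normalized_withDensity {α : Type*} [MeasurableSpace α] {μ : Measure α}
    {G : α → ℝ} (hG : Measurable G) (hG0 : ∀ x, 0 ≤ G x) (f : α → ℝ) :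
    ∫ x, f x ∂((∫⁻ x, ENNReal.ofReal (G x) ∂μ)⁻¹ •
      μ.withDensity fun x => ENNReal.ofReal (G x)) = (∫ x, G x * f x ∂μ) / ∫ x, G x ∂μ := by
  rw [integral_smul_measure, integral_withDensity_eq_integral_toReal_smul hG.ennreal_ofReal
    (ae_of_all _ fun _ => ENNReal.ofReal_lt_top),
    integral_eq_lintegral_of_nonneg_ae (ae_of_all _ hG0) hG.aestronglyMeasurable,
    ENNReal.toReal_inv, smul_eq_mul, div_eq_inv_mul]
  simp_rw [ENNReal.toReal_ofReal (hG0 _), smul_eq_mul]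

/-- The filter and the posteriors are built from abstract Gaussian vectors, whereas (A2) concerns
one Brownian motion. This equality of laws connects the two. -/
theorem IsBrownianWrt.map_incr {Ω : Type*} {mΩ : MeasurableSpace Ω} {P : Measure Ω}
    [IsProbabilityMeasure P] {ℱ : Filtration ℝ≥0 mΩ} {W : ℝ≥0 → Ω → ℝ}
    (hW : IsBrownianWrt P ℱ W) (l n : ℕ) :
    P.map (fun ω (j : Fin n) => incr W l ω j) =
      Measure.pi fun _ : Fin n => gaussianReal 0 (step l) := by
  have h1 : iIndepFun (fun (j : ℕ) ω => incr W l ω j) P :=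
    hW.brownian.hasIndepIncrements.nat (t := fun j : ℕ => j * step l)
      fun i j hij => by simp only; gcongr
  have h2 : iIndepFun (fun (j : Fin n) ω => incr W l ω j) P := h1.precomp Fin.val_injective
  rw [(iIndepFun_iff_map_fun_eq_pi_map fun j : Fin n =>
    (hW.hasLaw_incr l j).aemeasurable).1 h2]
  congr 1
  funext j
  exact (hW.hasLaw_incr l j).map_eq

theorem IsBoundedLipschitz.measurable {d T : ℕ} {Θ : Set (Fin d → ℝ)} {φ : Θ → (Fin T → ℝ) → ℝ}
    (hφ : IsBoundedLipschitz φ) : Measurable (Function.uncurry φ) := by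
  obtain ⟨L, hL⟩ := hφ.lip
  have hcont : Continuous (Function.uncurry φ) := by
    refine continuous_iff_continuousAt.2 fun p => tendsto_iff_dist_tendsto_zero.2 ?_
    have h : Tendsto (fun p' : Θ × (Fin T → ℝ) =>
        L * (∑ i, |p'.1.1 i - p.1.1 i| + ∑ t, |p'.2 t - p.2 t|)) (𝓝 p) (𝓝 0) := by
      have hc : Continuous fun p' : Θ × (Fin T → ℝ) =>
        L * (∑ i, |p'.1.1 i - p.1.1 i| + ∑ t, |p'.2 t - p.2 t|) :=
        continuous_const.mul ((continuous_finsetSum _ fun i _ =>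
          (((continuous_apply i).comp (continuous_subtype_val.comp continuous_fst)).sub
            continuous_const).abs).add (continuous_finsetSum _ fun t _ =>
          (((continuous_apply t).comp continuous_snd).sub continuous_const).abs))
      have := hc.tendsto p
      simpa using this
    exact squeeze_zero (fun _ => dist_nonneg) (fun p' => hL _ _ _ _) h
  exact hcont.measurable

namespace Model

variable {d : ℕ} {Θ : Set (Fin d → ℝ)} {Y : Type*} {𝓜 : Model Θ Y} {T N : ℕ} {β : ℝ}

/-- The prior law of the parameter. -/
noncomputable def priorLaw (𝓜 : Model Θ Y) : Measure Θ :=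
  𝓜.dθ.withDensity fun θ => (𝓜.prior θ : ℝ≥0∞)

/-- A function of the parameter and of a sequence of increments that depends on the first `n`
increments only. -/
def DependsOnFirst (n : ℕ) (G : Θ × (ℕ → ℝ) → ℝ) : Prop :=
  ∀ (θ : Θ) (w w' : ℕ → ℝ), (∀ j < n, w j = w' j) → G (θ, w) = G (θ, w')

/-- The discretized likelihood at level `l`. -/
noncomputable def likProd (𝓜 : Model Θ Y) (T l : ℕ) (p : Θ × (ℕ → ℝ)) : ℝ :=
  ∏ t ∈ Finset.range T, 𝓜.lik l t p.1 p.2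

theorem dependsOnFirst_likProd (T l : ℕ) : DependsOnFirst (T * 2 ^ l) (𝓜.likProd T l) :=
  fun θ _ _ h => Finset.prod_congr rfl fun _ ht =>
    lik_congr l _ θ fun j hj => h j (index_lt (Finset.mem_range.1 ht) hj)

theorem dependsOnFirst_maxLik (T l : ℕ) : DependsOnFirst (T * 2 ^ (l + 1))
    fun p : Θ × (ℕ → ℝ) => ∏ t ∈ Finset.range T, 𝓜.maxLik (l + 1) t p.1 p.2 :=
  fun θ _ _ h => Finset.prod_congr rfl fun _ ht =>
    maxLik_congr l _ θ fun j hj => h j (index_lt (Finset.mem_range.1 ht) hj)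

theorem dependsOnFirst_H₁ (T l : ℕ) : DependsOnFirst (T * 2 ^ (l + 1))
    fun p : Θ × (ℕ → ℝ) => 𝓜.H₁ T (l + 1) p.1 p.2 :=
  fun θ _ _ h => Finset.prod_congr rfl fun _ ht => by
    have h' := fun j hj => h j (index_lt (Finset.mem_range.1 ht) hj)
    rw [lik_congr (l + 1) _ θ h', maxLik_congr l _ θ h']

theorem dependsOnFirst_H₂ (T l : ℕ) : DependsOnFirst (T * 2 ^ (l + 1))
    fun p : Θ × (ℕ → ℝ) => 𝓜.H₂ T (l + 1) p.1 p.2 :=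
  fun θ _ _ h => Finset.prod_congr rfl fun _ ht => by
    have h' := fun j hj => h j (index_lt (Finset.mem_range.1 ht) hj)
    rw [Nat.add_sub_cancel, coarse_lik_congr l _ θ h', maxLik_congr l _ θ h']

theorem dependsOnFirst_skeleton (T l : ℕ) (φ : Θ → (Fin T → ℝ) → ℝ) :
    DependsOnFirst (T * 2 ^ l) fun p : Θ × (ℕ → ℝ) => φ p.1 (𝓜.skeleton T l p.1 p.2) :=
  fun θ w w' h => by
    simp only
    rw [skeleton_congr θ h]

theorem dependsOnFirst_coarse_skeleton (T l : ℕ) (φ : Θ → (Fin T → ℝ) → ℝ) :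
    DependsOnFirst (T * 2 ^ (l + 1))
      fun p : Θ × (ℕ → ℝ) => φ p.1 (𝓜.skeleton T l p.1 (coarsen p.2)) :=
  fun θ w w' h => by
    simp only
    rw [coarse_skeleton_congr θ h]

theorem DependsOnFirst.mul {n : ℕ} {G H : Θ × (ℕ → ℝ) → ℝ} (hG : DependsOnFirst n G)
    (hH : DependsOnFirst n H) : DependsOnFirst n fun p => G p * H p :=
  fun θ w w' h => by simp only; rw [hG θ w w' h, hH θ w w' h]

theorem DependsOnFirst.sub_sq {n : ℕ} {G H : Θ × (ℕ → ℝ) → ℝ} (hG : DependsOnFirst n G)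
    (hH : DependsOnFirst n H) : DependsOnFirst n fun p => (G p - H p) ^ 2 :=
  fun θ w w' h => by simp only; rw [hG θ w w' h, hH θ w w' h]

theorem DependsOnFirst.extend_eq {n : ℕ} {G : Θ × (ℕ → ℝ) → ℝ} (hG : DependsOnFirst n G) (θ : Θ)
    (w : ℕ → ℝ) : G (θ, extend fun j : Fin n => w j) = G (θ, w) :=
  hG θ _ _ fun j hj => by simp [extend, hj]

theorem IsRegular.measurable_likProd (h𝓜 : 𝓜.IsRegular T β) (hA1 : 𝓜.A1) (l : ℕ) :
    Measurable (𝓜.likProd T l) :=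
  Finset.measurable_prod _ fun t _ => h𝓜.measurable_lik hA1 l t

theorem IsRegular.measurable_prod_maxLik (h𝓜 : 𝓜.IsRegular T β) (hA1 : 𝓜.A1) (l : ℕ) :
    Measurable fun p : Θ × (ℕ → ℝ) => ∏ t ∈ Finset.range T, 𝓜.maxLik l t p.1 p.2 :=
  Finset.measurable_prod _ fun t _ => h𝓜.measurable_maxLik hA1 l t

theorem IsRegular.measurable_H₁ (h𝓜 : 𝓜.IsRegular T β) (hA1 : 𝓜.A1) (l : ℕ) :
    Measurable fun p : Θ × (ℕ → ℝ) => 𝓜.H₁ T l p.1 p.2 :=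
  Finset.measurable_prod _ fun t _ =>
    (h𝓜.measurable_lik hA1 l t).div (h𝓜.measurable_maxLik hA1 l t)

theorem IsRegular.measurable_H₂ (h𝓜 : 𝓜.IsRegular T β) (hA1 : 𝓜.A1) (l : ℕ) :
    Measurable fun p : Θ × (ℕ → ℝ) => 𝓜.H₂ T l p.1 p.2 :=
  Finset.measurable_prod _ fun t _ =>
    (h𝓜.measurable_coarse_lik hA1 (l - 1) t).div (h𝓜.measurable_maxLik hA1 l t)

theorem IsRegular.measurable_phi (h𝓜 : 𝓜.IsRegular T β) {φ : Θ → (Fin T → ℝ) → ℝ}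
    (hφ : IsBoundedLipschitz φ) (l : ℕ) :
    Measurable fun p : Θ × (ℕ → ℝ) => φ p.1 (𝓜.skeleton T l p.1 p.2) :=
  hφ.measurable.comp (measurable_fst.prodMk (h𝓜.measurable_skeleton l))

theorem IsRegular.measurable_coarse_phi (h𝓜 : 𝓜.IsRegular T β) {φ : Θ → (Fin T → ℝ) → ℝ}
    (hφ : IsBoundedLipschitz φ) (l : ℕ) :
    Measurable fun p : Θ × (ℕ → ℝ) => φ p.1 (𝓜.skeleton T l p.1 (coarsen p.2)) :=
  (h𝓜.measurable_phi hφ l).comp (measurable_fst.prodMk (measurable_coarsen.comp measurable_snd))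

section Brownian

variable {Ω : Type*} {mΩ : MeasurableSpace Ω} {P : Measure Ω} [IsProbabilityMeasure P]
  {ℱ : Filtration ℝ≥0 mΩ} {W : ℝ≥0 → Ω → ℝ}

/-- All expectations are moved to the product of the prior law with `P`. There fine and coarse
increments come from the same `W`, and the strong rates are available for every fixed `θ`. -/
theorem integral_baseLaw (h𝓜 : 𝓜.IsRegular T β) (hW : IsBrownianWrt P ℱ W) {l : ℕ}
    {G : Θ × (ℕ → ℝ) → ℝ} (hG : Measurable G) (hGd : DependsOnFirst (T * 2 ^ l) G) :
    ∫ p, G (p.1, extend p.2) ∂(𝓜.baseLaw T l) =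
      ∫ p, G (p.1, incr W l p.2) ∂(𝓜.priorLaw.prod P) := by
  have : IsProbabilityMeasure 𝓜.priorLaw := h𝓜.isProbabilityMeasure_prior
  have hm : Measurable fun ω (j : Fin (T * 2 ^ l)) => incr W l ω j :=
    measurable_pi_lambda _ fun j => (measurable_pi_apply j.1).comp (hW.measurable_incr l)
  have e : 𝓜.baseLaw T l = (𝓜.priorLaw.prod P).map
      (Prod.map id fun ω (j : Fin (T * 2 ^ l)) => incr W l ω j) := by
    rw [← Measure.map_prod_map _ _ measurable_id hm, Measure.map_id, hW.map_incr]
    rfl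
  have hGm : Measurable fun p : Θ × (Fin (T * 2 ^ l) → ℝ) => G (p.1, extend p.2) :=
    hG.comp measurable_prodMap_extend
  rw [e, integral_map (measurable_id.prodMap hm).aemeasurable hGm.aestronglyMeasurable]
  exact integral_congr_ae (ae_of_all _ fun p => hGd.extend_eq p.1 (incr W l p.2))

theorem posteriorExp_eq (h𝓜 : 𝓜.IsRegular T β) (hA1 : 𝓜.A1) (hW : IsBrownianWrt P ℱ W) (l : ℕ)
    {φ : Θ → (Fin T → ℝ) → ℝ} (hφ : IsBoundedLipschitz φ) :
    𝓜.posteriorExp T l φ =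
      (∫ p, 𝓜.likProd T l (p.1, incr W l p.2) * φ p.1 (𝓜.skeleton T l p.1 (incr W l p.2))
        ∂(𝓜.priorLaw.prod P)) / ∫ p, 𝓜.likProd T l (p.1, incr W l p.2) ∂(𝓜.priorLaw.prod P) := by
  have hm : Measurable fun p : Θ × (Fin (T * 2 ^ l) → ℝ) => 𝓜.likProd T l (p.1, extend p.2) :=
    (h𝓜.measurable_likProd hA1 l).comp measurable_prodMap_extend
  have h0 : ∀ p : Θ × (Fin (T * 2 ^ l) → ℝ), 0 ≤ 𝓜.likProd T l (p.1, extend p.2) := fun p =>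
    Finset.prod_nonneg fun t _ => (hA1.lik_pos l t _ _).le
  have h := integral_normalized_withDensity (μ := 𝓜.baseLaw T l) hm h0
    fun p => φ p.1 (𝓜.skeleton T l p.1 (extend p.2))
  rw [integral_baseLaw h𝓜 hW (h𝓜.measurable_likProd hA1 l) (dependsOnFirst_likProd T l),
    integral_baseLaw (G := fun p => 𝓜.likProd T l p * φ p.1 (𝓜.skeleton T l p.1 p.2)) h𝓜 hW
      ((h𝓜.measurable_likProd hA1 l).mul (h𝓜.measurable_phi hφ l))
      ((dependsOnFirst_likProd T l).mul (dependsOnFirst_skeleton T l φ))] at h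
  rw [← h]
  have e : 𝓜.unnormPosterior T l Set.univ =
      ∫⁻ p, ENNReal.ofReal (𝓜.likProd T l (p.1, extend p.2)) ∂(𝓜.baseLaw T l) := by
    rw [unnormPosterior, withDensity_apply _ MeasurableSet.univ, Measure.restrict_univ]
    rfl
  rw [posteriorExp, posterior, e]
  rfl

theorem integral_output (h𝓜 : 𝓜.IsRegular T β) (hA1 : 𝓜.A1) (hW : IsBrownianWrt P ℱ W) {l : ℕ}
    {η : Measure (State Θ T N (l + 1))}
    (hη : η.map returned =
      (∫⁻ p, ENNReal.ofReal (𝓜.maxLikProd T (l + 1) p) ∂(𝓜.baseLaw T (l + 1)))⁻¹ •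
      (𝓜.baseLaw T (l + 1)).withDensity fun p => ENNReal.ofReal (𝓜.maxLikProd T (l + 1) p))
    {G : Θ × (ℕ → ℝ) → ℝ} (hG : Measurable G) (hGd : DependsOnFirst (T * 2 ^ (l + 1)) G) :
    ∫ x, G (x.1, output x.2) ∂η =
      (∫ p, (∏ t ∈ Finset.range T, 𝓜.maxLik (l + 1) t p.1 (incr W (l + 1) p.2)) *
        G (p.1, incr W (l + 1) p.2) ∂(𝓜.priorLaw.prod P)) /
      ∫ p, ∏ t ∈ Finset.range T, 𝓜.maxLik (l + 1) t p.1 (incr W (l + 1) p.2)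
        ∂(𝓜.priorLaw.prod P) := by
  have h := integral_normalized_withDensity (μ := 𝓜.baseLaw T (l + 1))
    (measurable_maxLikProd h𝓜 hA1)
    (fun p => Finset.prod_nonneg fun t _ => (hA1.maxLik_pos (l + 1) t _ _).le)
    fun p => G (p.1, extend p.2)
  have hGm : Measurable fun p : Θ × (Fin (T * 2 ^ (l + 1)) → ℝ) => G (p.1, extend p.2) :=
    hG.comp measurable_prodMap_extend
  rw [← hη, integral_map measurable_returned.aemeasurable hGm.aestronglyMeasurable] at h
  have e : ∀ x : State Θ T N (l + 1), G ((returned x).1, extend (returned x).2) =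
      G (x.1, output x.2) := fun x => hGd.extend_eq x.1 (output x.2)
  simp_rw [e] at h
  rw [h]
  congr 1
  · exact integral_baseLaw (G := fun p =>
      (∏ t ∈ Finset.range T, 𝓜.maxLik (l + 1) t p.1 p.2) * G p) h𝓜 hW
      ((h𝓜.measurable_prod_maxLik hA1 (l + 1)).mul hG) ((dependsOnFirst_maxLik T l).mul hGd)
  · exact integral_baseLaw h𝓜 hW (h𝓜.measurable_prod_maxLik hA1 (l + 1))
      (dependsOnFirst_maxLik T l)

end Brownian

end Model

end VolterraMCMC

/-! ### Stationary ratios as posterior expectations, and mean squares under the stationary law. -/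

namespace VolterraMCMC

namespace Model

variable {d : ℕ} {Θ : Set (Fin d → ℝ)} {Y : Type*} {𝓜 : Model Θ Y} {T N : ℕ} {β : ℝ}
  {Ω : Type*} {mΩ : MeasurableSpace Ω} {P : Measure Ω} [IsProbabilityMeasure P]
  {ℱ : Filtration ℝ≥0 mΩ} {W : ℝ≥0 → Ω → ℝ}

theorem prod_maxLik_bounds {c c' : ℝ} (hc : 0 < c)
    (hlik : ∀ t < T, ∀ l θ w, c ≤ 𝓜.lik l t θ w ∧ 𝓜.lik l t θ w ≤ c') (l : ℕ)
    (θ : Θ) (w : ℕ → ℝ) : c ^ T ≤ ∏ t ∈ Finset.range T, 𝓜.maxLik l t θ w ∧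
      ∏ t ∈ Finset.range T, 𝓜.maxLik l t θ w ≤ c' ^ T := by
  have h : ∀ t ∈ Finset.range T, c ≤ 𝓜.maxLik l t θ w ∧ 𝓜.maxLik l t θ w ≤ c' := fun t ht => by
    obtain ⟨a1, a2⟩ := hlik t (Finset.mem_range.1 ht) l θ w
    obtain ⟨b1, b2⟩ := hlik t (Finset.mem_range.1 ht) (l - 1) θ (coarsen w)
    exact ⟨a1.trans (le_max_left _ _), max_le a2 b2⟩
  constructor
  · simpa using Finset.prod_le_prod (f := fun _ => c) (fun _ _ => hc.le) fun t ht => (h t ht).1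
  · simpa using Finset.prod_le_prod (g := fun _ => c') (fun t ht => hc.le.trans (h t ht).1)
      fun t ht => (h t ht).2

theorem prod_maxLik_mul_H₁ (hA1 : 𝓜.A1) (l : ℕ) (θ : Θ) (w : ℕ → ℝ) :
    (∏ t ∈ Finset.range T, 𝓜.maxLik l t θ w) * 𝓜.H₁ T l θ w = 𝓜.likProd T l (θ, w) := by
  rw [H₁, ← Finset.prod_mul_distrib]
  exact Finset.prod_congr rfl fun t _ => mul_div_cancel₀ _ (hA1.maxLik_pos l t θ w).ne'

theorem prod_maxLik_mul_H₂ (hA1 : 𝓜.A1) (l : ℕ) (θ : Θ) (w : ℕ → ℝ) :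
    (∏ t ∈ Finset.range T, 𝓜.maxLik l t θ w) * 𝓜.H₂ T l θ w =
      𝓜.likProd T (l - 1) (θ, coarsen w) := by
  rw [H₂, ← Finset.prod_mul_distrib]
  exact Finset.prod_congr rfl fun t _ => mul_div_cancel₀ _ (hA1.maxLik_pos l t θ w).ne'

section Stationary

variable (h𝓜 : 𝓜.IsRegular T β) (hA1 : 𝓜.A1) (hW : IsBrownianWrt P ℱ W) {l : ℕ}
  {η : Measure (State Θ T N (l + 1))}
  (hη : η.map returned =
    (∫⁻ p, ENNReal.ofReal (𝓜.maxLikProd T (l + 1) p) ∂(𝓜.baseLaw T (l + 1)))⁻¹ •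
    (𝓜.baseLaw T (l + 1)).withDensity fun p => ENNReal.ofReal (𝓜.maxLikProd T (l + 1) p))
include h𝓜 hA1 hW

theorem pow_le_integral_prod_maxLik {c c' : ℝ} (hc : 0 < c)
    (hlik : ∀ t < T, ∀ l θ w, c ≤ 𝓜.lik l t θ w ∧ 𝓜.lik l t θ w ≤ c') :
    c ^ T ≤ ∫ p, ∏ t ∈ Finset.range T, 𝓜.maxLik (l + 1) t p.1 (incr W (l + 1) p.2)
        ∂(𝓜.priorLaw.prod P) := by
  have : IsProbabilityMeasure 𝓜.priorLaw := h𝓜.isProbabilityMeasure_prior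
  have hm₀ : Measurable fun p : Θ × Ω => (p.1, incr W (l + 1) p.2) :=
    measurable_fst.prodMk ((hW.measurable_incr _).comp measurable_snd)
  have hm := (h𝓜.measurable_prod_maxLik hA1 (l + 1)).comp hm₀
  simp only [Function.comp_def] at hm
  have hb := fun p : Θ × Ω => prod_maxLik_bounds hc hlik (l + 1) p.1 (incr W (l + 1) p.2)
  have hi := integrable_of_abs_le (μ := 𝓜.priorLaw.prod P) hm (c := c' ^ T) fun p => by
    rw [abs_of_nonneg ((pow_nonneg hc.le T).trans (hb p).1)]
    exact (hb p).2
  calc c ^ T = ∫ _p, c ^ T ∂(𝓜.priorLaw.prod P) := by simp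
    _ ≤ _ := integral_mono (integrable_const _) hi fun p => (hb p).1

include hη

/-- Multiplying the stationary density by `H₁` turns the product of maxima into the fine likelihood.
The normalizing constant is common to numerator and denominator and cancels. -/
theorem posteriorExp_fine_eq {φ : Θ → (Fin T → ℝ) → ℝ} (hφ : IsBoundedLipschitz φ) :
    (∫ x, φ x.1 (𝓜.skeleton T (l + 1) x.1 (output x.2)) * 𝓜.H₁ T (l + 1) x.1 (output x.2) ∂η) /
      (∫ x, 𝓜.H₁ T (l + 1) x.1 (output x.2) ∂η) = 𝓜.posteriorExp T (l + 1) φ := by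
  obtain ⟨c, c', hc, hcc, hlik⟩ := hA1.exists_lik_bounds T
  have hZ := (pow_pos hc T).trans_le
    (pow_le_integral_prod_maxLik h𝓜 hA1 hW (l := l) hc hlik)
  have h1 := integral_output h𝓜 hA1 hW hη
    ((h𝓜.measurable_phi hφ (l + 1)).mul (h𝓜.measurable_H₁ hA1 (l + 1)))
    ((dependsOnFirst_skeleton T (l + 1) φ).mul (dependsOnFirst_H₁ T l))
  have h2 := integral_output h𝓜 hA1 hW hη (h𝓜.measurable_H₁ hA1 (l + 1))
    (dependsOnFirst_H₁ T l)
  simp only [Pi.mul_apply] at h1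
  rw [h1, h2, div_div_div_cancel_right₀ hZ.ne', posteriorExp_eq h𝓜 hA1 hW (l + 1) hφ]
  congr 1
  · refine integral_congr_ae (ae_of_all _ fun p => ?_)
    simp only
    rw [mul_left_comm, prod_maxLik_mul_H₁ hA1, mul_comm]
  · refine integral_congr_ae (ae_of_all _ fun p => ?_)
    exact prod_maxLik_mul_H₁ hA1 _ _ _

/-- Multiplication by `H₂` leaves the coarse likelihood of coarsened increments. Along Brownian
increments `coarsen_incr` identifies these with the increments of the coarser grid, so the ratio is
the posterior expectation one level below. -/
theorem posteriorExp_coarse_eq {φ : Θ → (Fin T → ℝ) → ℝ} (hφ : IsBoundedLipschitz φ) :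
    (∫ x, φ x.1 (𝓜.skeleton T l x.1 (coarsen (output x.2))) *
        𝓜.H₂ T (l + 1) x.1 (output x.2) ∂η) /
      (∫ x, 𝓜.H₂ T (l + 1) x.1 (output x.2) ∂η) = 𝓜.posteriorExp T l φ := by
  obtain ⟨c, c', hc, hcc, hlik⟩ := hA1.exists_lik_bounds T
  have hZ := (pow_pos hc T).trans_le
    (pow_le_integral_prod_maxLik h𝓜 hA1 hW (l := l) hc hlik)
  have h1 := integral_output h𝓜 hA1 hW hη
    ((h𝓜.measurable_coarse_phi hφ l).mul (h𝓜.measurable_H₂ hA1 (l + 1)))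
    ((dependsOnFirst_coarse_skeleton T l φ).mul (dependsOnFirst_H₂ T l))
  have h2 := integral_output h𝓜 hA1 hW hη (h𝓜.measurable_H₂ hA1 (l + 1))
    (dependsOnFirst_H₂ T l)
  simp only [Pi.mul_apply] at h1
  rw [h1, h2, div_div_div_cancel_right₀ hZ.ne', posteriorExp_eq h𝓜 hA1 hW l hφ]
  congr 1
  · refine integral_congr_ae (ae_of_all _ fun p => ?_)
    simp only
    rw [mul_left_comm, prod_maxLik_mul_H₂ hA1, mul_comm, coarsen_incr, Nat.add_sub_cancel]
  · refine integral_congr_ae (ae_of_all _ fun p => ?_)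
    simp only
    rw [prod_maxLik_mul_H₂ hA1, coarsen_incr, Nat.add_sub_cancel]

/-- On the returned trajectory the stationary law has density at most `(c'/c)^T` with respect to the
prior law. A mean square bound uniform in `θ` under `P` therefore carries over with this factor,
independent of the level. -/
theorem integral_sq_output_le {c c' : ℝ} (hc : 0 < c) (hcc : c ≤ c')
    (hlik : ∀ t < T, ∀ l θ w, c ≤ 𝓜.lik l t θ w ∧ 𝓜.lik l t θ w ≤ c')
    {F G : Θ × (ℕ → ℝ) → ℝ} (hF : Measurable F) (hG : Measurable G)
    (hFd : DependsOnFirst (T * 2 ^ (l + 1)) F) (hGd : DependsOnFirst (T * 2 ^ (l + 1)) G)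
    {B : ℝ} (hFB : ∀ p, |F p| ≤ B) (hGB : ∀ p, |G p| ≤ B) {E : ℝ}
    (hE : ∀ θ, ∫ ω, (F (θ, incr W (l + 1) ω) - G (θ, incr W (l + 1) ω)) ^ 2 ∂P ≤ E) :
    ∫ x, (F (x.1, output x.2) - G (x.1, output x.2)) ^ 2 ∂η ≤ (c' / c) ^ T * E := by
  have : IsProbabilityMeasure 𝓜.priorLaw := h𝓜.isProbabilityMeasure_prior
  have hm : Measurable fun p : Θ × Ω => (p.1, incr W (l + 1) p.2) :=
    measurable_fst.prodMk ((hW.measurable_incr _).comp measurable_snd)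
  have hD : Measurable fun p : Θ × Ω =>
      F (p.1, incr W (l + 1) p.2) - G (p.1, incr W (l + 1) p.2) :=
    (hF.comp hm).sub (hG.comp hm)
  have hDi : Integrable (fun p : Θ × Ω =>
      (F (p.1, incr W (l + 1) p.2) - G (p.1, incr W (l + 1) p.2)) ^ 2) (𝓜.priorLaw.prod P) := by
    refine MemLp.integrable_sq (memLp_of_abs_le hD (c := 2 * B) fun p => ?_)
    have h1 := hFB (p.1, incr W (l + 1) p.2)
    have h2 := hGB (p.1, incr W (l + 1) p.2)
    exact (abs_sub _ _).trans (by linarith)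
  have hb := fun p : Θ × Ω => prod_maxLik_bounds hc hlik (l + 1) p.1 (incr W (l + 1) p.2)
  have h1 : ∫ p, (F (p.1, incr W (l + 1) p.2) - G (p.1, incr W (l + 1) p.2)) ^ 2
      ∂(𝓜.priorLaw.prod P) ≤ E := by
    rw [integral_prod _ hDi]
    calc _ ≤ ∫ _θ, E ∂𝓜.priorLaw :=
          integral_mono hDi.integral_prod_left (integrable_const _) hE
      _ = E := by simp
  have hE0 : 0 ≤ E := (integral_nonneg fun _ => sq_nonneg _).trans h1
  have h2 : ∫ p, (∏ t ∈ Finset.range T, 𝓜.maxLik (l + 1) t p.1 (incr W (l + 1) p.2)) *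
      (F (p.1, incr W (l + 1) p.2) - G (p.1, incr W (l + 1) p.2)) ^ 2 ∂(𝓜.priorLaw.prod P) ≤
      c' ^ T * E := by
    refine (integral_mono_of_nonneg (ae_of_all _ fun p =>
      mul_nonneg ((pow_nonneg hc.le T).trans (hb p).1) (sq_nonneg _)) (hDi.const_mul (c' ^ T))
      (ae_of_all _ fun p => mul_le_mul_of_nonneg_right (hb p).2 (sq_nonneg _))).trans ?_
    rw [integral_const_mul]
    exact mul_le_mul_of_nonneg_left h1 (pow_nonneg (hc.le.trans hcc) T)
  have h3 := pow_le_integral_prod_maxLik h𝓜 hA1 hW (l := l) hc hlik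
  rw [integral_output (G := fun p => (F p - G p) ^ 2) h𝓜 hA1 hW hη ((hF.sub hG).pow_const 2)
    (hFd.sub_sq hGd), div_pow,
    div_mul_eq_mul_div]
  exact div_le_div₀ (mul_nonneg (pow_nonneg (hc.le.trans hcc) T) hE0) h2 (pow_pos hc T) h3

end Stationary

end Model

end VolterraMCMC

/-! ### Combination of the bias bound with the strong rates. -/

namespace VolterraMCMC

namespace Model

variable {d : ℕ} {Θ : Set (Fin d → ℝ)} {Y : Type*} {𝓜 : Model Θ Y} {T N : ℕ} {β : ℝ}

/-- `transition` is a bare family of measures; its Metropolis–Hastings form supplies measurability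
in the starting state and total mass one. -/
theorem exists_transitionKernel (h𝓜 : 𝓜.IsRegular T β) (hA1 : 𝓜.A1) (hT : 1 ≤ T) (hN : 1 ≤ N)
    {q : Θ → Θ → ℝ≥0} (hq : IsProposal 𝓜.dθ q) (l : ℕ) :
    ∃ κ : Kernel (State Θ T N l) (State Θ T N l), IsMarkovKernel κ ∧
      ∀ x, κ x = 𝓜.transition q x := by
  have := h𝓜.sigmaFinite
  exact ⟨mhKernel _ (measurable_acceptedDensity h𝓜 hA1 hq),
    isMarkovKernel_mhKernel _ fun x => lintegral_acceptedDensity_le h𝓜 hA1 hT hN hq x,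
    fun x => (transition_eq h𝓜 hA1 hq x).symm⟩

theorem estimator_eq {l : ℕ} (φ : Θ → (Fin T → ℝ) → ℝ) (m : ℕ) {Ω : Type*}
    (X : ℕ → Ω → State Θ T N (l + 1)) (ω : Ω) :
    𝓜.estimator φ m (fun k => X k ω) =
      chainAvg X m (fun x => φ x.1 (𝓜.skeleton T (l + 1) x.1 (output x.2)) *
          𝓜.H₁ T (l + 1) x.1 (output x.2)) ω /
        chainAvg X m (fun x => 𝓜.H₁ T (l + 1) x.1 (output x.2)) ω -
      chainAvg X m (fun x => φ x.1 (𝓜.skeleton T l x.1 (coarsen (output x.2))) *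
          𝓜.H₂ T (l + 1) x.1 (output x.2)) ω /
        chainAvg X m (fun x => 𝓜.H₂ T (l + 1) x.1 (output x.2)) ω := rfl

end Model

end VolterraMCMC

open VolterraMCMC VolterraMCMC.Model in
theorem proposition2 {d T N : ℕ} (hT : 1 ≤ T) (hN : 1 ≤ N) {Θ : Set (Fin d → ℝ)} {Y : Type*}
    (𝓜 : VolterraMCMC.Model Θ Y) (β : ℝ) (hβ₀ : 0 < β) (hβ₁ : β < 1)
    (h𝓜 : 𝓜.IsRegular T β)
    (q : ℕ → Θ → Θ → ℝ≥0) (hq : ∀ l, VolterraMCMC.IsProposal 𝓜.dθ (q l))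
    {Ω : Type*} {mΩ : MeasurableSpace Ω} (P : Measure Ω) [IsProbabilityMeasure P]
    (ℱ : Filtration ℝ≥0 mΩ) (W : ℝ≥0 → Ω → ℝ) (hW : VolterraMCMC.IsBrownianWrt P ℱ W)
    (V : Θ → ℝ≥0 → Ω → ℝ)
    (hV : ∀ θ, VolterraMCMC.IsVolterraSolution P ℱ W T 𝓜.K (𝓜.b θ) (𝓜.σ θ) 𝓜.v₀ (V θ))
    (hA1 : 𝓜.A1) (hA2 : 𝓜.A2 P W V T β)
    (η : ∀ l : ℕ, Measure (VolterraMCMC.State Θ T N l)) (hA3 : 𝓜.A3 q η)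
    {Ω' : Type*} {mΩ' : MeasurableSpace Ω'} (P' : Measure Ω') [IsProbabilityMeasure P']
    (X : ∀ l : ℕ, ℕ → Ω' → VolterraMCMC.State Θ T N l)
    (hX : ∀ l, 1 ≤ l → VolterraMCMC.IsMarkovChain P' (η l) (𝓜.transition (q l)) (X l))
    (φ : Θ → (Fin T → ℝ) → ℝ) (hφ : VolterraMCMC.IsBoundedLipschitz φ) :
    ∃ C : ℝ, ∀ l m : ℕ, 1 ≤ l → 1 ≤ m →
      Integrable (fun ω => 𝓜.estimator φ m (fun k => X l k ω)) P' ∧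
      |∫ ω, (𝓜.estimator φ m (fun k => X l k ω) -
          (𝓜.posteriorExp T l φ - 𝓜.posteriorExp T (l - 1) φ)) ∂P'|
        ≤ C * (VolterraMCMC.step l : ℝ) ^ β / m := by
  have hVm : ∀ θ t, Measurable (V θ t) := fun θ t => ((hV θ).adapted t).mono (ℱ.le t) le_rfl
  obtain ⟨c, c', hc, hcc, hlik⟩ := hA1.exists_lik_bounds T
  obtain ⟨B, hB⟩ := hφ.bdd
  obtain ⟨ξ, hξ₀, hξ₁, hmin⟩ := hA3.minorization
  obtain ⟨C₁, hC₁0, hC₁⟩ := exists_integral_sq_H_sub_le hβ₀ hβ₁ h𝓜 hW hVm hA1 hA2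
  obtain ⟨C₂, hC₂0, hC₂⟩ := exists_integral_sq_mul_H_sub_le hβ₀ hβ₁ h𝓜 hW hVm hA1 hA2 hφ
  have hc'0 : 0 < c' := hc.trans_le hcc
  -- The factor `(c' / c) ^ T` pays for passing from the prior to the stationary law; the sum `C₁ +
  -- C₂` lets one `D` serve for numerators and denominators.
  set E : ℝ := (c' / c) ^ T * (C₁ + C₂) with hE
  have hE0 : 0 ≤ E := by positivity
  set δ : ℝ := (c / c') ^ T with hδ
  have hδ0 : 0 < δ := by positivity
  -- `max B 1` bounds the weighted test functions and also the correction factors, `δ` is the lower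
  -- bound of `H₁` and `H₂`, and `√E` turns the mean square rate into the `L²` discrepancy `D`.
  refine ⟨ratioBiasConst (max B 1) δ ξ * √E, fun l m hl hm => ?_⟩
  obtain ⟨l, rfl⟩ := Nat.exists_eq_add_of_le' hl
  rw [Nat.add_sub_cancel]
  obtain ⟨ν, hν, hνmin⟩ := hmin (l + 1) hl
  have hηp := hA3.prob (l + 1) hl
  obtain ⟨κ, hκM, hκ⟩ := exists_transitionKernel h𝓜 hA1 hT hN (hq (l + 1)) (l + 1)
  have hκf : 𝓜.transition (q (l + 1)) = fun x => κ x := funext fun x => (hκ x).symm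
  have hX' : IsMarkovChain P' (η (l + 1)) κ (X (l + 1)) := by
    have := hX (l + 1) hl
    rwa [hκf] at this
  -- Reversibility enters through invariance alone; the spectral estimate comes from the
  -- minorization.
  have hinv : Kernel.Invariant κ (η (l + 1)) := by
    refine Kernel.IsReversible.invariant (fun A B' hA hB' => ?_)
    have := hA3.reversible (l + 1) hl A B' hA hB'
    rwa [hκf] at this
  have hκmin : ∀ x, ENNReal.ofReal ξ • ν ≤ κ x := fun x => (hνmin x).trans (hκ x).symm.le
  have hη := map_returned_of_reversible h𝓜 hA1 hT hN (hq (l + 1)) hκ hinv hξ₀ hξ₁ hκmin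
  have hH₁ := H₁_bounds hc hlik hcc (l + 1)
  have hH₂ := H₂_bounds hc hlik hcc (l + 1)
  have habs : ∀ {a x : ℝ}, |a| ≤ B → δ ≤ x ∧ x ≤ 1 → |a * x| ≤ max B 1 := fun ha hx => by
    rw [abs_mul, abs_of_nonneg (hδ0.le.trans hx.1)]
    exact (mul_le_of_le_one_right (abs_nonneg _) hx.2).trans (ha.trans (le_max_left _ _))
  have habs1 : ∀ {x : ℝ}, δ ≤ x ∧ x ≤ 1 → |x| ≤ max B 1 := fun hx => by
    rw [abs_of_nonneg (hδ0.le.trans hx.1)]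
    exact hx.2.trans (le_max_right _ _)
  have hs : (0 : ℝ) < step (l + 1) := step_pos _
  set D : ℝ := √E * (step (l + 1) : ℝ) ^ β with hD
  have hD0 : 0 ≤ D := by positivity
  have hD2 : D ^ 2 = E * (step (l + 1) : ℝ) ^ (2 * β) := by
    rw [hD, mul_pow, Real.sq_sqrt hE0, ← Real.rpow_natCast (_ ^ β) 2, ← Real.rpow_mul hs.le]
    congr 2; push_cast; ring
  have hle : ∀ {C : ℝ}, C ≤ C₁ + C₂ →
      (c' / c) ^ T * (C * (step (l + 1) : ℝ) ^ (2 * β)) ≤ D ^ 2 := fun hC => by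
    rw [hD2, hE, mul_assoc]
    gcongr
  have m₁ := (h𝓜.measurable_phi hφ (l + 1)).mul (h𝓜.measurable_H₁ hA1 (l + 1))
  have m₂ := (h𝓜.measurable_coarse_phi hφ l).mul (h𝓜.measurable_H₂ hA1 (l + 1))
  have hout : Measurable fun x : State Θ T N (l + 1) => (x.1, output x.2) :=
    measurable_fst.prodMk (measurable_output.comp measurable_snd)
  have hfD := (integral_sq_output_le h𝓜 hA1 hW hη hc hcc hlik m₁ m₂
    ((dependsOnFirst_skeleton T (l + 1) φ).mul (dependsOnFirst_H₁ T l))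
    ((dependsOnFirst_coarse_skeleton T l φ).mul (dependsOnFirst_H₂ T l))
    (B := max B 1) (fun p => habs (hB _ _) (hH₁ _ _)) (fun p => habs (hB _ _) (hH₂ _ _))
    (fun θ => by
      simp only [Pi.mul_apply, coarsen_incr]
      exact hC₂ l θ)).trans (hle (by linarith))
  have hgD := (integral_sq_output_le h𝓜 hA1 hW hη hc hcc hlik (h𝓜.measurable_H₁ hA1 (l + 1))
    (h𝓜.measurable_H₂ hA1 (l + 1)) (dependsOnFirst_H₁ T l) (dependsOnFirst_H₂ T l)
    (B := max B 1) (fun p => habs1 (hH₁ _ _)) (fun p => habs1 (hH₂ _ _))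
    (hC₁ l)).trans (hle (by linarith))
  obtain ⟨hint, hbias⟩ := hX'.abs_integral_ratio_sub_le hinv hξ₀ hξ₁ hκmin
    (m₁.comp hout) (m₂.comp hout) ((h𝓜.measurable_H₁ hA1 (l + 1)).comp hout)
    ((h𝓜.measurable_H₂ hA1 (l + 1)).comp hout)
    (fun x => habs (hB _ _) (hH₁ _ _)) (fun x => habs (hB _ _) (hH₂ _ _)) hδ0
    (fun x => hH₁ _ _) (fun x => hH₂ _ _) hD0 hfD hgD m
  refine ⟨hint, ?_⟩
  have e₁ := posteriorExp_fine_eq h𝓜 hA1 hW hη hφ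
  have e₂ := posteriorExp_coarse_eq h𝓜 hA1 hW hη hφ
  rw [← e₁, ← e₂]
  refine hbias.trans ?_
  have hm0 : (0 : ℝ) < m := by exact_mod_cast hm
  -- The sign is read off the bound itself, which dominates an absolute value. It is needed to
  -- replace `m + 1` by `m` in the denominator.
  have hr : 0 ≤ ratioBiasConst (max B 1) δ ξ * D := by
    have := (abs_nonneg _).trans hbias
    rw [le_div_iff₀ (by positivity), zero_mul] at this
    exact this
  calc _ ≤ ratioBiasConst (max B 1) δ ξ * D / m :=
        div_le_div_of_nonneg_left hr hm0 (by linarith)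
    _ = _ := by rw [hD, mul_assoc]
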